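/- **Conventions.** A *commutative convexoid ring* is a commutative monoid $(A,\cdot,1)$ with a binary operation $\boxplus$, a unary operation $-$ and a constant $0$ such that $(a\boxplus b)\boxplus(c\boxplus d)=(a\boxplus c)\boxplus(b\boxplus d)$, $-(a\boxplus b)=(-a)\boxplus(-b)$, $0\boxplus0=0$, $-0=0$, $a\boxplus b=b\boxplus a$, $a\boxplus(-a)=0$, and multiplication is compatible with $\boxplus$, $-$, $0$ in each variable. Its fundamental constant is $\gamma_A=1\boxplus 0$. Let $R_0\subset\mathbb Z[\gamma]$ be the smallest subset containing $0,1$ and closed under $fg$, $-f$ and $f\boxplus g:=\gamma(f+g)$, graded by $\deg\gamma=1$. $\operatorname{Proj}R_0$ is the space of homogeneous prime ideals of $R_0$ not containing $(R_0)_+$ (an ideal being homogeneous if an element lies in it exactly when all its homogeneous components do), with basis of open sets $D_+(f)$, $f$ homogeneous; $\mathcal O(d)$ is the sheaf of functions with values in the localizations that are locally fractions $a/b$ with $a,b$ homogeneous and $\deg a=\deg b+d$, and $\mathcal O=\mathcal O(0)$ is a sheaf of commutative monoids with absorbing element. Let $\mathbb F_{1^2}=\{0,\pm1\}$. $\mathbb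 P^{n}_{\mathbb F_{1^2}}$ is the $\operatorname{Proj}$ (primes of the monoid not containing all coordinates, with the sheaf of local homogeneous fractions of degree $0$) of the graded monoid $\mathbb F_{1^2}[x_1,\dots,x_{n+1}]=\{0\}\cup\{\pm x_1^{a_1}\cdots x_{n+1}^{a_{n+1}}\}$. A *weak scheme over $\mathbb F_1$* is a coherent (spectral) space $X$ with a sheaf $\mathcal O_X$ of commutative monoids with absorbing element and a support morphism $\beta_X:\Omega\mathcal O_X\to\tau_X$, where $\Omega(M)$ is the distributive lattice of finitely generated ideals of $M$ up to equality of radicals and $\tau_X(U)$ is the lattice of quasi-compact open subsets of $U$, such that for $V\subset U$ every $f\in\mathcal O_X(U)$ with $\beta_X((f))\supset V$ becomes invertible in $\mathcal O_X(V)$. Morphisms are quasi-compact morphisms of monoid-valued spaces which are local on stalks. Weak schemes over $\mathbb F_{1^2}$ are weak schemes over $\mathbb F_1$ with a morphism to $\operatorname{Spec}\mathbb F_{1^2}$. An *immersion* is a morphism which is a homeomorphism onto its image (with the subspace topology) and is surjective on all stalks. **Theorem.** $R_0$ is the initial object of the category of commutative convexoid rings whose fundamental constant is a non-zero-divisor (i.e.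 multiplication by it is injective). $\operatorname{Proj}R_0$ and the spaces $\mathbb P^{2^d-1}_{\mathbb F_{1^2}}$ are weak schemes over $\mathbb F_{1^2}$, and: 1. For every integer $d\ge1$, $\mathcal O(d)$ is a line bundle on $\operatorname{Proj}R_0$ and gives, through its global sections $s_l=l\gamma^d$ ($1\le l\le 2^d$), a morphism of monoid-valued spaces $f_d:\operatorname{Proj}R_0\to\mathbb P^{2^d-1}_{\mathbb F_{1^2}}$: there is exactly one morphism $f_d$ of weak schemes over $\mathbb F_{1^2}$ such that, for all $l,n$, the open set $f_d^{-1}(D_+(x_n))$ is the locus where $s_n$ generates $\mathcal O(d)$, and there $f_d^{*}(x_l/x_n)\,s_n=s_l$. 2. The product $\mathbb P=\prod_{d\ge1}\mathbb P^{2^d-1}_{\mathbb F_{1^2}}$ over $\mathbb F_{1^2}$ exists in the category of weak schemes over $\mathbb F_1$ (that is, as a product in the category of weak schemes over $\mathbb F_{1^2}$), and the morphism $f=(f_d)_{d\ge1}:\operatorname{Proj}R_0\to\mathbb P$ is an immersion. -/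

import Mathlib

open CategoryTheory CategoryTheory.Limits TopologicalSpace Opposite AlgebraicGeometry

universe u

/-- The category of commutative monoids with an absorbing element `0`
and the maps preserving `0`, `1` and products. -/
structure CMnd₀ : Type (u + 1) where
  of ::
  carrier : Type u
  [str : CommMonoidWithZero carrier]

namespace CMnd₀

attribute [instance] CMnd₀.str

instance : CoeSort CMnd₀.{u} (Type u) := ⟨CMnd₀.carrier⟩

structure Hom (A B : CMnd₀.{u}) where
  hom : A →*₀ B

instance : Category CMnd₀.{u} where
  Hom A B := Hom A B
  id A := ⟨MonoidWithZeroHom.id A⟩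
  comp f g := ⟨g.hom.comp f.hom⟩

instance : ConcreteCategory CMnd₀.{u} (fun A B => A →*₀ B) where
  hom f := f.hom
  ofHom f := ⟨f⟩

abbrev ofHom {A B : Type u} [CommMonoidWithZero A] [CommMonoidWithZero B] (f : A →*₀ B) :
    of A ⟶ of B :=
  ConcreteCategory.ofHom (C := CMnd₀.{u}) f

section Limits

variable {J : Type u} [SmallCategory J] (F : J ⥤ CMnd₀.{u})

def sectionsSubmonoid : Submonoid (∀ j, F.obj j) where
  carrier := {s | ∀ ⦃i j : J⦄ (f : i ⟶ j), F.map f (s i) = s j}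
  one_mem' _ _ f := map_one (ConcreteCategory.hom (F.map f))
  mul_mem' ha hb _ _ f := by
    have h := map_mul (ConcreteCategory.hom (F.map f))
    simp only [Pi.mul_apply, h, ha f, hb f]

instance : CommMonoidWithZero (sectionsSubmonoid F) where
  zero := ⟨0, fun _ _ f => map_zero (ConcreteCategory.hom (F.map f))⟩
  zero_mul _ := Subtype.ext (zero_mul _)
  mul_zero _ := Subtype.ext (mul_zero _)

def limitCone : Cone F where
  pt := of (sectionsSubmonoid F)
  π :=
    { app := fun j => ConcreteCategory.ofHom (C := CMnd₀.{u})
        { toFun := fun s => s.1 j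
          map_zero' := rfl
          map_one' := rfl
          map_mul' := fun _ _ => rfl }
      naturality := fun i j f => by
        apply ConcreteCategory.hom_ext
        intro s
        exact (s.2 f).symm }

def limitConeIsLimit : IsLimit (limitCone F) where
  lift s := ConcreteCategory.ofHom (C := CMnd₀.{u})
    { toFun := fun x => ⟨fun j => s.π.app j x, fun i j f => by
        rw [← ConcreteCategory.comp_apply, s.w f]⟩
      map_zero' := Subtype.ext (funext fun j => map_zero (ConcreteCategory.hom (s.π.app j)))
      map_one' := Subtype.ext (funext fun j => map_one (ConcreteCategory.hom (s.π.app j)))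
      map_mul' := fun a b =>
        Subtype.ext (funext fun j => map_mul (ConcreteCategory.hom (s.π.app j)) a b) }
  fac s j := by
    apply ConcreteCategory.hom_ext
    intro x
    rfl
  uniq s m hm := by
    apply ConcreteCategory.hom_ext
    intro x
    refine Subtype.ext (funext fun j => ?_)
    change _ = s.π.app j x
    rw [← hm j]
    rfl

noncomputable def limitConeForgetIsLimit : IsLimit ((forget CMnd₀.{u}).mapCone (limitCone F)) := by
  refine (Types.isLimit_iff _).2 (fun s hs => ?_) |>.some
  refine ⟨⟨s, fun i j f => hs f⟩, fun j => rfl, fun t ht => ?_⟩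
  exact Subtype.ext (funext fun j => ht j)

instance : HasLimits CMnd₀.{u} where
  has_limits_of_shape _ _ := ⟨fun F => ⟨⟨limitCone F, limitConeIsLimit F⟩⟩⟩

instance : PreservesLimits (forget CMnd₀.{u}) where
  preservesLimitsOfShape :=
    { preservesLimit := fun {F} => preservesLimit_of_preserves_limit_cone
        (limitConeIsLimit F) (limitConeForgetIsLimit F) }

end Limits

instance : (forget CMnd₀.{u}).ReflectsIsomorphisms where
  reflects {A B} f hf := by
    have hb : Function.Bijective f := (isIso_iff_bijective ((forget CMnd₀.{u}).map f)).1 hf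
    let e : A ≃* B := MulEquiv.ofBijective f.hom hb
    refine ⟨ConcreteCategory.ofHom (C := CMnd₀.{u}) ⟨⟨e.symm, map_zero e.symm⟩, map_one e.symm,
      map_mul e.symm⟩, ?_, ?_⟩
    · apply ConcreteCategory.hom_ext
      intro x
      exact e.symm_apply_apply x
    · apply ConcreteCategory.hom_ext
      intro x
      exact e.apply_symm_apply x

end CMnd₀

section Omega

variable {M N : Type u} [CommMonoidWithZero M] [CommMonoidWithZero N]

/-- The ideal of `M` generated by `s`: all multiples of elements of `s`, and `0`. -/
def idealSpan (s : Set M) : Set M := {a | a = 0 ∨ ∃ g ∈ s, g ∣ a}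

def idealRadical (I : Set M) : Set M := {a | ∃ n : ℕ, a ^ n ∈ I}

theorem subset_radical_span (s : Set M) : s ⊆ idealRadical (idealSpan s) :=
  fun a ha => ⟨1, Or.inr ⟨a, ha, by rw [pow_one]⟩⟩

theorem mul_mem_radical_span {s : Set M} {a : M} (ha : a ∈ idealRadical (idealSpan s)) (b : M) :
    a * b ∈ idealRadical (idealSpan s) := by
  obtain ⟨n, hn⟩ := ha
  refine ⟨n, ?_⟩
  rw [mul_pow]
  rcases hn with hn | ⟨g, hg, hd⟩
  · exact Or.inl (by rw [hn, zero_mul])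
  · exact Or.inr ⟨g, hg, hd.mul_right _⟩

variable (M) in
/-- The distributive lattice `Ω(M)` of finitely generated ideals of `M` modulo `𝔞² = 𝔞`. Two
finitely generated ideals are identified exactly when they have the same radical, so a class is
represented by its radical; union and intersection of sets are then the join (sum) and the meet
(product) of ideals. -/
def Omega : Sublattice (Set M) where
  carrier := {I | ∃ s : Set M, s.Finite ∧ I = idealRadical (idealSpan s)}
  supClosed' := by
    rintro _ ⟨s, hs, rfl⟩ _ ⟨t, ht, rfl⟩
    refine ⟨s ∪ t, hs.union ht, ?_⟩
    ext a
    constructor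
    · rintro (⟨n, h | ⟨g, hg, h⟩⟩ | ⟨n, h | ⟨g, hg, h⟩⟩)
      · exact ⟨n, Or.inl h⟩
      · exact ⟨n, Or.inr ⟨g, Or.inl hg, h⟩⟩
      · exact ⟨n, Or.inl h⟩
      · exact ⟨n, Or.inr ⟨g, Or.inr hg, h⟩⟩
    · rintro ⟨n, h | ⟨g, hg | hg, h⟩⟩
      · exact Or.inl ⟨n, Or.inl h⟩
      · exact Or.inl ⟨n, Or.inr ⟨g, hg, h⟩⟩
      · exact Or.inr ⟨n, Or.inr ⟨g, hg, h⟩⟩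
  infClosed' := by
    rintro _ ⟨s, hs, rfl⟩ _ ⟨t, ht, rfl⟩
    refine ⟨Set.image2 (· * ·) s t, hs.image2 _ ht, ?_⟩
    ext a
    constructor
    · rintro ⟨⟨n, h⟩, ⟨m, h'⟩⟩
      refine ⟨n + m, ?_⟩
      rw [pow_add]
      rcases h with h | ⟨g, hg, h⟩
      · exact Or.inl (by rw [h, zero_mul])
      · rcases h' with h' | ⟨g', hg', h'⟩
        · exact Or.inl (by rw [h', mul_zero])
        · exact Or.inr ⟨g * g', ⟨g, hg, g', hg', rfl⟩, mul_dvd_mul h h'⟩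
    · rintro ⟨n, h | ⟨_, ⟨g, hg, g', hg', rfl⟩, h⟩⟩
      · exact ⟨⟨n, Or.inl h⟩, ⟨n, Or.inl h⟩⟩
      · exact ⟨⟨n, Or.inr ⟨g, hg, (Dvd.intro _ rfl).trans h⟩⟩,
          ⟨n, Or.inr ⟨g', hg', (Dvd.intro_left _ rfl).trans h⟩⟩⟩

namespace Omega

/-- The class of the ideal generated by a finite set. -/
def span (s : Set M) (hs : s.Finite) : Omega M := ⟨idealRadical (idealSpan s), s, hs, rfl⟩

/-- The class of the principal ideal `(a)`. -/
def principal (a : M) : Omega M := span {a} (Set.finite_singleton a)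

instance : BoundedOrder (Omega M) where
  bot := span ∅ Set.finite_empty
  bot_le := by
    rintro ⟨_, s, hs, rfl⟩ a ⟨n, h | ⟨g, hg, -⟩⟩
    · exact ⟨n, Or.inl h⟩
    · exact hg.elim
  top := principal 1
  le_top := fun _ a _ => ⟨1, Or.inr ⟨1, rfl, one_dvd _⟩⟩

/-- Functoriality of `Ω`: an ideal is sent to the ideal generated by its image. -/
def map (φ : M →*₀ N) (I : Omega M) : Omega N :=
  ⟨idealRadical (idealSpan (φ '' I)), by
    obtain ⟨_, s, hs, rfl⟩ := I
    refine ⟨φ '' s, hs.image φ, ?_⟩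
    ext a
    constructor
    · rintro ⟨n, h | ⟨_, ⟨g, ⟨m, hg⟩, rfl⟩, h⟩⟩
      · exact ⟨n, Or.inl h⟩
      · refine ⟨n * m, ?_⟩
        have h' := pow_dvd_pow_of_dvd h m
        rw [← pow_mul, ← map_pow] at h'
        rcases hg with hg | ⟨g', hg', hg⟩
        · rw [hg, map_zero] at h'
          exact Or.inl (zero_dvd_iff.1 h')
        · exact Or.inr ⟨φ g', ⟨g', hg', rfl⟩, (map_dvd φ hg).trans h'⟩
    · rintro ⟨n, h | ⟨_, ⟨g, hg, rfl⟩, h⟩⟩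
      · exact ⟨n, Or.inl h⟩
      · exact ⟨n, Or.inr ⟨φ g, ⟨g, subset_radical_span s hg, rfl⟩, h⟩⟩⟩

theorem mul_mem (I : Omega M) {a : M} (ha : a ∈ I.1) (b : M) : a * b ∈ I.1 := by
  obtain ⟨_, s, hs, rfl⟩ := I
  exact mul_mem_radical_span ha b

end Omega

end Omega

/-- Monoid-valued spaces: topological spaces with a sheaf of commutative monoids with absorbing
element. -/
abbrev MonoidSpace := SheafedSpace.{1, 0, 0} CMnd₀.{0}

namespace MonoidSpace

variable {X Y Z : MonoidSpace}

abbrev Sec (X : MonoidSpace) (U : Opens X) : Type := X.presheaf.obj (op U)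

def res {U V : Opens X} (h : V ≤ U) : Sec X U →*₀ Sec X V :=
  (X.presheaf.map (homOfLE h).op).hom

theorem res_res {U V W : Opens X} (h : V ≤ U) (h' : W ≤ V) (s : Sec X U) :
    res h' (res h s) = res (h'.trans h) s := by
  change X.presheaf.map _ (X.presheaf.map _ s) = X.presheaf.map _ s
  rw [← ConcreteCategory.comp_apply, ← Functor.map_comp]
  rfl

/-- The preimage of an open set. -/
abbrev preim (f : X ⟶ Y) (V : Opens Y) : Opens X := (Opens.map f.hom.base).obj V

/-- The map on sections `𝒪_Y(V) → 𝒪_X(f⁻¹V)`. -/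
def comap (f : X ⟶ Y) (V : Opens Y) : Sec Y V →*₀ Sec X (preim f V) :=
  (f.hom.c.app (op V)).hom

theorem comap_res (f : X ⟶ Y) {U V : Opens Y} (h : V ≤ U) (s : Sec Y U) :
    comap f V (res h s) =
      res (show preim f V ≤ preim f U from fun _ hx => h hx) (comap f U s) := by
  have := f.hom.c.naturality (homOfLE h).op
  exact congrArg (fun k => CMnd₀.Hom.hom k s) this

/-- The germ of `s` at `x` is a unit of the stalk. -/
def UnitAt {U : Opens X} (s : Sec X U) (x : X) : Prop :=
  ∃ (V : Opens X) (h : V ≤ U), x ∈ V ∧ IsUnit (res h s)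

/-- `f` is local: the preimage of the maximal ideal (the set of non-units) of each stalk
`𝒪_{X,x}` is the maximal ideal of `𝒪_{Y,f(x)}`. -/
def IsLocal (f : X ⟶ Y) : Prop :=
  ∀ (V : Opens Y) (t : Sec Y V) (x : X), x ∈ preim f V →
    UnitAt (comap f V t) x → UnitAt t (f.hom.base x)

/-- The map of stalks `𝒪_{Y,f(x)} → 𝒪_{X,x}` is surjective for all `x`: every germ at `x` is the
germ of the pullback of a section defined near `f(x)`. -/
def IsStalkSurjective (f : X ⟶ Y) : Prop :=
  ∀ (x : X) (U : Opens X) (s : Sec X U), x ∈ U →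
    ∃ (V : Opens Y) (t : Sec Y V) (W : Opens X) (hU : W ≤ U) (hV : W ≤ preim f V),
      x ∈ W ∧ res hV (comap f V t) = res hU s

theorem UnitAt.res {U V : Opens X} {s : Sec X U} {x : X} (hs : UnitAt s x) (h : V ≤ U)
    (hx : x ∈ V) : UnitAt (res h s) x := by
  obtain ⟨W, hW, hxW, hu⟩ := hs
  refine ⟨W ⊓ V, inf_le_right, ⟨hxW, hx⟩, ?_⟩
  have := hu.map (MonoidSpace.res (inf_le_left : W ⊓ V ≤ W))
  rwa [res_res] at this ⊢

theorem UnitAt.of_res {U V : Opens X} {s : Sec X U} {x : X} (h : V ≤ U)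
    (hs : UnitAt (MonoidSpace.res h s) x) : UnitAt s x := by
  obtain ⟨W, hW, hxW, hu⟩ := hs
  exact ⟨W, hW.trans h, hxW, by rwa [res_res] at hu⟩

theorem UnitAt.mul {U : Opens X} {s t : Sec X U} {x : X} (hs : UnitAt s x) (ht : UnitAt t x) :
    UnitAt (s * t) x := by
  obtain ⟨V, hV, hxV, hu⟩ := hs
  obtain ⟨W, hW, hxW, hu'⟩ := ht
  refine ⟨V ⊓ W, inf_le_left.trans hV, ⟨hxV, hxW⟩, ?_⟩
  rw [map_mul]
  have h1 := hu.map (MonoidSpace.res (inf_le_left : V ⊓ W ≤ V))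
  have h2 := hu'.map (MonoidSpace.res (inf_le_right : V ⊓ W ≤ W))
  rw [res_res] at h1 h2
  exact h1.mul h2

theorem UnitAt.pow {U : Opens X} {s : Sec X U} {x : X} (hs : UnitAt s x) (n : ℕ) :
    UnitAt (s ^ n) x := by
  obtain ⟨V, hV, hxV, hu⟩ := hs
  exact ⟨V, hV, hxV, by rw [map_pow]; exact hu.pow n⟩

theorem UnitAt.of_dvd {U : Opens X} {s t : Sec X U} {x : X} (hs : UnitAt s x) (h : t ∣ s) :
    UnitAt t x := by
  obtain ⟨V, hV, hxV, hu⟩ := hs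
  exact ⟨V, hV, hxV, isUnit_of_dvd_unit (map_dvd (MonoidSpace.res hV) h) hu⟩

theorem unitAt_one {U : Opens X} {x : X} (hx : x ∈ U) : UnitAt (1 : Sec X U) x :=
  ⟨U, le_rfl, hx, by rw [map_one]; exact isUnit_one⟩

theorem UnitAt.comap {f : X ⟶ Y} {V : Opens Y} {t : Sec Y V} {x : X}
    (ht : UnitAt t (f.hom.base x)) : UnitAt (comap f V t) x := by
  obtain ⟨W, hW, hxW, hu⟩ := ht
  refine ⟨preim f W, fun _ hx => hW hx, hxW, ?_⟩
  have := hu.map (MonoidSpace.comap f W)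
  rwa [comap_res] at this

theorem isOpen_unitAt {U : Opens X} (s : Sec X U) : IsOpen {x | UnitAt s x} := by
  rw [isOpen_iff_forall_mem_open]
  rintro x ⟨V, hV, hxV, hu⟩
  exact ⟨V, fun y hy => ⟨V, hV, hy, hu⟩, V.2, hxV⟩

theorem UnitAt.mem {U : Opens X} {s : Sec X U} {x : X} (hs : UnitAt s x) : x ∈ U := by
  obtain ⟨V, hV, hxV, -⟩ := hs
  exact hV hxV

/-- Two sections that agree near each point agree. -/
theorem sec_ext {U : Opens X} {s t : Sec X U}
    (h : ∀ x ∈ U, ∃ (V : Opens X) (hV : V ≤ U), x ∈ V ∧ res hV s = res hV t) : s = t := by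
  choose V hV hxV hst using fun x : U => h x.1 x.2
  refine (X.sheaf).eq_of_locally_eq' V U (fun x => homOfLE (hV x)) ?_ s t (fun x => hst x)
  intro x hx
  exact Opens.mem_iSup.2 ⟨⟨x, hx⟩, hxV ⟨x, hx⟩⟩

/-- A section all of whose germs are units is a unit. -/
theorem isUnit_of_unitAt {U : Opens X} (s : Sec X U) (h : ∀ x ∈ U, UnitAt s x) : IsUnit s := by
  choose V hV hxV hu using fun x : U => h x.1 x.2
  choose t ht using fun x : U => (hu x).exists_right_inv
  obtain ⟨r, hr, -⟩ := (X.sheaf).existsUnique_gluing' V U (fun x => homOfLE (hV x))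
    (fun x hx => Opens.mem_iSup.2 ⟨⟨x, hx⟩, hxV ⟨x, hx⟩⟩) t (by
      intro i j
      change res (inf_le_left : V i ⊓ V j ≤ V i) (t i) = res (inf_le_right : V i ⊓ V j ≤ V j) (t j)
      have h1 := congrArg (res (inf_le_left : V i ⊓ V j ≤ V i)) (ht i)
      have h2 := congrArg (res (inf_le_right : V i ⊓ V j ≤ V j)) (ht j)
      rw [map_mul, map_one, res_res] at h1 h2
      generalize res (inf_le_left : V i ⊓ V j ≤ V i) (t i) = a at *
      generalize res (inf_le_right : V i ⊓ V j ≤ V j) (t j) = b at *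
      calc a = a * (res _ s * b) := by rw [h2, mul_one]
        _ = b * (res _ s * a) := by ac_rfl
        _ = b := by rw [h1, mul_one])
  have hr' : ∀ x, res (hV x) (show Sec X U from r) = t x := hr
  refine IsUnit.of_mul_eq_one (show Sec X U from r) (sec_ext fun x hx => ⟨V ⟨x, hx⟩, hV _, hxV ⟨x, hx⟩, ?_⟩)
  rw [map_mul, map_one, hr']
  exact ht _

/-- A support morphism `β : Ω𝒪_X → τ_X` of a monoid-valued space: compatible homomorphisms of
bounded distributive lattices from `Ω(𝒪_X(U))` to the lattice of quasi-compact open subsets of `U`,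
for all quasi-compact open `U`, such that the restriction `𝒪_X(U) → 𝒪_X(V)` factors through the
localization of `𝒪_X(U)` by `{f | V ≤ β_U(f)}`, that is, makes all these `f` invertible.
(A morphism into the sheaf `τ_X` from the sheafification of `U ↦ Ω(𝒪_X(U))` is the same as a
morphism from this presheaf.) -/
structure SupportMorphism (X : MonoidSpace) where
  supp : ∀ U : Opens X, IsCompact (U : Set X) → Omega (Sec X U) → Opens X
  supp_le : ∀ (U : Opens X) hU I, supp U hU I ≤ U
  isCompact_supp : ∀ (U : Opens X) hU I, IsCompact (supp U hU I : Set X)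
  supp_bot : ∀ (U : Opens X) hU, supp U hU ⊥ = ⊥
  supp_top : ∀ (U : Opens X) hU, supp U hU ⊤ = U
  supp_sup : ∀ (U : Opens X) hU I J, supp U hU (I ⊔ J) = supp U hU I ⊔ supp U hU J
  supp_inf : ∀ (U : Opens X) hU I J, supp U hU (I ⊓ J) = supp U hU I ⊓ supp U hU J
  supp_res : ∀ (U : Opens X) hU (V : Opens X) hV (h : V ≤ U) I,
    supp V hV (Omega.map (res h) I) = supp U hU I ⊓ V
  isUnit_res : ∀ (U : Opens X) hU (V : Opens X) (_ : IsCompact (V : Set X)) (h : V ≤ U) (f : Sec X U),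
    V ≤ supp U hU (Omega.principal f) → IsUnit (res h f)

/-- The support morphism sending an ideal to the locus where it contains a unit. -/
def supportOfCompact (X : MonoidSpace)
    (h0 : ∀ (U : Opens X) (x : X), ¬ UnitAt (0 : Sec X U) x)
    (hc : ∀ U : Opens X, IsCompact (U : Set X) → ∀ f : Sec X U, IsCompact {x | UnitAt f x}) :
    SupportMorphism X where
  supp U _ I := ⟨{x | ∃ f ∈ I.1, UnitAt f x}, by
    have : {x | ∃ f ∈ I.1, UnitAt f x} = ⋃ f ∈ I.1, {x | UnitAt f x} := by ext; simp
    rw [this]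
    exact isOpen_biUnion fun f _ => isOpen_unitAt f⟩
  supp_le U _ I := by
    rintro x ⟨f, -, hx⟩
    exact hx.mem
  isCompact_supp U hU I := by
    obtain ⟨_, s, hs, rfl⟩ := I
    have : {x | ∃ f ∈ idealRadical (idealSpan s), UnitAt f x} = ⋃ f ∈ s, {x | UnitAt f x} := by
      ext x
      simp only [Set.mem_ofPred_eq, Set.mem_iUnion, exists_prop]
      constructor
      · rintro ⟨f, ⟨n, h | ⟨g, hg, h⟩⟩, hf⟩
        · exact (h0 U x (h ▸ hf.pow n)).elim
        · exact ⟨g, hg, (hf.pow n).of_dvd h⟩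
      · rintro ⟨f, hf, hx⟩
        exact ⟨f, subset_radical_span s hf, hx⟩
    change IsCompact {x | ∃ f ∈ idealRadical (idealSpan s), UnitAt f x}
    rw [this]
    exact hs.isCompact_biUnion fun f _ => hc U hU f
  supp_bot U hU := by
    rw [eq_bot_iff]
    rintro x ⟨f, ⟨n, h | ⟨g, hg, -⟩⟩, hf⟩
    · exact (h0 U x (h ▸ hf.pow n)).elim
    · exact hg.elim
  supp_top U hU := by
    apply le_antisymm
    · rintro x ⟨f, -, hx⟩
      exact hx.mem
    · intro x hx
      exact ⟨1, ⟨1, Or.inr ⟨1, rfl, one_dvd _⟩⟩, unitAt_one hx⟩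
  supp_sup U hU I J := by
    ext x
    constructor
    · rintro ⟨f, hf | hf, hx⟩
      · exact Or.inl ⟨f, hf, hx⟩
      · exact Or.inr ⟨f, hf, hx⟩
    · rintro (⟨f, hf, hx⟩ | ⟨f, hf, hx⟩)
      · exact ⟨f, Or.inl hf, hx⟩
      · exact ⟨f, Or.inr hf, hx⟩
  supp_inf U hU I J := by
    ext x
    constructor
    · rintro ⟨f, hf, hx⟩
      exact ⟨⟨f, hf.1, hx⟩, ⟨f, hf.2, hx⟩⟩
    · rintro ⟨⟨f, hf, hx⟩, ⟨g, hg, hx'⟩⟩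
      exact ⟨f * g, ⟨Omega.mul_mem I hf g, mul_comm g f ▸ Omega.mul_mem J hg f⟩, hx.mul hx'⟩
  supp_res U hU V hV h I := by
    ext x
    constructor
    · rintro ⟨f, ⟨n, hf | ⟨_, ⟨g, hg, rfl⟩, hd⟩⟩, hx⟩
      · exact (h0 V x (hf ▸ hx.pow n)).elim
      · exact ⟨⟨g, hg, ((hx.pow n).of_dvd hd).of_res h⟩, hx.mem⟩
    · rintro ⟨⟨f, hf, hx⟩, hxV⟩
      exact ⟨res h f, subset_radical_span _ ⟨f, hf, rfl⟩, hx.res h hxV⟩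
  isUnit_res U hU V hV h f hf := by
    apply isUnit_of_unitAt
    intro x hx
    obtain ⟨g, ⟨n, hg | ⟨_, rfl, hd⟩⟩, hxg⟩ := hf hx
    · exact (h0 U x (hg ▸ hxg.pow n)).elim
    · exact ((hxg.pow n).of_dvd hd).res h hx

end MonoidSpace

open MonoidSpace

/-- A weak scheme over `𝔽₁`: a coherent (= spectral) space with a sheaf of commutative monoids with
absorbing element and a support morphism. -/
structure WeakScheme where
  space : MonoidSpace
  spectral : SpectralSpace space
  support : SupportMorphism space

namespace WeakScheme

/-- A morphism of weak schemes over `𝔽₁`: a quasi-compact local morphism of monoid-valued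
spaces. -/
@[ext]
structure Hom (X Y : WeakScheme) where
  map : X.space ⟶ Y.space
  isSpectralMap : IsSpectralMap map.hom.base
  isLocal : IsLocal map

instance : Category WeakScheme where
  Hom X Y := Hom X Y
  id X :=
    { map := 𝟙 X.space
      isSpectralMap := isSpectralMap_id
      isLocal := fun _ _ _ _ h => h }
  comp f g :=
    { map := f.map ≫ g.map
      isSpectralMap := g.isSpectralMap.comp f.isSpectralMap
      isLocal := fun V t x hx h =>
        g.isLocal V t _ hx (f.isLocal _ (comap g.map V t) x hx h) }
  id_comp f := Hom.ext (Category.id_comp f.map)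
  comp_id f := Hom.ext (Category.comp_id f.map)
  assoc f g h := Hom.ext (Category.assoc f.map g.map h.map)

/-- Immersions: embeddings of the underlying spaces that are surjective on all stalks. -/
def IsImmersion {X Y : WeakScheme} (f : X ⟶ Y) : Prop :=
  Topology.IsEmbedding (Hom.map f).hom.base ∧ IsStalkSurjective (Hom.map f)

end WeakScheme

/-- A graded commutative monoid `M` with absorbing element, together with a topological space whose
points are labelled by prime ideals of `M` and in which the loci `{x | a ∉ prime x}`, `a`
homogeneous, are open. -/
structure ProjDatum where
  M : Type
  [commMonoidWithZero : CommMonoidWithZero M]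
  ι : Type
  [addMonoid : AddMonoid ι]
  /-- The homogeneous elements of degree `i` (the element `0` is homogeneous of every degree). -/
  part : ι → Set M
  zero_mem_part : ∀ i, 0 ∈ part i
  one_mem_part : 1 ∈ part 0
  mul_mem_part : ∀ {i j a b}, a ∈ part i → b ∈ part j → a * b ∈ part (i + j)
  pt : Type
  [topologicalSpace : TopologicalSpace pt]
  prime : pt → Set M
  zero_mem_prime : ∀ x, 0 ∈ prime x
  mul_mem_prime : ∀ {x a} b, a ∈ prime x → a * b ∈ prime x
  one_notMem_prime : ∀ x, 1 ∉ prime x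
  mem_or_mem : ∀ {x a b}, a * b ∈ prime x → a ∈ prime x ∨ b ∈ prime x
  isOpen_basic : ∀ {i a}, a ∈ part i → IsOpen {x | a ∉ prime x}

namespace ProjDatum

attribute [instance] commMonoidWithZero addMonoid topologicalSpace

variable (D : ProjDatum)

/-- The homogeneous elements outside the prime ideal of `x`. -/
def den (x : D.pt) : Submonoid D.M where
  carrier := {s | s ∉ D.prime x ∧ ∃ i, s ∈ D.part i}
  one_mem' := ⟨D.one_notMem_prime x, 0, D.one_mem_part⟩
  mul_mem' := by
    rintro a b ⟨ha, i, hi⟩ ⟨hb, j, hj⟩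
    exact ⟨fun h => (D.mem_or_mem h).elim ha hb, i + j, D.mul_mem_part hi hj⟩

abbrev Loc (x : D.pt) : Type := Localization (D.den x)

/-- Functions given by one homogeneous fraction `a / b` of degree `e`. -/
def fracPred (e : D.ι) : TopCat.PrelocalPredicate (X := TopCat.of D.pt) D.Loc where
  pred {U} s := ∃ i, ∃ a ∈ D.part (i + e), ∃ b ∈ D.part i,
    ∀ x : U, ∃ hb : b ∈ D.den x.1, s x = Localization.mk a ⟨b, hb⟩
  res := by
    rintro U V i s ⟨n, a, ha, b, hb, h⟩
    exact ⟨n, a, ha, b, hb, fun x => h ⟨x.1, i.le x.2⟩⟩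

/-- The sheaf `𝒪(e)`: its sections over `U` are the functions `s` on `U` with `s(x)` in the
localization of `M` at the prime of `x`, which are locally homogeneous fractions of degree `e`. -/
def twist (e : D.ι) : TopCat.Sheaf Type (TopCat.of D.pt) :=
  TopCat.subsheafToTypes (D.fracPred e).sheafify

abbrev TwistSec (e : D.ι) (U : Opens D.pt) : Type :=
  {s : ∀ x : U, D.Loc x.1 // (D.fracPred e).sheafify.pred (U := U) s}

variable {D} in
theorem mul_mem_twist {e : D.ι} {U : Opens D.pt} {s t : ∀ x : U, D.Loc x.1}
    (hs : (D.fracPred 0).sheafify.pred (U := U) s) (ht : (D.fracPred e).sheafify.pred (U := U) t) :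
    (D.fracPred e).sheafify.pred (U := U) (s * t) := by
  intro x
  obtain ⟨V, hxV, iV, i, a, ha, b, hb, hab⟩ := hs x
  obtain ⟨W, hxW, iW, j, c, hc, d, hd, hcd⟩ := ht x
  refine ⟨V ⊓ W, ⟨hxV, hxW⟩, Opens.infLELeft V W ≫ iV, i + j, a * c, ?_, b * d,
    D.mul_mem_part hb hd, ?_⟩
  · rw [add_zero] at ha
    rw [add_assoc]
    exact D.mul_mem_part ha hc
  · intro y
    obtain ⟨h1, h1'⟩ := hab ⟨y.1, y.2.1⟩
    obtain ⟨h2, h2'⟩ := hcd ⟨y.1, y.2.2⟩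
    refine ⟨(D.den y.1).mul_mem h1 h2, ?_⟩
    exact (congrArg₂ (· * ·) h1' h2').trans (Localization.mk_mul _ _ _ _)

/-- The sections of the structure sheaf `𝒪 = 𝒪(0)`, as a submonoid of the monoid of functions. -/
def sections (U : Opens D.pt) : Submonoid (∀ x : U, D.Loc x.1) where
  carrier := {s | (D.fracPred 0).sheafify.pred (U := U) s}
  one_mem' := fun x => ⟨U, x.2, 𝟙 U, 0, 1, by simpa using D.one_mem_part, 1, D.one_mem_part,
    fun y => ⟨(D.den y.1).one_mem, Localization.mk_one.symm⟩⟩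
  mul_mem' := mul_mem_twist

instance (U : Opens D.pt) : CommMonoidWithZero (D.sections U) where
  zero := ⟨0, fun x => ⟨U, x.2, 𝟙 U, 0, 0, D.zero_mem_part _, 1, D.one_mem_part,
    fun y => ⟨(D.den y.1).one_mem, (Localization.mk_zero _).symm⟩⟩⟩
  zero_mul _ := Subtype.ext (zero_mul _)
  mul_zero _ := Subtype.ext (mul_zero _)

def structurePresheaf : TopCat.Presheaf CMnd₀.{0} (TopCat.of D.pt) where
  obj U := CMnd₀.of (D.sections U.unop)
  map {U V} i := CMnd₀.ofHom
    { toFun := fun s => ⟨fun x => s.1 ⟨x.1, i.unop.le x.2⟩, (D.fracPred 0).sheafify.res i.unop s.1 s.2⟩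
      map_zero' := rfl
      map_one' := rfl
      map_mul' := fun _ _ => rfl }

/-- The monoid-valued space of a datum: its space with the sheaf of functions that are locally
fractions `a / b` of homogeneous elements of the same degree. -/
def space : MonoidSpace where
  carrier := TopCat.of D.pt
  presheaf := D.structurePresheaf
  IsSheaf := by
    rw [TopCat.Presheaf.isSheaf_iff_isSheaf_comp (forget CMnd₀.{0})]
    exact (D.twist 0).property

variable {D}

/-- The section `a / b` of `𝒪(e)` over an open set on which `b` does not vanish. -/
def frac {i e : D.ι} (a b : D.M) (ha : a ∈ D.part (i + e)) (hb : b ∈ D.part i) (U : Opens D.pt)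
    (hU : ∀ x ∈ U, b ∉ D.prime x) : D.TwistSec e U :=
  ⟨fun x => Localization.mk a ⟨b, hU x.1 x.2, i, hb⟩, fun x =>
    ⟨U, x.2, 𝟙 U, i, a, ha, b, hb, fun y => ⟨⟨hU y.1 y.2, i, hb⟩, rfl⟩⟩⟩

/-- The open set `D₊(a)`. -/
def basicOpen {i : D.ι} (a : D.M) (ha : a ∈ D.part i) : Opens D.pt :=
  ⟨{x | a ∉ D.prime x}, D.isOpen_basic ha⟩

/-- The action of `𝒪` on `𝒪(e)`. -/
def act {e : D.ι} {U : Opens D.pt} (r : D.sections U) (s : D.TwistSec e U) : D.TwistSec e U :=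
  ⟨r.1 * s.1, mul_mem_twist r.2 s.2⟩

def TwistSec.res {e : D.ι} {U V : Opens D.pt} (h : V ≤ U) (s : D.TwistSec e U) : D.TwistSec e V :=
  ⟨fun x => s.1 ⟨x.1, h x.2⟩, (D.fracPred e).sheafify.res (homOfLE h) s.1 s.2⟩

/-- `s` generates `𝒪(e)` freely over `U`: multiplication by `s` is an isomorphism
`𝒪 ≅ 𝒪(e)` over `U`. -/
def IsGenerator {e : D.ι} {U : Opens D.pt} (s : D.TwistSec e U) : Prop :=
  ∀ (V : Opens D.pt) (h : V ≤ U), Function.Bijective fun r : D.sections V => act r (s.res h)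

/-- `s` generates `𝒪(e)` near the point `x`. -/
def GeneratesAt {e : D.ι} {U : Opens D.pt} (s : D.TwistSec e U) (x : D.pt) : Prop :=
  ∃ (V : Opens D.pt) (h : V ≤ U), x ∈ V ∧ IsGenerator (s.res h)

variable (D) in
/-- `𝒪(e)` is a line bundle: an `𝒪`-module locally isomorphic to `𝒪`. -/
def IsLineBundle (e : D.ι) : Prop :=
  ∀ x : D.pt, ∃ (U : Opens D.pt) (s : D.TwistSec e U), x ∈ U ∧ IsGenerator s

theorem not_unitAt_zero (U : Opens D.pt) (x : D.pt) :
    ¬ UnitAt (X := D.space) (0 : Sec D.space U) x := by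
  rintro ⟨(V : Opens D.pt), h, hx, hu⟩
  rw [map_zero] at hu
  obtain ⟨r, hr⟩ : ∃ r : D.sections V, (0 : D.sections V) * r = 1 := hu.exists_right_inv
  have h1 : (0 : D.Loc x) * r.1 ⟨x, hx⟩ = 1 := congrFun (congrArg Subtype.val hr) ⟨x, hx⟩
  rw [zero_mul, ← Localization.mk_one, ← Localization.mk_zero 1, Localization.mk_eq_mk_iff,
    Localization.r_iff_exists] at h1
  obtain ⟨c, hc⟩ := h1
  simp only [mul_zero, OneMemClass.coe_one, mul_one] at hc
  exact c.2.1 (hc ▸ D.zero_mem_prime x)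

variable (D) in
/-- The weak scheme over `𝔽₁` of a datum whose space is spectral and noetherian. -/
def toWeakScheme [SpectralSpace D.pt] [NoetherianSpace D.pt] : WeakScheme where
  space := D.space
  spectral := inferInstanceAs (SpectralSpace D.pt)
  support := supportOfCompact D.space not_unitAt_zero fun _ _ _ =>
    NoetherianSpace.isCompact (α := D.pt) _

/-- A homomorphism of graded monoids with a continuous map of spaces in the opposite direction
which corresponds to taking preimages of prime ideals. -/
structure Hom (E D : ProjDatum) where
  hom : D.M →*₀ E.M
  deg : D.ι → E.ι
  map_part : ∀ {i a}, a ∈ D.part i → hom a ∈ E.part (deg i)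
  base : E.pt → D.pt
  continuous_base : Continuous base
  mem_prime_base : ∀ x {i a}, a ∈ D.part i → (a ∈ D.prime (base x) ↔ hom a ∈ E.prime x)

namespace Hom

variable {E : ProjDatum} (f : Hom E D)

theorem map_den (x : E.pt) (s : D.den (f.base x)) : f.hom s ∈ E.den x := by
  obtain ⟨s, hs, i, hi⟩ := s
  exact ⟨fun h => hs ((f.mem_prime_base x hi).2 h), f.deg i, f.map_part hi⟩

/-- The induced map of local monoids `a / b ↦ f(a) / f(b)`. -/
noncomputable def locMap (x : E.pt) : D.Loc (f.base x) →* E.Loc x :=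
  (Localization.monoidOf (D.den (f.base x))).map (g := f.hom.toMonoidHom) (f.map_den x)
    (Localization.monoidOf (E.den x))

theorem locMap_mk (x : E.pt) (a : D.M) (b : D.den (f.base x)) :
    f.locMap x (Localization.mk a b) = Localization.mk (f.hom a) ⟨f.hom b, f.map_den x b⟩ := by
  rw [Localization.mk_eq_monoidOf_mk', Localization.mk_eq_monoidOf_mk']
  exact Submonoid.LocalizationMap.map_mk' _ _ _ _

theorem locMap_zero (x : E.pt) : f.locMap x 0 = 0 := by
  rw [← Localization.mk_zero 1, locMap_mk, map_zero, Localization.mk_zero]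

/-- The preimage of an open set. -/
def preim (U : Opens D.pt) : Opens E.pt := ⟨f.base ⁻¹' U, U.2.preimage f.continuous_base⟩

noncomputable def sectionsMap (U : Opens D.pt) : D.sections U →*₀ E.sections (f.preim U) where
  toFun s := ⟨fun x => f.locMap x.1 (s.1 ⟨f.base x.1, x.2⟩), by
    intro x
    obtain ⟨V, hxV, iV, i, a, ha, b, hb, hab⟩ := s.2 ⟨f.base x.1, x.2⟩
    rw [add_zero] at ha
    refine ⟨f.preim V, hxV, homOfLE fun y hy => iV.le hy, f.deg i, f.hom a, ?_, f.hom b,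
      f.map_part hb, ?_⟩
    · rw [add_zero]
      exact f.map_part ha
    · intro y
      obtain ⟨h, h'⟩ := hab ⟨f.base y.1, y.2⟩
      exact ⟨f.map_den y.1 ⟨b, h⟩, (congrArg (f.locMap y.1) h').trans (f.locMap_mk _ _ _)⟩⟩
  map_zero' := Subtype.ext (funext fun x => f.locMap_zero x.1)
  map_one' := Subtype.ext (funext fun x => map_one (f.locMap x.1))
  map_mul' s t := Subtype.ext (funext fun x => map_mul (f.locMap x.1) _ _)

/-- The induced morphism of monoid-valued spaces. -/
noncomputable def toSpaceHom : E.space ⟶ D.space :=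
  InducedCategory.homMk
    { base := TopCat.ofHom ⟨f.base, f.continuous_base⟩
      c := { app := fun U => CMnd₀.ofHom (f.sectionsMap U.unop)
             naturality := fun _ _ _ => rfl } }

theorem isLocal_toSpaceHom : IsLocal f.toSpaceHom := by
  rintro (U : Opens D.pt) (t : D.sections U) (x : E.pt) hx ⟨(V : Opens E.pt), hV, hxV, hu⟩
  obtain ⟨r, hr⟩ : ∃ r : E.sections V, _ * r = 1 := hu.exists_right_inv
  have h1 : f.locMap x (t.1 ⟨f.base x, hx⟩) * r.1 ⟨x, hxV⟩ = 1 :=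
    congrFun (congrArg Subtype.val hr) ⟨x, hxV⟩
  obtain ⟨W, hxW, iW, i, a, ha, b, hb, hab⟩ := t.2 ⟨f.base x, hx⟩
  rw [add_zero] at ha
  obtain ⟨h, h'⟩ := hab ⟨f.base x, hxW⟩
  have h2 : t.1 ⟨f.base x, hx⟩ = Localization.mk a ⟨b, h⟩ := h'
  have hax : a ∉ D.prime (f.base x) := by
    rw [f.mem_prime_base x ha]
    intro hfa
    generalize r.1 ⟨x, hxV⟩ = z at h1
    induction z using Localization.induction_on with
    | H y =>
      obtain ⟨c, s⟩ := y
      rw [h2, locMap_mk, Localization.mk_mul, ← Localization.mk_one, Localization.mk_eq_mk_iff,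
        Localization.r_iff_exists] at h1
      obtain ⟨k, hk⟩ := h1
      simp only [OneMemClass.coe_one, one_mul, mul_one] at hk
      have hmem : (k : E.M) * (f.hom a * c) ∈ E.prime x := by
        rw [mul_comm]
        exact E.mul_mem_prime _ (E.mul_mem_prime _ hfa)
      rw [hk] at hmem
      rcases E.mem_or_mem hmem with h3 | h3
      · exact k.2.1 h3
      · exact ((⟨_, f.map_den x ⟨b, h⟩⟩ : E.den x) * s).2.1 h3
  refine ⟨W ⊓ basicOpen a ha, inf_le_left.trans iW.le, ⟨hxW, hax⟩, ?_⟩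
  let inv : D.sections (W ⊓ basicOpen a ha) :=
    frac (e := 0) b a (by rwa [add_zero]) ha _ fun y hy => hy.2
  refine IsUnit.of_mul_eq_one (show Sec D.space (W ⊓ basicOpen a ha) from inv) ?_
  refine Subtype.ext (funext fun y => ?_)
  obtain ⟨h3, h3'⟩ := hab ⟨y.1, y.2.1⟩
  change t.1 ⟨y.1, _⟩ * Localization.mk b ⟨a, _⟩ = 1
  have h4 : t.1 ⟨y.1, iW.le y.2.1⟩ = Localization.mk a ⟨b, h3⟩ := h3'
  rw [h4, Localization.mk_mul, ← Localization.mk_one, Localization.mk_eq_mk_iff,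
    Localization.r_iff_exists]
  exact ⟨1, by simp [mul_comm]⟩

/-- The induced morphism of weak schemes. -/
noncomputable def toWeakSchemeHom [SpectralSpace D.pt] [NoetherianSpace D.pt]
    [SpectralSpace E.pt] [NoetherianSpace E.pt] : E.toWeakScheme ⟶ D.toWeakScheme where
  map := f.toSpaceHom
  isSpectralMap :=
    { toContinuous := f.continuous_base
      isCompact_preimage_of_isOpen := fun _ _ _ => NoetherianSpace.isCompact (α := E.pt) _ }
  isLocal := f.isLocal_toSpaceHom

end Hom

end ProjDatum

theorem quasiSober_of_finite (X : Type*) [TopologicalSpace X] [Finite X] : QuasiSober X where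
  sober {S} hS hS' := by
    obtain ⟨z, hz, hSz⟩ := isIrreducible_iff_sUnion_isClosed.1 hS
      ((S.toFinite.image fun x => closure {x}).toFinset) (by
        intro z hz
        obtain ⟨x, -, rfl⟩ := (Set.Finite.mem_toFinset _).1 hz
        exact isClosed_closure) (by
        intro x hx
        exact ⟨closure {x}, (Set.Finite.mem_toFinset _).2 ⟨x, hx, rfl⟩,
          subset_closure (Set.mem_singleton x)⟩)
    obtain ⟨x, hx, rfl⟩ := (Set.Finite.mem_toFinset _).1 hz
    refine ⟨x, le_antisymm ?_ hSz⟩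
    exact hS'.closure_subset_iff.2 (Set.singleton_subset_iff.2 hx)

/-- Prime ideals of a commutative monoid with absorbing element. -/
@[ext]
structure MonoidPrime (M : Type) [CommMonoidWithZero M] where
  carrier : Set M
  zero_mem : 0 ∈ carrier
  mul_mem : ∀ {a} b, a ∈ carrier → a * b ∈ carrier
  one_notMem : 1 ∉ carrier
  mem_or_mem : ∀ {a b}, a * b ∈ carrier → a ∈ carrier ∨ b ∈ carrier

namespace MonoidPrime

variable {M : Type} [CommMonoidWithZero M]

instance : TopologicalSpace (MonoidPrime M) :=
  TopologicalSpace.generateFrom {U | ∃ a : M, U = {p | a ∉ p.carrier}}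

theorem isOpen_basic (a : M) : IsOpen {p : MonoidPrime M | a ∉ p.carrier} :=
  TopologicalSpace.isOpen_generateFrom_of_mem ⟨a, rfl⟩

instance : T0Space (MonoidPrime M) where
  t0 p q h := by
    ext a
    exact not_iff_not.1 (h.mem_open_iff (isOpen_basic a))

instance [Finite M] : Finite (MonoidPrime M) :=
  Finite.of_injective MonoidPrime.carrier fun _ _ h => MonoidPrime.ext h

theorem mul_mem_iff (p : MonoidPrime M) {a b : M} :
    a * b ∈ p.carrier ↔ a ∈ p.carrier ∨ b ∈ p.carrier :=
  ⟨p.mem_or_mem, fun h => h.elim (p.mul_mem b) fun h => mul_comm b a ▸ p.mul_mem a h⟩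

end MonoidPrime

/-- The spectrum of a commutative monoid with absorbing element. -/
def specDatum (M : Type) [CommMonoidWithZero M] : ProjDatum where
  M := M
  ι := Unit
  part _ := Set.univ
  zero_mem_part _ := trivial
  one_mem_part := trivial
  mul_mem_part _ _ := trivial
  pt := MonoidPrime M
  prime p := p.carrier
  zero_mem_prime p := p.zero_mem
  mul_mem_prime {p _} b h := p.mul_mem b h
  one_notMem_prime p := p.one_notMem
  mem_or_mem {p _ _} h := p.mem_or_mem h
  isOpen_basic {_ a} _ := MonoidPrime.isOpen_basic a

/-- `𝔽_{1²} = {0, 1, -1}`. -/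
abbrev F12 : Type := WithZero ℤˣ

instance : Finite F12 := inferInstanceAs (Finite (Option ℤˣ))

instance : Finite (specDatum F12).pt := inferInstanceAs (Finite (MonoidPrime F12))

instance : SpectralSpace (specDatum F12).pt where
  __ : T0Space (specDatum F12).pt := inferInstanceAs (T0Space (MonoidPrime F12))
  __ := quasiSober_of_finite (specDatum F12).pt

/-- `Spec 𝔽_{1²}`. -/
def specF12 : WeakScheme := (specDatum F12).toWeakScheme

/-- The polynomial ring `𝔽_{1²}[x_i : i ∈ σ]`: the elements are `0` and `± ∏ x_i ^ a_i`. -/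
abbrev F12Poly (σ : Type) : Type := WithZero (ℤˣ × Multiplicative (σ →₀ ℕ))

namespace F12Poly

variable {σ : Type}

noncomputable def X (i : σ) : F12Poly σ :=
  ((1, Multiplicative.ofAdd (Finsupp.single i 1)) : ℤˣ × Multiplicative (σ →₀ ℕ))

/-- The monomials of degree `n`, and `0`. -/
def part (n : ℕ) : Set (F12Poly σ) :=
  {z | ∀ m : ℤˣ × Multiplicative (σ →₀ ℕ), z = m → Finsupp.degree m.2.toAdd = n}

theorem X_mem_part (i : σ) : X i ∈ part (σ := σ) 1 := by
  intro m hm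
  rw [← WithZero.coe_inj.1 hm]
  exact Finsupp.degree_single i 1

/-- The structure map `𝔽_{1²} → 𝔽_{1²}[x_i : i ∈ σ]`. -/
noncomputable def const : F12 →*₀ F12Poly σ := WithZero.map' (MonoidHom.inl _ _)

theorem zero_mem_part (n : ℕ) : (0 : F12Poly σ) ∈ part n := by
  intro m hm
  exact (WithZero.coe_ne_zero hm.symm).elim

theorem const_mem_part (a : F12) : const (σ := σ) a ∈ part 0 := by
  induction a using WithZero.recZeroCoe with
  | zero => rw [map_zero]; exact zero_mem_part 0
  | coe u =>
    intro m hm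
    rw [const, WithZero.map'_coe] at hm
    rw [← WithZero.coe_inj.1 hm]
    exact map_zero _

theorem mul_mem_part {i j : ℕ} {a b : F12Poly σ} (ha : a ∈ part i) (hb : b ∈ part j) :
    a * b ∈ part (i + j) := by
  induction a using WithZero.recZeroCoe with
  | zero => rw [zero_mul]; exact zero_mem_part _
  | coe a =>
    induction b using WithZero.recZeroCoe with
    | zero => rw [mul_zero]; exact zero_mem_part _
    | coe b =>
      intro m hm
      rw [← WithZero.coe_mul] at hm
      rw [← WithZero.coe_inj.1 hm, ← ha a rfl, ← hb b rfl]
      exact map_add Finsupp.degree _ _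

theorem mem_prime_iff (p : MonoidPrime (F12Poly σ)) (u : ℤˣ) (a : σ →₀ ℕ) :
    (((u, Multiplicative.ofAdd a) : ℤˣ × Multiplicative (σ →₀ ℕ)) : F12Poly σ) ∈ p.carrier ↔
      ∃ i, a i ≠ 0 ∧ X i ∈ p.carrier := by
  classical
  have hmul : ∀ (u v : ℤˣ) (a b : σ →₀ ℕ),
      (((u * v, Multiplicative.ofAdd (a + b)) : ℤˣ × Multiplicative (σ →₀ ℕ)) : F12Poly σ) =
        (((u, Multiplicative.ofAdd a) : ℤˣ × Multiplicative (σ →₀ ℕ)) : F12Poly σ) *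
        (((v, Multiplicative.ofAdd b) : ℤˣ × Multiplicative (σ →₀ ℕ)) : F12Poly σ) :=
    fun _ _ _ _ => rfl
  have hu : ∀ u : ℤˣ, (((u, Multiplicative.ofAdd 0) : ℤˣ × Multiplicative (σ →₀ ℕ)) :
      F12Poly σ) ∉ p.carrier := by
    intro u h
    have := p.mul_mem (((u⁻¹, Multiplicative.ofAdd 0) : ℤˣ × Multiplicative (σ →₀ ℕ)) :
      F12Poly σ) h
    rw [← hmul, mul_inv_cancel, add_zero] at this
    exact p.one_notMem this
  induction a using Finsupp.induction_linear generalizing u with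
  | zero => exact iff_of_false (hu u) (by simp)
  | add a b ha hb =>
    have := hmul u 1 a b
    rw [mul_one] at this
    rw [this, p.mul_mem_iff]
    refine (or_congr (ha u) (hb 1)).trans ?_
    simp only [Finsupp.add_apply, ne_eq, Nat.add_eq_zero_iff, not_and_or, or_and_right, exists_or]
  | single i n =>
    induction n with
    | zero => exact iff_of_false (by rw [Finsupp.single_zero]; exact hu u) (by simp)
    | succ n ih =>
      have := hmul u 1 (Finsupp.single i n) (Finsupp.single i 1)
      rw [mul_one, ← Finsupp.single_add] at this
      rw [this, p.mul_mem_iff]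
      refine (or_congr_left ih).trans ?_
      constructor
      · rintro (⟨j, hj, h⟩ | h)
        · have hij : i = j := by
            by_contra hne
            exact hj (Finsupp.single_eq_of_ne (Ne.symm hne))
          exact ⟨j, by simp [hij], h⟩
        · exact ⟨i, by simp, h⟩
      · rintro ⟨j, hj, h⟩
        have hij : i = j := by
          by_contra hne
          exact hj (Finsupp.single_eq_of_ne (Ne.symm hne))
        exact Or.inr (hij ▸ h)

end F12Poly

/-- `Proj 𝔽_{1²}[x_i : i ∈ σ]`, the projective space over `𝔽_{1²}` with homogeneous coordinates
indexed by `σ`: the prime ideals not containing all the `x_i`. -/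
noncomputable def projSpaceDatum (σ : Type) : ProjDatum where
  M := F12Poly σ
  ι := ℕ
  part := F12Poly.part
  zero_mem_part := F12Poly.zero_mem_part
  one_mem_part := F12Poly.const_mem_part 1
  mul_mem_part := F12Poly.mul_mem_part
  pt := {p : MonoidPrime (F12Poly σ) // ∃ i, F12Poly.X i ∉ p.carrier}
  prime p := p.1.carrier
  zero_mem_prime p := p.1.zero_mem
  mul_mem_prime {p _} b h := p.1.mul_mem b h
  one_notMem_prime p := p.1.one_notMem
  mem_or_mem {p _ _} h := p.1.mem_or_mem h
  isOpen_basic {_ a} _ := (MonoidPrime.isOpen_basic a).preimage continuous_subtype_val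

instance (σ : Type) [Finite σ] : Finite (projSpaceDatum σ).pt := by
  refine Finite.of_injective (β := Set σ) (fun p => {i | F12Poly.X i ∈ p.1.carrier}) ?_
  intro p q h
  refine Subtype.ext (MonoidPrime.ext (Set.ext fun a => ?_))
  induction a using WithZero.recZeroCoe with
  | zero => exact iff_of_true p.1.zero_mem q.1.zero_mem
  | coe a =>
    obtain ⟨u, a⟩ := a
    have hX : ∀ i, F12Poly.X i ∈ p.1.carrier ↔ F12Poly.X i ∈ q.1.carrier :=
      fun i => Set.ext_iff.1 h i
    refine (F12Poly.mem_prime_iff p.1 u a.toAdd).trans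
      (Iff.trans ?_ (F12Poly.mem_prime_iff q.1 u a.toAdd).symm)
    simp only [hX]

instance (σ : Type) [Finite σ] : SpectralSpace (projSpaceDatum σ).pt where
  __ : T0Space (projSpaceDatum σ).pt :=
    inferInstanceAs (T0Space {p : MonoidPrime (F12Poly σ) // ∃ i, F12Poly.X i ∉ p.carrier})
  __ := quasiSober_of_finite (projSpaceDatum σ).pt

/-- The structure morphism to `Spec 𝔽_{1²}` given by a homomorphism `𝔽_{1²} → M` into the degree
zero part. -/
def structureHom (D : ProjDatum) (φ : F12 →*₀ D.M) (hφ : ∀ a, φ a ∈ D.part 0) :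
    D.Hom (specDatum F12) where
  hom := φ
  deg _ := 0
  map_part {_ a} _ := hφ a
  base x :=
    { carrier := {a | φ a ∈ D.prime x}
      zero_mem := by
        change φ 0 ∈ D.prime x
        rw [map_zero]
        exact D.zero_mem_prime x
      mul_mem := fun {a} b h => by
        change φ (a * b) ∈ D.prime x
        rw [map_mul]
        exact D.mul_mem_prime _ h
      one_notMem := fun h => D.one_notMem_prime x (map_one φ ▸ h)
      mem_or_mem := fun {a b} h => D.mem_or_mem (map_mul φ a b ▸ h) }
  continuous_base := by
    refine continuous_generateFrom_iff.2 ?_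
    rintro _ ⟨a, rfl⟩
    exact D.isOpen_basic (hφ a)
  mem_prime_base _ _ _ _ := Iff.rfl

/-- The projective space over `𝔽_{1²}` with homogeneous coordinates indexed by the finite set `σ`,
as a weak scheme over `𝔽_{1²}`; for `σ = Fin (n + 1)` this is `ℙⁿ`. -/
noncomputable def projSpace (σ : Type) [Finite σ] : Over specF12 :=
  Over.mk (Y := (projSpaceDatum σ).toWeakScheme)
    (structureHom (projSpaceDatum σ) F12Poly.const F12Poly.const_mem_part).toWeakSchemeHom

open Polynomial in
/-- The smallest subset of `ℤ[γ]` containing `0` and `1` and closed under products, negation and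
`(f, g) ↦ γ (f + g)`. -/
inductive IsR0 : ℤ[X] → Prop
  | zero : IsR0 0
  | one : IsR0 1
  | mul {f g : ℤ[X]} : IsR0 f → IsR0 g → IsR0 (f * g)
  | box {f g : ℤ[X]} : IsR0 f → IsR0 g → IsR0 (X * (f + g))
  | neg {f : ℤ[X]} : IsR0 f → IsR0 (-f)

/-- A commutative convexoid ring: a commutative monoid object in the category of convexoids
`(A, ⊞, -, 0)`. -/
class CommConvexoidRing (A : Type u) extends CommMonoidWithZero A, Neg A where
  /-- The operation `a ⊞ b`. -/
  box : A → A → A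
  box_box_comm : ∀ a b c d : A, box (box a b) (box c d) = box (box a c) (box b d)
  neg_box : ∀ a b : A, -(box a b) = box (-a) (-b)
  box_zero_zero : box 0 0 = (0 : A)
  neg_zero : -(0 : A) = (0 : A)
  box_comm : ∀ a b : A, box a b = box b a
  box_neg : ∀ a : A, box a (-a) = 0
  mul_box : ∀ a b c : A, a * box b c = box (a * b) (a * c)
  mul_neg : ∀ a b : A, a * -b = -(a * b)

namespace CommConvexoidRing

/-- The fundamental constant `γ_A = 1 ⊞ 0`. -/
def gamma (A : Type u) [CommConvexoidRing A] : A := box 1 0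

/-- The fundamental constant of `A` is a non-zero-divisor: multiplication by it is injective. -/
def GammaRegular (A : Type u) [CommConvexoidRing A] : Prop :=
  Function.Injective fun a : A => gamma A * a

structure Hom (A : Type*) (B : Type*) [CommConvexoidRing A] [CommConvexoidRing B] extends
    A →*₀ B where
  map_box : ∀ a b : A, toFun (box a b) = box (toFun a) (toFun b)
  map_neg : ∀ a : A, toFun (-a) = -toFun a

/-- `A` is initial in the category of convexoid rings (commutative, with fundamental constant a
non-zero-divisor). -/
def IsInitialConvexoidRing (A : Type) [CommConvexoidRing A] : Prop :=
  GammaRegular A ∧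
    ∀ (B : Type u) [CommConvexoidRing B], GammaRegular B → Nonempty (Unique (Hom A B))

end CommConvexoidRing

/-- The convexoid ring `R₀ ⊆ ℤ[γ]`, with `f ⊞ g = γ (f + g)`. -/
def R0 : Type := {f : Polynomial ℤ // IsR0 f}

namespace R0

open Polynomial

noncomputable instance : CommConvexoidRing R0 where
  mul f g := ⟨f.1 * g.1, f.2.mul g.2⟩
  one := ⟨1, .one⟩
  zero := ⟨0, .zero⟩
  neg f := ⟨-f.1, f.2.neg⟩
  box f g := ⟨X * (f.1 + g.1), f.2.box g.2⟩
  mul_assoc _ _ _ := Subtype.ext (mul_assoc _ _ _)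
  one_mul _ := Subtype.ext (one_mul _)
  mul_one _ := Subtype.ext (mul_one _)
  mul_comm _ _ := Subtype.ext (mul_comm _ _)
  zero_mul _ := Subtype.ext (zero_mul _)
  mul_zero _ := Subtype.ext (mul_zero _)
  box_box_comm a b c d := Subtype.ext (by
    change X * (X * (a.1 + b.1) + X * (c.1 + d.1)) = X * (X * (a.1 + c.1) + X * (b.1 + d.1))
    ring)
  neg_box a b := Subtype.ext (by
    change -(X * (a.1 + b.1)) = X * (-a.1 + -b.1)
    ring)
  box_zero_zero := Subtype.ext (by
    change (X : ℤ[X]) * (0 + 0) = 0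
    ring)
  neg_zero := Subtype.ext (neg_zero (G := ℤ[X]))
  box_comm a b := Subtype.ext (by
    change X * (a.1 + b.1) = X * (b.1 + a.1)
    ring)
  box_neg a := Subtype.ext (by
    change X * (a.1 + -a.1) = 0
    ring)
  mul_box a b c := Subtype.ext (by
    change a.1 * (X * (b.1 + c.1)) = X * (a.1 * b.1 + a.1 * c.1)
    ring)
  mul_neg a b := Subtype.ext (by
    change a.1 * -b.1 = -(a.1 * b.1)
    ring)

theorem mul_val (f g : R0) : (f * g).1 = f.1 * g.1 := rfl

theorem isR0_monomial {n : ℕ} {m : ℤ} (h : |m| ≤ 2 ^ n) : IsR0 (monomial n m) := by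
  induction n generalizing m with
  | zero =>
    rw [pow_zero, abs_le] at h
    obtain rfl | rfl | rfl : m = -1 ∨ m = 0 ∨ m = 1 := by omega
    · exact (map_neg (monomial (R := ℤ) 0) 1) ▸ IsR0.one.neg
    · exact (map_zero (monomial (R := ℤ) 0)) ▸ IsR0.zero
    · exact IsR0.one
  | succ n ih =>
    rw [pow_succ, abs_le] at h
    have h1 := ih (m := m / 2) (by rw [abs_le]; omega)
    have h2 := ih (m := m - m / 2) (by rw [abs_le]; omega)
    have := h1.box h2
    rwa [← map_add, add_sub_cancel, X_mul_monomial] at this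

theorem abs_coeff_mul_le {f : ℤ[X]} (hf : IsR0 f) :
    ∀ g : ℤ[X], (∀ n, |g.coeff n| ≤ 2 ^ n) → ∀ n, |(f * g).coeff n| ≤ 2 ^ n := by
  induction hf with
  | zero => intro g _ n; simp
  | one => intro g hg n; simpa using hg n
  | mul _ _ ih ih' => intro g hg; rw [mul_assoc]; exact ih _ (ih' g hg)
  | neg _ ih => intro g hg n; simpa using ih g hg n
  | box _ _ ih ih' =>
    intro g hg n
    rw [mul_assoc]
    cases n with
    | zero => simp
    | succ n =>
      rw [coeff_X_mul, add_mul, coeff_add, pow_succ, mul_two]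
      exact (abs_add_le _ _).trans (add_le_add (ih g hg n) (ih' g hg n))

theorem abs_coeff_le (f : R0) (n : ℕ) : |f.1.coeff n| ≤ 2 ^ n := by
  have := abs_coeff_mul_le f.2 1 (fun n => by
    rw [coeff_one]
    split_ifs with h
    · simp [h]
    · simp) n
  rwa [mul_one] at this

/-- The element `m γⁿ`, `|m| ≤ 2ⁿ`. -/
noncomputable def mono (n : ℕ) (m : ℤ) (h : |m| ≤ 2 ^ n) : R0 := ⟨monomial n m, isR0_monomial h⟩

/-- The homogeneous component of degree `n`. -/
noncomputable def component (f : R0) (n : ℕ) : R0 := mono n (f.1.coeff n) (f.abs_coeff_le n)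

/-- The homogeneous elements of degree `n`; here `γ` has degree `1`. -/
def part (n : ℕ) : Set R0 := {f | ∃ m : ℤ, f.1 = monomial n m}

theorem zero_mem_part (n : ℕ) : (0 : R0) ∈ part n := ⟨0, (map_zero (monomial n)).symm⟩

theorem mul_mem_part {i j : ℕ} {f g : R0} (hf : f ∈ part i) (hg : g ∈ part j) :
    f * g ∈ part (i + j) := by
  obtain ⟨m, hm⟩ := hf
  obtain ⟨k, hk⟩ := hg
  exact ⟨m * k, by rw [mul_val, hm, hk, monomial_mul_monomial]⟩

theorem component_mem_part (f : R0) (n : ℕ) : component f n ∈ part n := ⟨_, rfl⟩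

theorem exists_mono {n : ℕ} {f : R0} (hf : f ∈ part n) : ∃ m h, f = mono n m h := by
  obtain ⟨m, hm⟩ := hf
  have h := f.abs_coeff_le n
  rw [hm, coeff_monomial_same] at h
  exact ⟨m, h, Subtype.ext hm⟩

end R0

open CommConvexoidRing in
/-- The points of `Proj R₀`: the homogeneous prime ideals of `R₀` not containing `(R₀)₊`. An ideal is
homogeneous if it contains an element exactly when it contains all its homogeneous components. -/
@[ext]
structure ProjR0 where
  carrier : Set R0
  zero_mem : 0 ∈ carrier
  neg_mem : ∀ {f}, f ∈ carrier → -f ∈ carrier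
  box_mem : ∀ {f g}, f ∈ carrier → g ∈ carrier → box f g ∈ carrier
  mul_mem : ∀ {f} g, f ∈ carrier → f * g ∈ carrier
  one_notMem : 1 ∉ carrier
  mem_or_mem : ∀ {f g}, f * g ∈ carrier → f ∈ carrier ∨ g ∈ carrier
  mem_iff_component : ∀ f, f ∈ carrier ↔ ∀ n, R0.component f n ∈ carrier
  not_subset : ¬ {f : R0 | f.1.coeff 0 = 0} ⊆ carrier

namespace ProjR0

open Polynomial R0 CommConvexoidRing

/-- The topology with basis the sets `D₊(f)`, `f` homogeneous. -/
instance : TopologicalSpace ProjR0 :=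
  TopologicalSpace.generateFrom {U | ∃ n, ∃ f ∈ part n, U = {p | f ∉ p.carrier}}

theorem isOpen_basic {n : ℕ} {f : R0} (hf : f ∈ part n) : IsOpen {p : ProjR0 | f ∉ p.carrier} :=
  TopologicalSpace.isOpen_generateFrom_of_mem ⟨n, f, hf, rfl⟩

theorem mul_mem_iff (p : ProjR0) {f g : R0} :
    f * g ∈ p.carrier ↔ f ∈ p.carrier ∨ g ∈ p.carrier :=
  ⟨p.mem_or_mem, fun h => h.elim (p.mul_mem g) fun h => mul_comm g f ▸ p.mul_mem f h⟩

theorem isTopologicalBasis : IsTopologicalBasis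
    {U : Set ProjR0 | ∃ n, ∃ f ∈ part n, U = {p | f ∉ p.carrier}} := by
  have h1 : {U : Set ProjR0 | ∃ n, ∃ f ∈ part n, U = {p | f ∉ p.carrier}} =
      insert Set.univ {U : Set ProjR0 | ∃ n, ∃ f ∈ part n, U = {p | f ∉ p.carrier}} := by
    refine Eq.symm (Set.insert_eq_of_mem ?_)
    refine ⟨0, 1, ⟨1, rfl⟩, ?_⟩
    ext p
    exact iff_of_true trivial p.one_notMem
  rw [h1]
  apply isTopologicalBasis_of_subbasis_of_inter rfl
  rintro _ ⟨n, f, hf, rfl⟩ _ ⟨m, g, hg, rfl⟩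
  refine ⟨n + m, f * g, mul_mem_part hf hg, ?_⟩
  ext p
  exact ((not_congr p.mul_mem_iff).trans not_or).symm

theorem ext_component {p q : ProjR0}
    (h : ∀ n, ∀ f ∈ part n, f ∈ p.carrier ↔ f ∈ q.carrier) : p = q := by
  refine ProjR0.ext (Set.ext fun f => ?_)
  rw [p.mem_iff_component, q.mem_iff_component]
  exact forall_congr' fun n => h n _ (component_mem_part f n)

instance : T0Space ProjR0 where
  t0 _ _ h := ext_component fun _ _ hf => not_iff_not.1 (h.mem_open_iff (isOpen_basic hf))

instance : QuasiSober ProjR0 where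
  sober {S} hS hS' := by
    obtain ⟨x₀, hx₀⟩ := hS.nonempty
    let p : ProjR0 :=
      { carrier := {f | ∀ x ∈ S, f ∈ x.carrier}
        zero_mem := fun x _ => x.zero_mem
        neg_mem := fun h x hx => x.neg_mem (h x hx)
        box_mem := fun h h' x hx => x.box_mem (h x hx) (h' x hx)
        mul_mem := fun g h x hx => x.mul_mem g (h x hx)
        one_notMem := fun h => x₀.one_notMem (h x₀ hx₀)
        mem_or_mem := fun {f g} h => by
          by_contra! hfg
          obtain ⟨⟨x, hx, hfx⟩, ⟨y, hy, hgy⟩⟩ :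
              (∃ x ∈ S, f ∉ x.carrier) ∧ ∃ y ∈ S, g ∉ y.carrier := by
            simpa using hfg
          rw [mem_iff_component, not_forall] at hfx hgy
          obtain ⟨i, hi⟩ := hfx
          obtain ⟨j, hj⟩ := hgy
          obtain ⟨z, hz, hzf, hzg⟩ := hS.isPreirreducible _ _
            (isOpen_basic (component_mem_part f i)) (isOpen_basic (component_mem_part g j))
            ⟨x, hx, hi⟩ ⟨y, hy, hj⟩
          rcases z.mem_or_mem (h z hz) with h1 | h1
          · exact hzf ((z.mem_iff_component f).1 h1 i)
          · exact hzg ((z.mem_iff_component g).1 h1 j)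
        mem_iff_component := fun f =>
          ⟨fun h n x hx => (x.mem_iff_component f).1 (h x hx) n,
            fun h x hx => (x.mem_iff_component f).2 fun n => h n x hx⟩
        not_subset := fun h => x₀.not_subset fun f hf => h hf x₀ hx₀ }
    refine ⟨p, le_antisymm ?_ fun x hx => ?_⟩
    · refine hS'.closure_subset_iff.2 (Set.singleton_subset_iff.2 ?_)
      by_contra hp
      obtain ⟨_, ⟨n, f, hf, rfl⟩, hpf, hfS⟩ :=
        isTopologicalBasis.exists_subset_of_mem_open (show p ∈ Sᶜ from hp) hS'.isOpen_compl
      obtain ⟨x, hx, hfx⟩ : ∃ x ∈ S, f ∉ x.carrier := by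
        by_contra! h
        exact hpf h
      exact hfS hfx hx
    · rw [isTopologicalBasis.mem_closure_iff]
      rintro _ ⟨n, f, hf, rfl⟩ hfx
      exact ⟨p, fun h => hfx (h x hx), rfl⟩

theorem mono_mul {n k : ℕ} {a b : ℤ} (ha hb) (h) :
    mono n a ha * mono k b hb = mono (n + k) (a * b) h :=
  Subtype.ext (monomial_mul_monomial _ _ _ _)

theorem abs_pow_le {n : ℕ} {m : ℤ} (h : |m| ≤ 2 ^ n) (k : ℕ) : |m ^ k| ≤ 2 ^ (n * k) := by
  rw [abs_pow, pow_mul]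
  exact pow_le_pow_left₀ (abs_nonneg m) h k

theorem mono_congr {n k : ℕ} {a b : ℤ} (hn : n = k) (hab : a = b) (h) (h') :
    mono n a h = mono k b h' := by
  subst hn hab
  rfl

theorem pow_mem_iff (p : ProjR0) {n : ℕ} {m : ℤ} (h : |m| ≤ 2 ^ n) {k : ℕ} (hk : k ≠ 0) :
    mono (n * k) (m ^ k) (abs_pow_le h k) ∈ p.carrier ↔ mono n m h ∈ p.carrier := by
  induction k with
  | zero => exact (hk rfl).elim
  | succ k ih =>
    have h1 : mono (n * (k + 1)) (m ^ (k + 1)) (abs_pow_le h (k + 1)) =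
        mono (n * k) (m ^ k) (abs_pow_le h k) * mono n m h := by
      rw [mono_mul _ _ (by rw [← pow_succ, ← Nat.mul_succ]; exact abs_pow_le h (k + 1))]
      exact mono_congr (by ring) (by ring) _ _
    rw [h1, mul_mem_iff]
    rcases Nat.eq_zero_or_pos k with rfl | hpos
    · refine or_iff_right fun h2 => p.one_notMem ?_
      convert! h2
      exact Subtype.ext (by simp [mono]; rfl)
    · rw [ih hpos.ne', or_self]

theorem one_abs_le (n : ℕ) : |(1 : ℤ)| ≤ 2 ^ n := by
  rw [abs_one]
  exact one_le_pow₀ (by norm_num)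

theorem two_mul_pow_le (a : ℕ) (ha : a ≠ 0) : 2 * (a : ℤ) ^ a ≤ (a + 1) ^ a := by
  have h := one_add_mul_le_pow (a := (1 / a : ℚ)) (by
    have : (0 : ℚ) ≤ 1 / a := by positivity
    linarith) a
  have ha' : (a : ℚ) ≠ 0 := by exact_mod_cast ha
  rw [mul_one_div_cancel ha'] at h
  have h2 : (1 + 1 / a : ℚ) ^ a * (a : ℚ) ^ a = ((a : ℚ) + 1) ^ a := by
    rw [← mul_pow]
    congr 1
    field_simp
  have h3 : (2 : ℚ) * (a : ℚ) ^ a ≤ ((a : ℚ) + 1) ^ a := by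
    rw [← h2]
    exact mul_le_mul_of_nonneg_right (by linarith) (by positivity)
  exact_mod_cast h3

theorem mono_mem_of_lt {p : ProjR0} (hp : mono 1 1 (one_abs_le 1) ∈ p.carrier) {n : ℕ} {m : ℤ}
    (h : |m| < 2 ^ n) : mono n m h.le ∈ p.carrier := by
  rcases eq_or_ne m 0 with rfl | hm
  · have : mono n 0 h.le = 0 := Subtype.ext (map_zero (monomial n))
    rw [this]
    exact p.zero_mem
  have hk : m.natAbs ≠ 0 := Int.natAbs_ne_zero.2 hm
  rw [← p.pow_mem_iff h.le hk]
  have hn : n ≠ 0 := by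
    rintro rfl
    rw [pow_zero, Int.abs_lt_one_iff] at h
    exact hm h
  have hnk : n * m.natAbs ≠ 0 := mul_ne_zero hn hk
  obtain ⟨N, hN⟩ := Nat.exists_eq_succ_of_ne_zero hnk
  have h1 : 2 * |m ^ m.natAbs| ≤ 2 ^ (N + 1) := by
    rw [← Nat.succ_eq_add_one, ← hN, abs_pow, pow_mul]
    have h2 := two_mul_pow_le _ hk
    rw [Int.natCast_natAbs] at h2
    refine h2.trans (pow_le_pow_left₀ (by positivity) (by omega) _)
  have h3 : |m ^ m.natAbs| ≤ 2 ^ N := by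
    rw [pow_succ] at h1
    omega
  have h4 : mono (n * m.natAbs) (m ^ m.natAbs) (abs_pow_le h.le _) =
      mono 1 1 (one_abs_le 1) * mono N (m ^ m.natAbs) h3 := by
    rw [mono_mul _ _ (by rw [add_comm, one_mul, ← Nat.succ_eq_add_one, ← hN]; exact abs_pow_le h.le _)]
    exact mono_congr (by omega) (by ring) _ _
  rw [h4]
  exact p.mul_mem _ hp

theorem neg_mono {n : ℕ} {m : ℤ} (h) (h') : -mono n m h = mono n (-m) h' :=
  Subtype.ext (map_neg (monomial n) m).symm

theorem neg_mem_iff (p : ProjR0) {f : R0} : -f ∈ p.carrier ↔ f ∈ p.carrier :=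
  ⟨fun h => by
    have := p.neg_mem h
    rwa [show -(-f) = f from Subtype.ext (neg_neg f.1)] at this, p.neg_mem⟩

theorem two_pow_abs_le (n : ℕ) : |(2 : ℤ) ^ n| ≤ 2 ^ n := by
  rw [abs_pow, abs_two]

/-- If `γ` lies in `p`, then no `(2γ)ⁿ` does. -/
theorem two_pow_notMem {p : ProjR0} (hp : mono 1 1 (one_abs_le 1) ∈ p.carrier) (n : ℕ) :
    mono n (2 ^ n) (two_pow_abs_le n) ∉ p.carrier := by
  have key : ∀ k, k ≠ 0 → (mono k (2 ^ k) (two_pow_abs_le k) ∈ p.carrier ↔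
      mono 1 2 (by norm_num) ∈ p.carrier) := by
    intro k hk
    have h2 : |(2 : ℤ)| ≤ 2 ^ 1 := by norm_num
    rw [← p.pow_mem_iff h2 hk]
    rw [mono_congr (one_mul k) rfl (abs_pow_le h2 k) (two_pow_abs_le k)]
  intro h
  rcases Nat.eq_zero_or_pos n with rfl | hn
  · exact p.one_notMem (by convert! h)
  rw [key n hn.ne'] at h
  refine p.not_subset fun f hf => ?_
  rw [mem_iff_component]
  intro k
  rcases Nat.eq_zero_or_pos k with rfl | hk
  · have : component f 0 = 0 := Subtype.ext (by
      change monomial 0 (f.1.coeff 0) = 0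
      rw [show f.1.coeff 0 = 0 from hf, map_zero])
    rw [this]
    exact p.zero_mem
  · rcases (f.abs_coeff_le k).lt_or_eq with h1 | h1
    · exact mono_mem_of_lt hp h1
    · rw [← key k hk.ne'] at h
      rcases eq_or_eq_neg_of_abs_eq h1 with h2 | h2
      · rwa [component, mono_congr rfl h2 _ (two_pow_abs_le k)]
      · rw [← neg_mem_iff, component, neg_mono _ (by rw [abs_neg]; exact f.abs_coeff_le k),
          mono_congr rfl (by rw [h2, neg_neg]) _ (two_pow_abs_le k)]
        exact h

theorem eq_of_gamma_mem {p q : ProjR0} (hp : mono 1 1 (one_abs_le 1) ∈ p.carrier)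
    (hq : mono 1 1 (one_abs_le 1) ∈ q.carrier) : p = q := by
  refine ext_component fun n f hf => ?_
  obtain ⟨m, h, rfl⟩ := exists_mono hf
  rcases h.lt_or_eq with h1 | h1
  · exact iff_of_true (mono_mem_of_lt hp h1) (mono_mem_of_lt hq h1)
  · have key : ∀ r : ProjR0, mono 1 1 (one_abs_le 1) ∈ r.carrier → mono n m h ∉ r.carrier := by
      intro r hr hm
      rcases eq_or_eq_neg_of_abs_eq h1 with h2 | h2
      · exact two_pow_notMem hr n (mono_congr rfl h2 h (two_pow_abs_le n) ▸ hm)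
      · rw [← neg_mem_iff, neg_mono _ (by rwa [abs_neg]),
          mono_congr rfl (by rw [h2, neg_neg]) _ (two_pow_abs_le n)] at hm
        exact two_pow_notMem hr n hm
    exact iff_of_false (key p hp) (key q hq)

theorem one_mono_notMem {p : ProjR0} (hp : mono 1 1 (one_abs_le 1) ∉ p.carrier) (n : ℕ) :
    mono n 1 (one_abs_le n) ∉ p.carrier := by
  rcases Nat.eq_zero_or_pos n with rfl | hn
  · exact p.one_notMem
  · have := (p.pow_mem_iff (one_abs_le 1) hn.ne').not.2 hp
    rwa [mono_congr (one_mul n) (one_pow n) _ (one_abs_le n)] at this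

theorem mono_mem_iff {p : ProjR0} (hp : mono 1 1 (one_abs_le 1) ∉ p.carrier) {n k : ℕ} {m : ℤ}
    (h : |m| ≤ 2 ^ n) (h' : |m| ≤ 2 ^ k) : mono n m h ∈ p.carrier ↔ mono k m h' ∈ p.carrier := by
  have key : ∀ (n k : ℕ) (h : |m| ≤ 2 ^ n) (h' : |m| ≤ 2 ^ k), mono n m h ∈ p.carrier →
      mono k m h' ∈ p.carrier := by
    intro n k h h' hm
    have hle : |m * 1| ≤ 2 ^ (n + k) := by
      rw [mul_one]
      exact h.trans (pow_le_pow_right₀ (by norm_num) (by omega))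
    have h1 := p.mul_mem (mono k 1 (one_abs_le k)) hm
    rw [mono_mul _ _ hle, mono_congr (add_comm n k) rfl _ (by rwa [add_comm]),
      ← mono_mul h' (one_abs_le n), mul_mem_iff] at h1
    exact h1.resolve_right (one_mono_notMem hp n)
  exact ⟨key n k h h', key k n h' h⟩

theorem exists_abs_le (m : ℤ) : ∃ n : ℕ, |m| ≤ 2 ^ n :=
  ⟨m.natAbs, by
    rw [← Int.natCast_natAbs]
    exact_mod_cast (Nat.lt_two_pow_self (n := m.natAbs)).le⟩

/-- A point outside `V(γ)` gives a prime ideal of `ℤ`. -/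
def toSpec (p : {p : ProjR0 // mono 1 1 (one_abs_le 1) ∉ p.carrier}) : PrimeSpectrum ℤ where
  asIdeal :=
    { carrier := {m | ∃ n h, mono n m h ∈ p.1.carrier}
      zero_mem' := ⟨0, by norm_num, by
        convert! p.1.zero_mem
        exact Subtype.ext (map_zero (monomial 0))⟩
      add_mem' := by
        rintro a b ⟨n, ha, ha'⟩ ⟨k, hb, hb'⟩
        have ha1 : |a| ≤ 2 ^ (n + k) := ha.trans (pow_le_pow_right₀ (by norm_num) (by omega))
        have hb1 : |b| ≤ 2 ^ (n + k) := hb.trans (pow_le_pow_right₀ (by norm_num) (by omega))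
        rw [mono_mem_iff p.2 ha ha1] at ha'
        rw [mono_mem_iff p.2 hb hb1] at hb'
        refine ⟨n + k + 1, ?_, ?_⟩
        · rw [pow_succ, mul_two]
          exact (abs_add_le a b).trans (add_le_add ha1 hb1)
        · convert! p.1.box_mem ha' hb'
          refine Subtype.ext ?_
          change monomial (n + k + 1) (a + b) = X * (monomial (n + k) a + monomial (n + k) b)
          rw [← map_add, X_mul_monomial]
      smul_mem' := by
        rintro c a ⟨n, ha, ha'⟩
        obtain ⟨k, hk⟩ := exists_abs_le c
        have h : |a * c| ≤ 2 ^ (n + k) := by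
          rw [abs_mul, pow_add]
          exact mul_le_mul ha hk (abs_nonneg c) (by positivity)
        have := p.1.mul_mem (mono k c hk) ha'
        rw [mono_mul _ _ h] at this
        have h' : |c • a| ≤ 2 ^ (n + k) := by rwa [smul_eq_mul, mul_comm]
        exact ⟨n + k, h', mono_congr rfl (mul_comm a c) h h' ▸ this⟩ }
  isPrime :=
    { ne_top' := by
        rw [Ideal.ne_top_iff_one]
        rintro ⟨n, h, h'⟩
        exact one_mono_notMem p.2 n h'
      mem_or_mem' := by
        rintro a b ⟨n, h, h'⟩
        obtain ⟨i, hi⟩ := exists_abs_le a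
        obtain ⟨j, hj⟩ := exists_abs_le b
        have hij : |a * b| ≤ 2 ^ (i + j) := by
          rw [abs_mul, pow_add]
          exact mul_le_mul hi hj (abs_nonneg b) (by positivity)
        rw [mono_mem_iff p.2 h hij, ← mono_mul hi hj, mul_mem_iff] at h'
        exact h'.imp (fun h => ⟨i, hi, h⟩) (fun h => ⟨j, hj, h⟩) }

theorem isInducing_toSpec : Topology.IsInducing toSpec := by
  have hmem : ∀ (p : {p : ProjR0 // mono 1 1 (one_abs_le 1) ∉ p.carrier}) (n : ℕ) (m : ℤ)
      (h : |m| ≤ 2 ^ n), mono n m h ∈ p.1.carrier ↔ m ∈ (toSpec p).asIdeal :=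
    fun p n m h => ⟨fun h' => ⟨n, h, h'⟩, fun ⟨k, hk, h'⟩ => (mono_mem_iff p.2 h hk).2 h'⟩
  constructor
  apply le_antisymm
  · rw [← continuous_iff_le_induced, PrimeSpectrum.isTopologicalBasis_basic_opens.continuous_iff]
    rintro _ ⟨m, rfl⟩
    obtain ⟨n, h⟩ := exists_abs_le m
    convert! (isOpen_basic (f := mono n m h) ⟨m, rfl⟩).preimage continuous_subtype_val
    ext p
    exact (hmem p n m h).not.symm
  · change _ ≤ TopologicalSpace.induced Subtype.val (TopologicalSpace.generateFrom _)
    rw [← continuous_iff_le_induced, continuous_generateFrom_iff]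
    rintro _ ⟨n, f, hf, rfl⟩
    obtain ⟨m, h, rfl⟩ := exists_mono hf
    refine isOpen_induced_iff.2 ⟨PrimeSpectrum.basicOpen m, (PrimeSpectrum.basicOpen m).2, ?_⟩
    ext p
    exact (hmem p n m h).not.symm

instance : NoetherianSpace ProjR0 := by
  have h1 : NoetherianSpace {p : ProjR0 | mono 1 1 (one_abs_le 1) ∉ p.carrier} :=
    isInducing_toSpec.noetherianSpace
  have h2 : Subsingleton {p : ProjR0 | mono 1 1 (one_abs_le 1) ∈ p.carrier} :=
    ⟨fun p q => Subtype.ext (eq_of_gamma_mem p.2 q.2)⟩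
  rw [noetherianSpace_iff_isCompact]
  intro s
  rw [noetherianSpace_set_iff] at h1
  have h3 : s = (s ∩ {p : ProjR0 | mono 1 1 (one_abs_le 1) ∉ p.carrier}) ∪
      (s ∩ {p : ProjR0 | mono 1 1 (one_abs_le 1) ∈ p.carrier}) := by
    ext p
    simp only [Set.mem_union, Set.mem_inter_iff, Set.mem_ofPred_eq]
    tauto
  rw [h3]
  refine (h1 _ Set.inter_subset_right).union (Set.Subsingleton.isCompact ?_)
  exact fun p hp q hq => eq_of_gamma_mem hp.2 hq.2

instance : SpectralSpace ProjR0 where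

end ProjR0

open R0 in
/-- The datum of `Proj R₀`: the space of homogeneous prime ideals of the graded monoid `R₀`. -/
noncomputable def projR0Datum : ProjDatum where
  M := R0
  ι := ℕ
  part := part
  zero_mem_part := zero_mem_part
  one_mem_part := ⟨1, rfl⟩
  mul_mem_part := mul_mem_part
  pt := ProjR0
  prime p := p.carrier
  zero_mem_prime p := p.zero_mem
  mul_mem_prime {p _} g h := p.mul_mem g h
  one_notMem_prime p := p.one_notMem
  mem_or_mem {p _ _} h := p.mem_or_mem h
  isOpen_basic h := ProjR0.isOpen_basic h

instance : SpectralSpace projR0Datum.pt := inferInstanceAs (SpectralSpace ProjR0)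

instance : NoetherianSpace projR0Datum.pt := inferInstanceAs (NoetherianSpace ProjR0)

namespace R0

/-- The inclusion `𝔽_{1²} = {0, ±1} → R₀`. -/
noncomputable def ofF12 : F12 →*₀ R0 :=
  WithZero.lift'
    { toFun := fun u => mono 0 u (by
        rw [pow_zero, Int.isUnit_iff_abs_eq.1 u.isUnit])
      map_one' := rfl
      map_mul' := fun u v => Subtype.ext (by
        change Polynomial.monomial 0 ((u * v : ℤˣ) : ℤ) =
          Polynomial.monomial 0 (u : ℤ) * Polynomial.monomial 0 (v : ℤ)
        rw [Units.val_mul, Polynomial.monomial_mul_monomial]) }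

theorem ofF12_mem_part (a : F12) : ofF12 a ∈ part 0 := by
  induction a using WithZero.recZeroCoe with
  | zero => rw [map_zero]; exact zero_mem_part 0
  | coe u => exact ⟨u, rfl⟩

end R0

/-- `Proj R₀` as a weak scheme over `𝔽_{1²}`. -/
noncomputable def projR0 : Over specF12 :=
  Over.mk (Y := projR0Datum.toWeakScheme)
    (structureHom projR0Datum R0.ofF12 R0.ofF12_mem_part).toWeakSchemeHom

theorem succ_abs_le {d : ℕ} (l : Fin (2 ^ d)) : |((l : ℕ) + 1 : ℤ)| ≤ 2 ^ d := by
  rw [abs_of_nonneg (by positivity)]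
  exact_mod_cast l.2

/-- The global section `l γᵈ` of `𝒪(d)` on `Proj R₀`, `1 ≤ l ≤ 2ᵈ` (numbered from `0` here). The
sections `± l γᵈ` and `0` are the degree `d` part of `R₀`. -/
noncomputable def linearSystem (d : ℕ) (l : Fin (2 ^ d)) :
    projR0Datum.TwistSec (show ℕ from d) ⊤ :=
  ProjDatum.frac (D := projR0Datum) (i := (0 : ℕ)) (e := (d : ℕ))
    (R0.mono d (l + 1) (succ_abs_le l)) (1 : R0)
    (by
      change _ ∈ R0.part (0 + d)
      rw [zero_add]
      exact ⟨_, rfl⟩)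
    ⟨1, rfl⟩ ⊤ fun x _ => ProjR0.one_notMem x

/-- The open set `D₊(x_n)` of the projective space. -/
noncomputable def coordOpen {σ : Type} (n : σ) : Opens (projSpaceDatum σ).pt :=
  ProjDatum.basicOpen (D := projSpaceDatum σ) (F12Poly.X n) (F12Poly.X_mem_part n)

/-- The section `x_l / x_n` of the structure sheaf over `D₊(x_n)`. -/
noncomputable def coord {σ : Type} (l n : σ) : Sec (projSpaceDatum σ).space (coordOpen n) :=
  show (projSpaceDatum σ).TwistSec 0 (coordOpen n) from
    ProjDatum.frac (D := projSpaceDatum σ) (i := (1 : ℕ)) (e := (0 : ℕ)) (F12Poly.X l)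
      (F12Poly.X n) (F12Poly.X_mem_part l) (F12Poly.X_mem_part n) _ fun _ h => h

/-- `f : Proj R₀ → ℙ^{2ᵈ-1}` is the morphism given by the line bundle `𝒪(d)` and its sections
`s_l = l γᵈ`, `1 ≤ l ≤ 2ᵈ`: the preimage of `D₊(x_n)` is the locus where `s_n` generates `𝒪(d)`,
and there `f^*(x_l / x_n) s_n = s_l`. -/
structure IsAssociated (d : ℕ) (f : projR0 ⟶ projSpace (Fin (2 ^ d))) : Prop where
  mem_preim_iff : ∀ (n : Fin (2 ^ d)) (x : projR0Datum.pt),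
    x ∈ preim (WeakScheme.Hom.map f.left) (coordOpen n) ↔
      ProjDatum.GeneratesAt (linearSystem d n) x
  comap_coord : ∀ l n : Fin (2 ^ d),
    ProjDatum.act (comap (WeakScheme.Hom.map f.left) (coordOpen n) (coord l n))
      ((linearSystem d n).res le_top) = (linearSystem d l).res le_top

/-! Initiality. In a commutative convexoid ring `B` whose constant `γ` is regular, `a + b := (a ⊞
b)/γ` turns the localization `B[1/γ]` into a commutative ring containing `B` (`GammaLoc`).
Evaluating integer polynomials at `γ` gives a ring homomorphism `ℤ[γ] → B[1/γ]`, and induction over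
the generation of `R0` shows that `R0` lands in `B`. Uniqueness is the same induction
(`Hom.ext_R0`).

The morphisms `f_d`. At every point of `Proj R₀` either `γᵈ` or `(2γ)ᵈ` does not vanish
(`ProjR0.exists_mono_succ_notMem`). So the sections `l γᵈ` have no common zero, and `𝒪(d)` is
generated by one of them near each point. The graded homomorphism `x_l ↦ l γᵈ` then induces `f_d`.
It is unique: the loci where the `s_n` generate determine the map of points, the structure morphism
determines the pullback of `±1`, and `x_l/x_n` is determined because `s_n` is invertible in the
local monoids (`IsAssociated.unique`).

The product. It is built as a multigraded `Proj` whose space is the product of the finite spaces of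
the factors. Such a product is spectral, by Tychonoff and a coordinatewise choice of generic points,
but the noetherian argument for quasi-compactness of unit loci is replaced by a local computation
with fractions. A morphism into the space of a graded datum amounts to a map of points with
compatible maps from the local monoids to the stalks (`exists_hom_of_locMaps`). Components over
`𝔽_{1²}` agree on `±1`, so their coordinate ratios assemble to such maps (`exists_prodDatum_lift`).
Ratios also determine a morphism (`hom_ext_of_generators`).

The immersion. An element of degree `n` of `R0` is `m γⁿ` with `|m| ≤ 2ⁿ`, hence the image of `0` or
of a signed coordinate under `x_l ↦ l γⁿ` (`exists_linearHom_eq`). Multiplying by `γ` or `2γ`,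
whichever does not vanish at the given point, makes the degree positive. Then each `D₊(a)` is a
union of preimages of open sets, and each germ `a/b = ac/bc` is the pullback of a quotient of such
forms on a single factor. -/

namespace MonoidSpace

/-! ### Stalks of monoid-valued spaces and gluing along germs. -/

variable {X Y Z : MonoidSpace}

theorem res_self {U : Opens X} (s : Sec X U) : res (le_refl U) s = s := by
  change X.presheaf.map (𝟙 (op U)) s = s
  rw [X.presheaf.map_id]
  rfl

/-- Morphisms of monoid-valued spaces with the same underlying map that agree locally on
sections are equal. -/
theorem hom_ext_of_locally {f g : X ⟶ Y} (hb : f.hom.base = g.hom.base)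
    (h : ∀ (V : Opens Y) (s : Sec Y V) (x : X), x ∈ preim f V → ∃ (W : Opens X)
      (hf : W ≤ preim f V) (hg : W ≤ preim g V), x ∈ W ∧
        res hf (comap f V s) = res hg (comap g V s)) : f = g := by
  obtain ⟨⟨bf, cf⟩⟩ := f
  obtain ⟨⟨bg, cg⟩⟩ := g
  change bf = bg at hb
  subst hb
  have hc : cf = cg := by
    refine NatTrans.ext (funext fun V => ?_)
    apply ConcreteCategory.hom_ext
    intro s
    refine sec_ext (X := X) fun x hx => ?_
    obtain ⟨W, hf, hg, hxW, e⟩ := h V.unop s x hx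
    exact ⟨W, hf, hxW, e⟩
  subst hc
  rfl

/-- Open neighbourhoods, ordered by reverse inclusion. -/
abbrev Nhd (X : MonoidSpace) (x : X) : Type := {U : (Opens X)ᵒᵈ // x ∈ OrderDual.ofDual U}

instance (x : X) : IsDirectedOrder (Nhd X x) where
  directed U V := ⟨⟨OrderDual.toDual (OrderDual.ofDual U.1 ⊓ OrderDual.ofDual V.1), U.2, V.2⟩,
    inf_le_left (a := OrderDual.ofDual U.1), inf_le_right (a := OrderDual.ofDual U.1)⟩

instance (x : X) : Nonempty (Nhd X x) := ⟨⟨OrderDual.toDual ⊤, trivial⟩⟩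

abbrev nhdSec (X : MonoidSpace) (x : X) (U : Nhd X x) : Type := Sec X (OrderDual.ofDual U.1)

abbrev nhdRes (x : X) (U V : Nhd X x) (h : U ≤ V) : nhdSec X x U →*₀ nhdSec X x V :=
  res (show OrderDual.ofDual V.1 ≤ OrderDual.ofDual U.1 from h)

instance (x : X) : DirectedSystem (nhdSec X x) (nhdRes x · · ·) where
  map_self _ s := res_self s
  map_map _ _ _ h h' s := res_res (X := X) h h' s

/-- The stalk at `x`. -/
def Germ (X : MonoidSpace) (x : X) : Type := DirectLimit (nhdSec X x) (nhdRes x)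

noncomputable instance (x : X) : CommMonoidWithZero (Germ X x) :=
  inferInstanceAs (CommMonoidWithZero (DirectLimit (nhdSec X x) (nhdRes x)))

/-- The germ of a section. -/
noncomputable def germ {U : Opens X} {x : X} (hx : x ∈ U) : Sec X U →*₀ Germ X x where
  toFun s := (⟦⟨(⟨OrderDual.toDual U, hx⟩ : Nhd X x), s⟩⟧ : DirectLimit (nhdSec X x) (nhdRes x))
  map_zero' := (DirectLimit.zero_def (G := nhdSec X x) (f := nhdRes x)
    (⟨OrderDual.toDual U, hx⟩ : Nhd X x)).symm
  map_one' := (DirectLimit.one_def (G := nhdSec X x) (f := nhdRes x)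
    (⟨OrderDual.toDual U, hx⟩ : Nhd X x)).symm
  map_mul' s t := (DirectLimit.mul_def (G := nhdSec X x) (f := nhdRes x)
    (⟨OrderDual.toDual U, hx⟩ : Nhd X x) s t).symm

theorem germ_eq_iff {U V : Opens X} {x : X} (hU : x ∈ U) (hV : x ∈ V) {s : Sec X U}
    {t : Sec X V} : germ hU s = germ hV t ↔
      ∃ (W : Opens X) (h : W ≤ U) (h' : W ≤ V), x ∈ W ∧ res h s = res h' t := by
  refine (Quotient.eq (r := DirectLimit.setoid (nhdRes x))).trans ⟨?_, ?_⟩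
  · rintro ⟨W, h1, h2, h3⟩
    exact ⟨OrderDual.ofDual W.1, h1, h2, W.2, h3⟩
  · rintro ⟨W, h1, h2, hx, h3⟩
    exact ⟨⟨OrderDual.toDual W, hx⟩, h1, h2, h3⟩

theorem germ_res {U V : Opens X} {x : X} (h : V ≤ U) (hx : x ∈ V) (s : Sec X U) :
    germ hx (res h s) = germ (h hx) s :=
  (germ_eq_iff _ _).2 ⟨V, le_rfl, h, hx, by rw [res_self]⟩

theorem exists_germ_eq {x : X} (z : Germ X x) :
    ∃ (U : Opens X) (hx : x ∈ U) (s : Sec X U), germ hx s = z := by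
  obtain ⟨U, s, hz⟩ := DirectLimit.exists_eq_mk (nhdRes x) z
  exact ⟨OrderDual.ofDual U.1, U.2, s, hz.symm⟩

theorem sec_ext_germ {U : Opens X} {s t : Sec X U}
    (h : ∀ x (hx : x ∈ U), germ hx s = germ hx t) : s = t := by
  refine sec_ext fun x hx => ?_
  obtain ⟨W, h1, _, hxW, h3⟩ := (germ_eq_iff hx hx).1 (h x hx)
  exact ⟨W, h1, hxW, h3⟩

/-- An inverse germ is represented by a section near `x`, and the equation `s t = 1` of germs
already holds on a smaller neighbourhood. This links the stalk-free definition of `UnitAt` to actual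
stalks. -/
theorem unitAt_iff_isUnit_germ {U : Opens X} {x : X} (hx : x ∈ U) (s : Sec X U) :
    UnitAt s x ↔ IsUnit (germ hx s) := by
  constructor
  · rintro ⟨V, h, hxV, hu⟩
    rw [← germ_res h hxV]
    exact hu.map _
  · intro hu
    obtain ⟨z, hz⟩ := hu.exists_right_inv
    obtain ⟨V, hxV, t, rfl⟩ := exists_germ_eq z
    have hxW : x ∈ U ⊓ V := ⟨hx, hxV⟩
    rw [← germ_res (inf_le_left : U ⊓ V ≤ U) hxW,
      ← germ_res (inf_le_right : U ⊓ V ≤ V) hxW, ← map_mul,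
      ← map_one (germ hxW), germ_eq_iff] at hz
    obtain ⟨W, h1, h2, hxW, h3⟩ := hz
    rw [map_mul, map_one, res_res] at h3
    exact ⟨W, h1.trans inf_le_left, hxW, .of_mul_eq_one _ h3⟩

/-- A family of germs that is locally given by sections comes from a section. -/
theorem exists_sec_of_germs {U : Opens X} (z : ∀ x ∈ U, Germ X x)
    (h : ∀ x ∈ U, ∃ (V : Opens X) (hV : V ≤ U) (s : Sec X V), x ∈ V ∧
      ∀ y (hy : y ∈ V), germ hy s = z y (hV hy)) :
    ∃ s : Sec X U, ∀ x (hx : x ∈ U), germ hx s = z x hx := by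
  choose V hV s hxV hs using fun x : U => h x.1 x.2
  obtain ⟨r, hr, -⟩ := (X.sheaf).existsUnique_gluing' V U (fun x => homOfLE (hV x))
    (fun x hx => Opens.mem_iSup.2 ⟨⟨x, hx⟩, hxV ⟨x, hx⟩⟩) s (by
      intro i j
      refine sec_ext_germ (X := X) (s := res (inf_le_left : V i ⊓ V j ≤ V i) (s i))
        (t := res (inf_le_right : V i ⊓ V j ≤ V j) (s j)) fun x hx => ?_
      rw [germ_res, germ_res, hs, hs])
  obtain ⟨r, hr'⟩ : ∃ r : Sec X U, ∀ x, res (hV x) r = s x := ⟨r, hr⟩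
  refine ⟨r, fun x hx => ?_⟩
  rw [← germ_res (hV ⟨x, hx⟩) (hxV ⟨x, hx⟩), hr', hs]

theorem hom_ext_germ {f g : X ⟶ Y} (hb : f.hom.base = g.hom.base)
    (h : ∀ (V : Opens Y) (s : Sec Y V) (x : X) (hf : x ∈ preim f V) (hg : x ∈ preim g V),
      germ hf (comap f V s) = germ hg (comap g V s)) : f = g := by
  refine hom_ext_of_locally hb fun V s x hx => ?_
  have hg : x ∈ preim g V := by
    change g.hom.base x ∈ V
    rw [← hb]
    exact hx
  obtain ⟨W, h1, h2, h3, h4⟩ := (germ_eq_iff _ _).1 (h V s x hx hg)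
  exact ⟨W, h1, h2, h3, h4⟩

end MonoidSpace

/-! ### Morphisms into the space of a graded datum. -/

namespace ProjDatum

variable {D : ProjDatum} {X : MonoidSpace}

/-- The map of points underlying a morphism to the space of a datum. -/
def ptMap (f : X ⟶ D.space) (x : X) : D.pt := f.hom.base x

/-- The preimage of an open set. -/
def pre (f : X ⟶ D.space) (V : Opens D.pt) : Opens X := MonoidSpace.preim f V

/-- The map on sections. -/
def pull (f : X ⟶ D.space) (V : Opens D.pt) : D.sections V →*₀ Sec X (pre f V) :=
  comap f V

/-- Restriction of sections of the structure sheaf. -/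
def sres {U V : Opens D.pt} (h : V ≤ U) : D.sections U →*₀ D.sections V :=
  MonoidSpace.res (X := D.space) h

theorem mem_pre {f : X ⟶ D.space} {V : Opens D.pt} {x : X} : x ∈ pre f V ↔ ptMap f x ∈ V :=
  Iff.rfl

theorem continuous_ptMap (f : X ⟶ D.space) : Continuous (ptMap f) :=
  f.hom.base.hom.continuous

theorem germ_pull_sres (f : X ⟶ D.space) {U V : Opens D.pt} (h : V ≤ U) (s : D.sections U)
    {x : X} (hx : x ∈ pre f V) (hx' : x ∈ pre f U) :
    germ hx (pull f V (sres h s)) = germ hx' (pull f U s) := by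
  have h1 : pull f V (sres h s) = MonoidSpace.res (show pre f V ≤ pre f U from fun _ hy => h hy)
    (pull f U s) := comap_res f (U := U) (V := V) h s
  rw [h1, germ_res]

theorem hom_ext {f g : X ⟶ D.space} (hb : ∀ x, ptMap f x = ptMap g x)
    (h : ∀ (V : Opens D.pt) (s : D.sections V) (x : X) (hf : x ∈ pre f V) (hg : x ∈ pre g V),
      germ hf (pull f V s) = germ hg (pull g V s)) : f = g :=
  hom_ext_germ (TopCat.hom_ext (ContinuousMap.ext hb)) h

/-- A section of the structure sheaf given by one fraction. -/
def sfrac {i : D.ι} (a b : D.M) (ha : a ∈ D.part i) (hb : b ∈ D.part i) (U : Opens D.pt)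
    (hU : ∀ x ∈ U, b ∉ D.prime x) : D.sections U :=
  frac (e := 0) a b ((add_zero i).symm ▸ ha) hb U hU

theorem exists_sres_eq_sfrac {V : Opens D.pt} (s : D.sections V) {x : D.pt} (hx : x ∈ V) :
    ∃ (W : Opens D.pt) (hW : W ≤ V) (i : D.ι) (a b : D.M) (ha : a ∈ D.part i) (hb : b ∈ D.part i)
      (h : ∀ y ∈ W, b ∉ D.prime y), x ∈ W ∧ sres hW s = sfrac a b ha hb W h := by
  obtain ⟨W, hxW, iW, i, a, ha, b, hb, hab⟩ := s.2 ⟨x, hx⟩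
  rw [add_zero] at ha
  exact ⟨W, iW.le, i, a, b, ha, hb, fun y hy => (hab ⟨y, hy⟩).choose.1, hxW,
    Subtype.ext (funext fun y => (hab y).choose_spec)⟩

/-- To compare pullbacks of sections it suffices to consider fractions. -/
theorem hom_ext_sfrac {f g : X ⟶ D.space} (hb : ∀ x, ptMap f x = ptMap g x)
    (h : ∀ (i : D.ι) (a b : D.M) (ha : a ∈ D.part i) (hb : b ∈ D.part i) (x : X)
      (hf : x ∈ pre f (basicOpen b hb)) (hg : x ∈ pre g (basicOpen b hb)),
      germ hf (pull f _ (sfrac a b ha hb (basicOpen b hb) fun _ hy => hy)) =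
      germ hg (pull g _ (sfrac a b ha hb (basicOpen b hb) fun _ hy => hy))) : f = g := by
  refine hom_ext hb fun V s x hf hg => ?_
  obtain ⟨V', iV, i, a, b, ha, hb', hV', hxV, hs⟩ := exists_sres_eq_sfrac s (mem_pre.1 hf)
  have hxV' : x ∈ pre f V' := hxV
  have hxg : x ∈ pre g V' := by
    rw [mem_pre, ← hb]
    exact hxV'
  have hle : V' ≤ basicOpen b hb' := hV'
  -- A fraction with denominator `b` extends to all of `D₊(b)`, so its domain of definition plays no
  -- role.
  have hs' : sfrac a b ha hb' V' hV' = sres hle (sfrac a b ha hb' _ fun _ hy => hy) := rfl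
  rw [← germ_pull_sres f iV s hxV', ← germ_pull_sres g iV s hxg, hs, hs',
    germ_pull_sres f hle _ _ (hV' _ hxV), germ_pull_sres g hle _ _ (hV' _ hxg)]
  exact h i a b ha hb' x _ _

/-- A continuous map to the space of a datum together with compatible homomorphisms from the local
monoids to the stalks gives a morphism of monoid-valued spaces. -/
theorem exists_hom_of_locMaps (φ : X → D.pt) (hφ : Continuous φ)
    (ev : ∀ x, D.Loc (φ x) →* Germ X x) (ev_zero : ∀ x, ev x 0 = 0)
    (h : ∀ (i : D.ι) (a b : D.M), a ∈ D.part i → b ∈ D.part i → ∀ x, b ∉ D.prime (φ x) →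
      ∃ (W : Opens X) (r : Sec X W), x ∈ W ∧ ∀ y (hy : y ∈ W) (hb : b ∈ D.den (φ y)),
        germ hy r = ev y (Localization.mk a ⟨b, hb⟩)) :
    ∃ f : X ⟶ D.space, ptMap f = φ ∧
      ∀ (V : Opens D.pt) (s : D.sections V) (x : X) (hx : φ x ∈ V)
        (hx' : x ∈ pre f V), germ hx' (pull f V s) = ev x (s.1 ⟨φ x, hx⟩) := by
  let pre' (V : Opens D.pt) : Opens X := ⟨φ ⁻¹' V, V.2.preimage hφ⟩
  -- The pullback of `s` is prescribed germ by germ. The hypothesis on fractions makes this family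
  -- locally a section, so it glues.
  have key : ∀ (V : Opens D.pt) (s : D.sections V), ∃ r : Sec X (pre' V),
      ∀ x (hx : x ∈ pre' V), germ hx r = ev x (s.1 ⟨φ x, hx⟩) := by
    intro V s
    refine exists_sec_of_germs _ fun x hx => ?_
    obtain ⟨V', iV, i, a, b, ha, hb, hV', hxV', hs⟩ := exists_sres_eq_sfrac s hx
    obtain ⟨W, r, hxW, hr⟩ := h i a b ha hb x (hV' _ hxV')
    refine ⟨W ⊓ pre' V', fun y hy => iV hy.2, MonoidSpace.res inf_le_left r, ⟨hxW, hxV'⟩,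
      fun y hy => ?_⟩
    rw [germ_res, hr y hy.1 ⟨hV' _ hy.2, i, hb⟩]
    exact congrArg (fun s => ev y (s.1 ⟨φ y, hy.2⟩)) hs.symm
  choose r hr using key
  let r' (V : Opens D.pt) : D.sections V →*₀ Sec X (pre' V) :=
    { toFun := r V
      map_zero' := sec_ext_germ fun x hx => by
        rw [hr, map_zero]
        exact ev_zero x
      map_one' := sec_ext_germ fun x hx => by
        rw [hr, map_one]
        exact map_one (ev x)
      map_mul' := fun s t => sec_ext_germ fun x hx => by
        rw [map_mul, hr, hr, hr]
        exact map_mul (ev x) _ _ }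
  refine ⟨InducedCategory.homMk
    { base := TopCat.ofHom ⟨φ, hφ⟩
      c :=
        { app := fun V => CMnd₀.ofHom (r' V.unop)
          naturality := fun U V i => by
            apply ConcreteCategory.hom_ext
            intro s
            refine sec_ext_germ (X := X) (U := pre' V.unop) fun x hx => ?_
            refine (hr V.unop _ x hx).trans (((germ_res (X := X) (U := pre' U.unop)
              (V := pre' V.unop) (fun y hy => i.unop.le hy) hx (r U.unop s)).trans ?_).symm)
            exact hr U.unop s x _ } }, rfl, fun V s x hx hx' => hr V s x hx⟩

end ProjDatum

/-! ### Monomials and homomorphisms out of the polynomial monoid. -/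

namespace F12Poly

variable {σ : Type}

/-- The monomial `u x^a`. -/
def mon (u : ℤˣ) (a : σ →₀ ℕ) : F12Poly σ :=
  (((u, Multiplicative.ofAdd a) : ℤˣ × Multiplicative (σ →₀ ℕ)) : F12Poly σ)

theorem mon_mul (u v : ℤˣ) (a b : σ →₀ ℕ) : mon u a * mon v b = mon (u * v) (a + b) := rfl

theorem mon_one_zero : mon 1 0 = (1 : F12Poly σ) := rfl

theorem X_eq_mon (i : σ) : X i = mon 1 (Finsupp.single i 1) := rfl

theorem mon_ne_zero (u : ℤˣ) (a : σ →₀ ℕ) : mon u a ≠ 0 := WithZero.coe_ne_zero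

theorem mon_inj {u v : ℤˣ} {a b : σ →₀ ℕ} : mon u a = mon v b ↔ u = v ∧ a = b := by
  rw [mon, mon, WithZero.coe_inj, Prod.mk.injEq, Multiplicative.ofAdd.injective.eq_iff]

theorem eq_zero_or_mon (z : F12Poly σ) : z = 0 ∨ ∃ u a, z = mon u a := by
  induction z using WithZero.recZeroCoe with
  | zero => exact Or.inl rfl
  | coe m => exact Or.inr ⟨m.1, m.2.toAdd, rfl⟩

theorem const_coe (u : ℤˣ) : const (σ := σ) (u : F12) = mon u 0 := rfl

theorem mon_mem_part_iff {u : ℤˣ} {a : σ →₀ ℕ} {n : ℕ} :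
    mon u a ∈ part (σ := σ) n ↔ Finsupp.degree a = n := by
  constructor
  · intro h
    exact h (u, Multiplicative.ofAdd a) rfl
  · rintro h m hm
    rw [← WithZero.coe_inj.1 hm]
    exact h

/-- To prove a statement for all exponents it suffices to treat `0`, the unit vectors, and sums. -/
theorem exponent_induction {P : (σ →₀ ℕ) → Prop} (zero : P 0) (single : ∀ i, P (.single i 1))
    (add : ∀ a b, P a → P b → P (a + b)) (a : σ →₀ ℕ) : P a := by
  induction a using Finsupp.induction_linear with
  | zero => exact zero
  | add a b ha hb => exact add a b ha hb
  | single i n =>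
    induction n with
    | zero => rwa [Finsupp.single_zero]
    | succ n ih =>
      rw [Finsupp.single_add]
      exact add _ _ ih (single i)

variable {N : Type*} [CommMonoidWithZero N]

/-- The homomorphism out of the polynomial ring given by the values on `±1` and on the
variables. -/
noncomputable def lift (ε : ℤˣ →* N) (c : σ → N) : F12Poly σ →*₀ N :=
  WithZero.lift' (ε.coprod
    { toFun := fun m => m.toAdd.prod fun i k => c i ^ k
      map_one' := Finsupp.prod_zero_index
      map_mul' := fun _ _ => Finsupp.prod_add_index' (fun _ => pow_zero _)
        fun _ _ _ => pow_add _ _ _ })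

theorem lift_mon (ε : ℤˣ →* N) (c : σ → N) (u : ℤˣ) (a : σ →₀ ℕ) :
    lift ε c (mon u a) = ε u * a.prod fun i k => c i ^ k := rfl

theorem lift_X (ε : ℤˣ →* N) (c : σ → N) (i : σ) : lift ε c (X i) = c i := by
  rw [X_eq_mon, lift_mon, map_one, one_mul, Finsupp.prod_single_index (h := fun i k => c i ^ k) (pow_zero (c i)), pow_one]

theorem lift_mon_zero (ε : ℤˣ →* N) (c : σ → N) (u : ℤˣ) : lift ε c (mon u 0) = ε u := by
  rw [lift_mon, Finsupp.prod_zero_index, mul_one]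

end F12Poly

/-! ### Calculus of pulled back fractions in the stalks. -/

namespace ProjDatum

variable {D : ProjDatum} {X : MonoidSpace}

/-- The germ at `x` of the pullback of the fraction `a / b`. -/
noncomputable def gfrac (f : X ⟶ D.space) {i : D.ι} (a b : D.M) (ha : a ∈ D.part i)
    (hb : b ∈ D.part i) (x : X) (hx : b ∉ D.prime (ptMap f x)) : Germ X x :=
  germ (show x ∈ pre f (basicOpen b hb) from hx)
    (pull f (basicOpen b hb) (sfrac a b ha hb _ fun _ hy => hy))

theorem germ_pull_sfrac (f : X ⟶ D.space) {i : D.ι} {a b : D.M} (ha : a ∈ D.part i)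
    (hb : b ∈ D.part i) {U : Opens D.pt} (hU : ∀ x ∈ U, b ∉ D.prime x) {x : X}
    (hx : x ∈ pre f U) : germ hx (pull f U (sfrac a b ha hb U hU)) =
      gfrac f a b ha hb x (hU _ hx) := by
  have hle : U ≤ basicOpen b hb := hU
  exact germ_pull_sres f hle (sfrac a b ha hb _ fun _ hy => hy) hx (hU _ hx)

/-- Cross-multiplication makes the two fractions equal as functions on `D₊(b) ∩ D₊(d)`, a
neighbourhood of the image of `x`. The degrees `i` and `j` may differ. -/
theorem gfrac_eq (f : X ⟶ D.space) {i j : D.ι} {a b c d : D.M} (ha : a ∈ D.part i)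
    (hb : b ∈ D.part i) (hc : c ∈ D.part j) (hd : d ∈ D.part j) {x : X}
    (hx : b ∉ D.prime (ptMap f x)) (hx' : d ∉ D.prime (ptMap f x)) (h : a * d = c * b) :
    gfrac f a b ha hb x hx = gfrac f c d hc hd x hx' := by
  let U : Opens D.pt := basicOpen b hb ⊓ basicOpen d hd
  have hU : x ∈ pre f U := ⟨hx, hx'⟩
  rw [← germ_pull_sfrac f ha hb (U := U) (fun _ h => h.1) hU,
    ← germ_pull_sfrac f hc hd (U := U) (fun _ h => h.2) hU]
  congr 2
  refine Subtype.ext (funext fun y => ?_)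
  refine Localization.mk_eq_mk_iff.2 (Localization.r_iff_exists.2 ⟨1, ?_⟩)
  change 1 * (d * a) = 1 * (b * c)
  rw [mul_comm d, h, mul_comm c]

theorem mul_notMem {p : D.pt} {a b : D.M} (ha : a ∉ D.prime p) (hb : b ∉ D.prime p) :
    a * b ∉ D.prime p := fun h => (D.mem_or_mem h).elim ha hb

theorem gfrac_mul (f : X ⟶ D.space) {i j : D.ι} {a b c d : D.M} (ha : a ∈ D.part i)
    (hb : b ∈ D.part i) (hc : c ∈ D.part j) (hd : d ∈ D.part j) {x : X}
    (hx : b ∉ D.prime (ptMap f x)) (hx' : d ∉ D.prime (ptMap f x)) :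
    gfrac f a b ha hb x hx * gfrac f c d hc hd x hx' =
      gfrac f (a * c) (b * d) (D.mul_mem_part ha hc) (D.mul_mem_part hb hd) x
        (mul_notMem hx hx') := by
  let U : Opens D.pt := basicOpen b hb ⊓ basicOpen d hd
  have hU : x ∈ pre f U := ⟨hx, hx'⟩
  rw [← germ_pull_sfrac f ha hb (U := U) (fun _ h => h.1) hU,
    ← germ_pull_sfrac f hc hd (U := U) (fun _ h => h.2) hU, ← map_mul, ← map_mul,
    ← germ_pull_sfrac f (D.mul_mem_part ha hc) (D.mul_mem_part hb hd) (U := U)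
      (fun _ h => mul_notMem h.1 h.2) hU]
  congr 2
  refine Subtype.ext (funext fun y => ?_)
  exact Localization.mk_mul _ _ _ _

theorem gfrac_self (f : X ⟶ D.space) {i : D.ι} {a : D.M} (ha : a ∈ D.part i) {x : X}
    (hx : a ∉ D.prime (ptMap f x)) : gfrac f a a ha ha x hx = 1 := by
  have : sfrac a a ha ha (basicOpen a ha) (fun _ hy => hy) = 1 :=
    Subtype.ext (funext fun y => Localization.mk_self (⟨a, y.2, i, ha⟩ : D.den y.1))
  rw [gfrac, this, map_one, map_one]

theorem gfrac_zero (f : X ⟶ D.space) {i : D.ι} {b : D.M} (h0 : 0 ∈ D.part i)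
    (hb : b ∈ D.part i) {x : X} (hx : b ∉ D.prime (ptMap f x)) : gfrac f 0 b h0 hb x hx = 0 := by
  have : sfrac 0 b h0 hb (basicOpen b hb) (fun _ hy => hy) = 0 :=
    Subtype.ext (funext fun y => Localization.mk_zero (⟨b, y.2, i, hb⟩ : D.den y.1))
  rw [gfrac, this, map_zero, map_zero]

/-- Change of denominator, the step by which fractions are compared across charts. -/
theorem gfrac_mul_cancel (f : X ⟶ D.space) {i : D.ι} {a b c : D.M} (ha : a ∈ D.part i)
    (hb : b ∈ D.part i) (hc : c ∈ D.part i) {x : X} (hx : b ∉ D.prime (ptMap f x))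
    (hx' : c ∉ D.prime (ptMap f x)) :
    gfrac f a b ha hb x hx * gfrac f b c hb hc x hx' = gfrac f a c ha hc x hx' := by
  rw [gfrac_mul]
  exact gfrac_eq f _ _ _ _ _ _ (by ac_rfl)

theorem isUnit_gfrac (f : X ⟶ D.space) {i : D.ι} {a b : D.M} (ha : a ∈ D.part i)
    (hb : b ∈ D.part i) {x : X} (hx : b ∉ D.prime (ptMap f x)) (hx' : a ∉ D.prime (ptMap f x)) :
    IsUnit (gfrac f a b ha hb x hx) :=
  .of_mul_eq_one (gfrac f b a hb ha x hx') (by rw [gfrac_mul_cancel, gfrac_self])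

theorem hom_ext_gfrac {f g : X ⟶ D.space} (hb : ∀ x, ptMap f x = ptMap g x)
    (h : ∀ (i : D.ι) (a b : D.M) (ha : a ∈ D.part i) (hb : b ∈ D.part i) (x : X)
      (hf : b ∉ D.prime (ptMap f x)) (hg : b ∉ D.prime (ptMap g x)),
      gfrac f a b ha hb x hf = gfrac g a b ha hb x hg) : f = g :=
  hom_ext_sfrac hb fun i a b ha hb x hf hg => h i a b ha hb x hf hg

/-- The local maps of `φ` act on numerator and denominator separately, so pulling back along `φ`
first only changes the fraction. -/
theorem gfrac_comp {E : ProjDatum} (f : X ⟶ E.space) (φ : Hom E D) {i : D.ι} {a b : D.M}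
    (ha : a ∈ D.part i) (hb : b ∈ D.part i) {x : X}
    (hx : b ∉ D.prime (ptMap (f ≫ φ.toSpaceHom) x))
    (hx' : φ.hom b ∉ E.prime (ptMap f x)) :
    gfrac (f ≫ φ.toSpaceHom) a b ha hb x hx =
      gfrac f (φ.hom a) (φ.hom b) (φ.map_part ha) (φ.map_part hb) x hx' := by
  have hU : ∀ y ∈ φ.preim (basicOpen b hb), φ.hom b ∉ E.prime y :=
    fun y hy h => hy ((φ.mem_prime_base y hb).2 h)
  have hs : φ.sectionsMap (basicOpen b hb) (sfrac a b ha hb _ fun _ hy => hy) =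
      sfrac (φ.hom a) (φ.hom b) (φ.map_part ha) (φ.map_part hb) (φ.preim (basicOpen b hb)) hU :=
    Subtype.ext (funext fun y => φ.locMap_mk y.1 _ _)
  have h1 := germ_pull_sfrac f (φ.map_part ha) (φ.map_part hb) hU (x := x) hx
  rw [← hs] at h1
  exact h1

/-- Morphisms into the space of a datum whose monoid is a monomial algebra are determined by the
map of points and the pullbacks of `±1` and of quotients of variables. -/
theorem hom_ext_of_generators {τ : Type} (e : F12Poly τ →*₀ D.M)
    (he : Function.Surjective e) (d : (τ →₀ ℕ) → D.ι)
    (hd : ∀ u a, e (F12Poly.mon u a) ∈ D.part (d a))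
    (hd' : ∀ u a i, e (F12Poly.mon u a) ∈ D.part i → d a = i)
    {f g : X ⟶ D.space} (hb : ∀ x, ptMap f x = ptMap g x) (κ : X → τ → τ)
    (hκ : ∀ x i, e (F12Poly.X (κ x i)) ∉ D.prime (ptMap f x))
    (hκd : ∀ x a, d (a.mapDomain (κ x)) = d a)
    (hκ' : ∀ x a b, d a = d b → a.mapDomain (κ x) = b.mapDomain (κ x))
    (hu : ∀ x u (h0 : e (F12Poly.mon u 0) ∈ D.part 0),
      gfrac f (e (F12Poly.mon u 0)) 1 h0 D.one_mem_part x (D.one_notMem_prime _) =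
      gfrac g (e (F12Poly.mon u 0)) 1 h0 D.one_mem_part x (D.one_notMem_prime _))
    (hX : ∀ x i j (hi : e (F12Poly.X i) ∈ D.part j) (hj : e (F12Poly.X (κ x i)) ∈ D.part j)
      (hf : e (F12Poly.X (κ x i)) ∉ D.prime (ptMap f x))
      (hg : e (F12Poly.X (κ x i)) ∉ D.prime (ptMap g x)),
      gfrac f (e (F12Poly.X i)) (e (F12Poly.X (κ x i))) hi hj x hf =
      gfrac g (e (F12Poly.X i)) (e (F12Poly.X (κ x i))) hi hj x hg) : f = g := by
  have h0 : d 0 = 0 := hd' 1 0 0 (by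
    rw [F12Poly.mon_one_zero, map_one]
    exact D.one_mem_part)
  -- `κ x` replaces each variable by one of the same degree that does not vanish at the image of
  -- `x`. Replacing all variables of a monomial gives a denominator of the same degree, nonvanishing
  -- because the ideal is prime.
  have hden : ∀ x (a : τ →₀ ℕ), e (F12Poly.mon 1 (a.mapDomain (κ x))) ∉ D.prime (ptMap f x) := by
    intro x a
    induction a using F12Poly.exponent_induction with
    | zero =>
      rw [Finsupp.mapDomain_zero, F12Poly.mon_one_zero, map_one]
      exact D.one_notMem_prime _
    | single i =>
      rw [Finsupp.mapDomain_single]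
      exact hκ x i
    | add a b ha hb =>
      rw [Finsupp.mapDomain_add, show ∀ a b : τ →₀ ℕ, F12Poly.mon 1 (a + b) =
        F12Poly.mon 1 a * F12Poly.mon 1 b from fun _ _ => rfl, map_mul]
      exact mul_notMem ha hb
  -- A monomial over its replacement is a sign times a product of quotients `x_i / x_{κ i}`, on
  -- which `f` and `g` agree by hypothesis.
  have key : ∀ x (a : τ →₀ ℕ) (u : ℤˣ) (i : D.ι) (h1 : e (F12Poly.mon u a) ∈ D.part i)
      (h2 : e (F12Poly.mon 1 (a.mapDomain (κ x))) ∈ D.part i) hf hg,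
      gfrac f (e (F12Poly.mon u a)) (e (F12Poly.mon 1 (a.mapDomain (κ x)))) h1 h2 x hf =
      gfrac g (e (F12Poly.mon u a)) (e (F12Poly.mon 1 (a.mapDomain (κ x)))) h1 h2 x hg := by
    intro x a
    induction a using F12Poly.exponent_induction with
    | zero =>
      intro u i h1 h2 hf hg
      have h3 : e (F12Poly.mon 1 ((0 : τ →₀ ℕ).mapDomain (κ x))) = 1 := by
        rw [Finsupp.mapDomain_zero, F12Poly.mon_one_zero, map_one]
      have h4 : e (F12Poly.mon u 0) ∈ D.part 0 := h0 ▸ hd u 0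
      rw [gfrac_eq f h1 h2 h4 D.one_mem_part hf (D.one_notMem_prime _) (by rw [h3]),
        gfrac_eq g h1 h2 h4 D.one_mem_part hg (D.one_notMem_prime _) (by rw [h3])]
      exact hu x u h4
    | single j =>
      intro u i h1 h2 hf hg
      have h3 : e (F12Poly.mon 1 ((Finsupp.single j 1).mapDomain (κ x))) =
          e (F12Poly.X (κ x j)) := by
        rw [Finsupp.mapDomain_single]
        rfl
      have h4 : e (F12Poly.mon u 0) ∈ D.part 0 := h0 ▸ hd u 0
      have hj1 : e (F12Poly.X j) ∈ D.part (d (.single j 1)) := hd 1 _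
      have hj2 : e (F12Poly.X (κ x j)) ∈ D.part (d (.single j 1)) := by
        rw [← hκd x, Finsupp.mapDomain_single]
        exact hd 1 _
      have hg' : e (F12Poly.X (κ x j)) ∉ D.prime (ptMap g x) := hb x ▸ hκ x j
      have h5 : e (F12Poly.mon u (.single j 1)) =
          e (F12Poly.mon u 0) * e (F12Poly.X j) := by
        rw [← map_mul, F12Poly.X_eq_mon, F12Poly.mon_mul, mul_one, zero_add]
      have h6 : e (F12Poly.mon u (.single j 1)) * (1 * e (F12Poly.X (κ x j))) =
          e (F12Poly.mon u 0) * e (F12Poly.X j) *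
            e (F12Poly.mon 1 ((Finsupp.single j 1).mapDomain (κ x))) := by
        rw [h3, h5, one_mul]
      rw [gfrac_eq f h1 h2 (D.mul_mem_part h4 hj1) (D.mul_mem_part D.one_mem_part hj2) hf
          (mul_notMem (D.one_notMem_prime _) (hκ x j)) h6,
        gfrac_eq g h1 h2 (D.mul_mem_part h4 hj1) (D.mul_mem_part D.one_mem_part hj2) hg
          (mul_notMem (D.one_notMem_prime _) hg') h6,
        ← gfrac_mul f h4 D.one_mem_part hj1 hj2 (D.one_notMem_prime _) (hκ x j),
        ← gfrac_mul g h4 D.one_mem_part hj1 hj2 (D.one_notMem_prime _) hg', hu x u h4,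
        hX x j _ hj1 hj2 (hκ x j) hg']
    | add a b ha hb' =>
      intro u i h1 h2 hf hg
      have ha2 : e (F12Poly.mon 1 (a.mapDomain (κ x))) ∈ D.part (d a) := hκd x a ▸ hd 1 _
      have hb2 : e (F12Poly.mon 1 (b.mapDomain (κ x))) ∈ D.part (d b) := hκd x b ▸ hd 1 _
      have hag : e (F12Poly.mon 1 (a.mapDomain (κ x))) ∉ D.prime (ptMap g x) := hb x ▸ hden x a
      have hbg : e (F12Poly.mon 1 (b.mapDomain (κ x))) ∉ D.prime (ptMap g x) := hb x ▸ hden x b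
      have h6 : e (F12Poly.mon u (a + b)) * (e (F12Poly.mon 1 (a.mapDomain (κ x))) *
          e (F12Poly.mon 1 (b.mapDomain (κ x)))) =
          e (F12Poly.mon u a) * e (F12Poly.mon 1 b) *
            e (F12Poly.mon 1 ((a + b).mapDomain (κ x))) := by
        rw [← map_mul, ← map_mul, ← map_mul, ← map_mul, F12Poly.mon_mul, F12Poly.mon_mul,
          F12Poly.mon_mul, F12Poly.mon_mul, Finsupp.mapDomain_add]
        simp only [mul_one]
      rw [gfrac_eq f h1 h2 (D.mul_mem_part (hd u a) (hd 1 b)) (D.mul_mem_part ha2 hb2) hf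
          (mul_notMem (hden x a) (hden x b)) h6,
        gfrac_eq g h1 h2 (D.mul_mem_part (hd u a) (hd 1 b)) (D.mul_mem_part ha2 hb2) hg
          (mul_notMem hag hbg) h6,
        ← gfrac_mul f (hd u a) ha2 (hd 1 b) hb2 (hden x a) (hden x b),
        ← gfrac_mul g (hd u a) ha2 (hd 1 b) hb2 hag hbg,
        ha u _ _ _ _ hag, hb' 1 _ _ _ _ hbg]
  refine hom_ext_gfrac hb fun i a b ha hb' x hf hg => ?_
  obtain ⟨a, rfl⟩ := he a
  obtain ⟨b, rfl⟩ := he b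
  obtain rfl | ⟨v, b, rfl⟩ := F12Poly.eq_zero_or_mon b
  · rw [map_zero] at hf
    exact (hf (D.zero_mem_prime _)).elim
  obtain rfl | ⟨u, a, rfl⟩ := F12Poly.eq_zero_or_mon a
  · simp only [map_zero, gfrac_zero]
  obtain rfl := hd' v b i hb'
  -- Numerator and denominator have the same degree, so they share one replacement `K`. Thus `a/b ·
  -- b/K = a/K`, where `f` and `g` agree on `a/K` and on the unit `b/K`.
  have hab := hκ' x a b (hd' u a _ ha)
  have hK : e (F12Poly.mon 1 (b.mapDomain (κ x))) ∈ D.part (d b) := hκd x b ▸ hd 1 _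
  have hKa : e (F12Poly.mon 1 (a.mapDomain (κ x))) ∈ D.part (d b) := hab ▸ hK
  have hKg : e (F12Poly.mon 1 (b.mapDomain (κ x))) ∉ D.prime (ptMap g x) := hb x ▸ hden x b
  have hKag : e (F12Poly.mon 1 (a.mapDomain (κ x))) ∉ D.prime (ptMap g x) := hb x ▸ hden x a
  have h1 := key x a u _ ha hKa (hden x a) hKag
  simp only [hab] at h1
  rw [← gfrac_mul_cancel f ha hb' hK hf (hden x b), ← gfrac_mul_cancel g ha hb' hK hg hKg,
    key x b v _ hb' hK (hden x b) hKg] at h1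
  exact (isUnit_gfrac g hb' hK hKg hg).mul_right_cancel h1

end ProjDatum

/-! ### Products of finite T0 spaces are spectral. -/

section ProductOfFiniteSpaces

variable {J : Type*} {Y : J → Type*} [∀ j, TopologicalSpace (Y j)]

/-- Tychonoff: every subset of a finite space is compact, so no topological condition on the sides
of the box is needed. -/
theorem isCompact_univ_pi_of_finite [∀ j, Finite (Y j)] (U : ∀ j, Set (Y j)) : IsCompact (Set.univ.pi U) :=
  isCompact_univ_pi fun j => (U j).toFinite.isCompact

-- A cylinder is the box with full sides outside its finite index set. Boxes are preferred to
-- cylinders because an intersection of two boxes is visibly a box, hence compact for finite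
-- factors.
variable (Y) in
theorem isTopologicalBasis_finite_boxes :
    IsTopologicalBasis (Set.range fun b : {b : ∀ j, Set (Y j) // IsOpen (Set.univ.pi b)} =>
      Set.univ.pi b.1) := by
  classical
  refine (isTopologicalBasis_pi fun j : J => isTopologicalBasis_opens (α := Y j)).of_isOpen_of_subset
    ?_ ?_
  · rintro _ ⟨b, rfl⟩
    exact b.2
  · rintro _ ⟨U, F, hU, rfl⟩
    have h : (F : Set J).pi U = Set.univ.pi fun j => if j ∈ F then U j else Set.univ := by
      ext x
      simp only [Set.mem_pi, Finset.mem_coe, Set.mem_univ, true_imp_iff]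
      refine forall_congr' fun j => ?_
      split_ifs with hj <;> simp [hj]
    exact ⟨⟨_, h ▸ isOpen_set_pi F.finite_toSet fun j hj => hU j hj⟩, h.symm⟩

/-- The generic point of an irreducible closed set `S` is the tuple of generic points of the
closures of its projections. The remaining axioms follow from the basis of compact open boxes. -/
theorem spectralSpace_pi_of_finite [∀ j, Finite (Y j)] [∀ j, T0Space (Y j)] : SpectralSpace (∀ j, Y j) where
  sober {S} hS hS' := by
    have := fun j => quasiSober_of_finite (Y j)
    have hirr : ∀ j, IsIrreducible ((fun x : ∀ j, Y j => x j) '' S) :=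
      fun j => hS.image _ (continuous_apply j).continuousOn
    refine ⟨fun j => (hirr j).genericPoint, ?_⟩
    have hmeet : ∀ j (U : Set (Y j)), IsOpen U → (hirr j).genericPoint ∈ U →
        ∃ y ∈ S, y j ∈ U := by
      intro j U hU hx
      obtain ⟨z, hz, hzU⟩ :=
        ((hirr j).isGenericPoint_genericPoint_closure.mem_open_set_iff hU).1 hx
      obtain ⟨_, h1, y, hy, rfl⟩ := mem_closure_iff.1 hz U hU hzU
      exact ⟨y, hy, h1⟩
    refine le_antisymm ?_ fun y hy => ?_
    · refine hS'.closure_subset_iff.2 (Set.singleton_subset_iff.2 ?_)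
      refine hS'.closure_subset ?_
      rw [(isTopologicalBasis_pi fun j : J =>
        isTopologicalBasis_opens (α := Y j)).mem_closure_iff]
      rintro _ ⟨U, F, hU, rfl⟩ hx
      -- A basic neighbourhood of the tuple constrains finitely many coordinates. `S` meets each
      -- constraint, and by irreducibility it meets their finite intersection; as `S` is closed, the
      -- tuple lies in it.
      have hFin : ∀ G : Finset J, G ⊆ F → ∃ y ∈ S, ∀ j ∈ G, y j ∈ U j := by
        classical
        intro G
        induction G using Finset.induction_on with
        | empty => exact fun _ => ⟨hS.nonempty.some, hS.nonempty.some_mem, by simp⟩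
        | insert j G hj ih =>
          intro hG
          obtain ⟨y, hy, hyG⟩ := ih fun i hi => hG (Finset.mem_insert_of_mem hi)
          have hjF : j ∈ F := hG (Finset.mem_insert_self j G)
          obtain ⟨y', hy', hyj⟩ := hmeet j (U j) (hU j hjF) (hx j hjF)
          have ho1 : IsOpen ((G : Set J).pi U) := isOpen_set_pi G.finite_toSet
            fun i hi => hU i (hG (Finset.mem_insert_of_mem hi))
          obtain ⟨z, hz, hz1, hz2⟩ := hS.isPreirreducible _ _ ho1
            ((hU j hjF).preimage (continuous_apply j)) ⟨y, hy, hyG⟩ ⟨y', hy', hyj⟩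
          refine ⟨z, hz, fun i hi => ?_⟩
          rcases Finset.mem_insert.1 hi with rfl | hi
          · exact hz2
          · exact hz1 i hi
      obtain ⟨y, hy, hyF⟩ := hFin F le_rfl
      exact ⟨y, hyF, hy⟩
    · rw [← specializes_iff_mem_closure, specializes_pi]
      intro j
      exact (hirr j).isGenericPoint_genericPoint_closure.specializes
        (subset_closure ⟨y, hy, rfl⟩)
  inter_isCompact := by
    refine (QuasiSeparatedSpace.of_isTopologicalBasis (isTopologicalBasis_finite_boxes Y)
      fun i j => ?_).inter_isCompact
    rw [← Set.pi_inter_distrib]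
    exact isCompact_univ_pi_of_finite _
  isTopologicalBasis := (PrespectralSpace.of_isTopologicalBasis'
    (isTopologicalBasis_finite_boxes Y) fun _ => isCompact_univ_pi_of_finite _).isTopologicalBasis

end ProductOfFiniteSpaces

/-! ### Unit loci of sections and their compactness. -/

namespace ProjDatum

variable {D : ProjDatum}

/-- Clearing denominators in `(a/b)(c/s) = 1` gives `k a c = k b s` with `k, b, s` outside the prime
ideal, so `a` cannot lie in it. -/
theorem notMem_of_mk_mul_eq_one {x : D.pt} {a : D.M} {b : D.den x} {z : D.Loc x}
    (h : Localization.mk a b * z = 1) : a ∉ D.prime x := by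
  intro ha
  induction z using Localization.induction_on with
  | H y =>
    obtain ⟨c, s⟩ := y
    rw [Localization.mk_mul, ← Localization.mk_one, Localization.mk_eq_mk_iff,
      Localization.r_iff_exists] at h
    obtain ⟨k, hk⟩ := h
    simp only [OneMemClass.coe_one, one_mul, mul_one] at hk
    have hmem : (k : D.M) * (a * c) ∈ D.prime x := by
      rw [mul_comm]
      exact D.mul_mem_prime _ (D.mul_mem_prime _ ha)
    rw [hk] at hmem
    rcases D.mem_or_mem hmem with h3 | h3
    · exact k.2.1 h3
    · exact (b * s).2.1 h3

/-- The germ of a section at a point is a unit. -/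
def SUnitAt {U : Opens D.pt} (s : D.sections U) (x : D.pt) : Prop :=
  UnitAt (X := D.space) (U := U) s x

theorem sunitAt_sres_iff {U V : Opens D.pt} (h : V ≤ U) (s : D.sections U) {x : D.pt}
    (hx : x ∈ V) : SUnitAt (sres h s) x ↔ SUnitAt s x :=
  ⟨fun hs => UnitAt.of_res (X := D.space) h hs, fun hs => UnitAt.res (X := D.space) hs h hx⟩

theorem sunitAt_sfrac_iff {i : D.ι} {a b : D.M} (ha : a ∈ D.part i) (hb : b ∈ D.part i)
    {U : Opens D.pt} (hU : ∀ x ∈ U, b ∉ D.prime x) {x : D.pt} (hx : x ∈ U) :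
    SUnitAt (sfrac a b ha hb U hU) x ↔ a ∉ D.prime x := by
  constructor
  · rintro ⟨(V : Opens D.pt), hV, hxV, hu⟩
    obtain ⟨r, hr⟩ : ∃ r : D.sections V, sres hV (sfrac a b ha hb U hU) * r = 1 :=
      hu.exists_right_inv
    exact notMem_of_mk_mul_eq_one (congrFun (congrArg Subtype.val hr) ⟨x, hxV⟩)
  · intro hax
    let V : Opens D.pt := U ⊓ basicOpen a ha
    have hV : V ≤ U := inf_le_left
    refine ⟨V, hV, ⟨hx, hax⟩, ?_⟩
    have h : sres hV (sfrac a b ha hb U hU) * sfrac b a hb ha V (fun _ h => h.2) = 1 := by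
      refine Subtype.ext (funext fun y => ?_)
      have h1 : b ∈ D.den y.1 := ⟨hU _ y.2.1, i, hb⟩
      have h2 : a ∈ D.den y.1 := ⟨y.2.2, i, ha⟩
      change Localization.mk a ⟨b, h1⟩ * Localization.mk b ⟨a, h2⟩ = 1
      rw [Localization.mk_mul, ← Localization.mk_self (⟨a, h2⟩ * ⟨b, h1⟩ : D.den y.1)]
      congr 1
      exact mul_comm _ _
    exact IsUnit.of_mul_eq_one (M := D.sections V) _ h

/-- Near each point `s` is a fraction `a/b`, and on a compact open `V` in its domain the unit locus
is `V ∩ D₊(a)`, compact because the space is spectral. Finitely many such `V` cover `U`. This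
replaces the noetherian hypothesis for the infinite product. -/
theorem isCompact_setOf_sunitAt [SpectralSpace D.pt]
    (hc : ∀ (i : D.ι) (a : D.M), a ∈ D.part i → IsCompact {x | a ∉ D.prime x})
    {U : Opens D.pt} (hU : IsCompact (U : Set D.pt)) (s : D.sections U) :
    IsCompact {x | SUnitAt s x} := by
  have key : ∀ x ∈ U, ∃ V : Opens D.pt, x ∈ V ∧ IsCompact {y | y ∈ V ∧ SUnitAt s y} := by
    intro x hx
    obtain ⟨W, hW, i, a, b, ha, hb, hWb, hxW, hs⟩ := exists_sres_eq_sfrac s hx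
    obtain ⟨V, ⟨hVo, hVc⟩, hxV, hVW⟩ :=
      PrespectralSpace.isTopologicalBasis.exists_subset_of_mem_open hxW W.2
    refine ⟨⟨V, hVo⟩, hxV, ?_⟩
    have h : {y | y ∈ V ∧ SUnitAt s y} = V ∩ {y | a ∉ D.prime y} := by
      ext y
      refine and_congr_right fun hy => ?_
      rw [← sunitAt_sres_iff hW s (hVW hy), hs]
      exact sunitAt_sfrac_iff ha hb hWb (hVW hy)
    change IsCompact {y | y ∈ V ∧ SUnitAt s y}
    rw [h]
    exact hVc.inter_of_isOpen (hc i a ha) hVo (D.isOpen_basic ha)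
  choose V hV hVc using fun x : U => key x.1 x.2
  obtain ⟨t, ht⟩ := hU.elim_finite_subcover (fun x : U => (V x : Set D.pt)) (fun x => (V x).2)
    fun x hx => Set.mem_iUnion.2 ⟨⟨x, hx⟩, hV ⟨x, hx⟩⟩
  have h : {x | SUnitAt s x} = ⋃ x ∈ t, {y | y ∈ V x ∧ SUnitAt s y} := by
    ext y
    simp only [Set.mem_ofPred_eq, Set.mem_iUnion, exists_prop]
    constructor
    · intro hy
      obtain ⟨x, hx, hxy⟩ : ∃ x ∈ t, y ∈ V x := by
        simpa using ht (UnitAt.mem (X := D.space) hy)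
      exact ⟨x, hx, hxy, hy⟩
    · rintro ⟨x, _, _, hy⟩
      exact hy
  rw [h]
  exact t.finite_toSet.isCompact_biUnion fun x _ => hVc x

/-- The weak scheme of a datum whose space is spectral with compact sets `D₊(a)`. -/
def toWeakSchemeOfCompact (D : ProjDatum) [SpectralSpace D.pt]
    (hc : ∀ (i : D.ι) (a : D.M), a ∈ D.part i → IsCompact {x | a ∉ D.prime x}) :
    WeakScheme where
  space := D.space
  spectral := inferInstanceAs (SpectralSpace D.pt)
  support := supportOfCompact D.space not_unitAt_zero fun _ hU s =>
    isCompact_setOf_sunitAt hc hU s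

end ProjDatum

/-! ### `Spec 𝔽_{1²}` is a point, and morphisms to it. -/

section Subsingleton

instance : Subsingleton (MonoidPrime F12) where
  allEq p q := by
    have h : ∀ (p : MonoidPrime F12) (a : F12), a ∈ p.carrier ↔ a = 0 := by
      intro p a
      -- Every nonzero element is invertible, so the only prime ideal is `{0}`.
      refine ⟨fun ha => ?_, fun ha => ha ▸ p.zero_mem⟩
      by_contra h0
      have := p.mul_mem a⁻¹ ha
      rw [mul_inv_cancel₀ h0] at this
      exact p.one_notMem this
    exact MonoidPrime.ext (Set.ext fun a => (h p a).trans (h q a).symm)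

instance : Subsingleton (specDatum F12).pt := inferInstanceAs (Subsingleton (MonoidPrime F12))

end Subsingleton

namespace ProjDatum

variable {D : ProjDatum} {X : MonoidSpace}

/-- Morphisms to `Spec 𝔽_{1²}` are determined by the pullbacks of `±1`. -/
theorem specF12_hom_ext {f g : X ⟶ (specDatum F12).space}
    (h : ∀ (x : X) (u : ℤˣ), gfrac (D := specDatum F12) f (i := ()) (u : F12) (1 : F12) trivial
      trivial x ((specDatum F12).one_notMem_prime _) =
      gfrac (D := specDatum F12) g (i := ()) (u : F12) (1 : F12) trivial
      trivial x ((specDatum F12).one_notMem_prime _)) : f = g := by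
  refine hom_ext_gfrac (fun x => Subsingleton.elim _ _) fun i a b ha hb x hf hg => ?_
  change F12 at a b
  have hb0 : b ≠ 0 := by
    rintro rfl
    exact hf ((specDatum F12).zero_mem_prime _)
  -- Nonzero denominators are invertible and can be moved into the numerator, leaving only `0` and
  -- `±1`.
  have h1 : ∀ f : X ⟶ (specDatum F12).space, ∀ hf, gfrac (D := specDatum F12) f a b ha hb x hf =
      gfrac (D := specDatum F12) f (i := ()) (a * b⁻¹ : F12) (1 : F12) trivial trivial x
        ((specDatum F12).one_notMem_prime _) := by
    intro f hf
    refine gfrac_eq f _ _ _ _ _ _ ?_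
    change a * 1 = a * b⁻¹ * b
    rw [mul_one, mul_assoc, inv_mul_cancel₀ hb0, mul_one]
  rw [h1, h1]
  generalize a * b⁻¹ = c
  induction c using WithZero.recZeroCoe with
  | zero => exact (gfrac_zero f _ _ _).trans (gfrac_zero g _ _ _).symm
  | coe u => exact h x u

end ProjDatum

/-! ### Points of projective space, and morphisms to it in coordinates. -/

namespace F12Poly

variable {σ : Type}

theorem exists_X_notMem (p : (projSpaceDatum σ).pt) :
    ∃ i, X i ∉ (projSpaceDatum σ).prime p := p.2

theorem mon_mem_prime_iff (p : (projSpaceDatum σ).pt) (u : ℤˣ) (a : σ →₀ ℕ) :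
    mon u a ∈ (projSpaceDatum σ).prime p ↔ ∃ i, a i ≠ 0 ∧ X i ∈ (projSpaceDatum σ).prime p :=
  mem_prime_iff p.1 u a

/-- By primality a monomial lies in the ideal exactly when one of the variables occurring in it
does. -/
theorem pt_ext {p q : (projSpaceDatum σ).pt}
    (h : ∀ i, X i ∈ (projSpaceDatum σ).prime p ↔ X i ∈ (projSpaceDatum σ).prime q) : p = q := by
  refine Subtype.ext (MonoidPrime.ext (Set.ext fun z => ?_))
  obtain rfl | ⟨u, a, rfl⟩ := eq_zero_or_mon z
  · exact iff_of_true p.1.zero_mem q.1.zero_mem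
  · refine (mon_mem_prime_iff p u a).trans (Iff.trans ?_ (mon_mem_prime_iff q u a).symm)
    simp only [h]

theorem mapDomain_const {τ : Type*} (t : τ) (a : σ →₀ ℕ) :
    a.mapDomain (fun _ => t) = Finsupp.single t (Finsupp.degree a) := by
  induction a using exponent_induction with
  | zero => simp
  | single i => simp [Finsupp.mapDomain_single]
  | add a b ha hb => rw [Finsupp.mapDomain_add, ha, hb, map_add, Finsupp.single_add]

end F12Poly

namespace ProjDatum

variable {X : MonoidSpace} {σ : Type}

/-- The pullbacks of `±1` to the stalk at `x`. -/
noncomputable def sign (f : X ⟶ (projSpaceDatum σ).space) (x : X) : ℤˣ →* Germ X x where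
  toFun u := gfrac f (i := (0 : ℕ)) (F12Poly.mon u 0) 1 (F12Poly.mon_mem_part_iff.2 (map_zero _))
    (projSpaceDatum σ).one_mem_part x ((projSpaceDatum σ).one_notMem_prime _)
  map_one' := gfrac_self f _ _
  map_mul' u v := by
    refine Eq.trans ?_ (gfrac_mul f _ _ _ _ _ _).symm
    exact gfrac_eq f _ _ _ _ _ _ (congrArg (F12Poly.mon (u * v) 0 * ·) (mul_one 1))

/-- The pullback of `x_l / x_n` to the stalk at `x`. -/
noncomputable def ratio (f : X ⟶ (projSpaceDatum σ).space) (l n : σ) (x : X)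
    (hx : F12Poly.X n ∉ (projSpaceDatum σ).prime (ptMap f x)) : Germ X x :=
  gfrac f (i := (1 : ℕ)) (F12Poly.X l) (F12Poly.X n) (F12Poly.X_mem_part l)
    (F12Poly.X_mem_part n) x hx

/-- Morphisms to projective space are determined by the map of points and the pullbacks of `±1`
and of the quotients of coordinates. -/
theorem projSpace_hom_ext {f g : X ⟶ (projSpaceDatum σ).space} (hb : ∀ x, ptMap f x = ptMap g x)
    (hu : ∀ x u, sign f x u = sign g x u)
    (hX : ∀ x l n hf hg, ratio f l n x hf = ratio g l n x hg) : f = g := by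
  choose n hn using fun x => F12Poly.exists_X_notMem (ptMap f x)
  refine hom_ext_of_generators (D := projSpaceDatum σ) (MonoidWithZeroHom.id (F12Poly σ))
    (fun z => ⟨z, rfl⟩) (fun a => (Finsupp.degree a : ℕ))
    (fun u a => F12Poly.mon_mem_part_iff.2 rfl) (fun u a i h => F12Poly.mon_mem_part_iff.1 h) hb
    -- All variables have degree 1, so a single coordinate nonvanishing at the image of `x` can
    -- replace every variable.
    (fun x _ => n x) (fun x _ => hn x) ?_ ?_ ?_ ?_
  · intro x a
    rw [F12Poly.mapDomain_const, Finsupp.degree_single]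
  · intro x a b hab
    rw [F12Poly.mapDomain_const, F12Poly.mapDomain_const]
    exact congrArg _ hab
  · exact fun x u h0 => hu x u
  · intro x i j hi hj hf hg
    have h2 : ∀ (f : X ⟶ (projSpaceDatum σ).space) hf, gfrac f (F12Poly.X i) (F12Poly.X (n x)) hi
        hj x hf = ratio f i (n x) x hf := fun f hf => gfrac_eq f _ _ _ _ _ _ rfl
    exact (h2 f hf).trans ((hX x i (n x) hf hg).trans (h2 g hg).symm)

end ProjDatum

/-! ### The multigraded `Proj` and its projections. -/

section ProductDatum

variable {J : Type} (σ : J → Type)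

/-- The product over `𝔽_{1²}` of the projective spaces with coordinates indexed by the `σ j`: the
multigraded `Proj` of the monomial algebra in all the coordinates. -/
noncomputable def prodDatum : ProjDatum where
  M := F12Poly (Σ j, σ j)
  ι := J →₀ ℕ
  part d := {z | ∀ u a, z = F12Poly.mon u a → a.mapDomain Sigma.fst = d}
  zero_mem_part _ _ _ h := (F12Poly.mon_ne_zero _ _ h.symm).elim
  one_mem_part u a h := by
    rw [← F12Poly.mon_one_zero, F12Poly.mon_inj] at h
    rw [← h.2, Finsupp.mapDomain_zero]
  mul_mem_part {i j a b} ha hb u c h := by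
    obtain rfl | ⟨v, a, rfl⟩ := F12Poly.eq_zero_or_mon a
    · rw [zero_mul] at h
      exact (F12Poly.mon_ne_zero _ _ h.symm).elim
    obtain rfl | ⟨w, b, rfl⟩ := F12Poly.eq_zero_or_mon b
    · rw [mul_zero] at h
      exact (F12Poly.mon_ne_zero _ _ h.symm).elim
    rw [F12Poly.mon_mul, F12Poly.mon_inj] at h
    rw [← h.2, Finsupp.mapDomain_add, ha v a rfl, hb w b rfl]
  -- Points are families rather than prime ideals, so the topology is the product topology by
  -- construction. The ideal of a family contains `0`, vacuously, and the monomials in which some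
  -- variable vanishes in its own factor.
  pt := ∀ j, (projSpaceDatum (σ j)).pt
  prime p := {z | ∀ u a, z = F12Poly.mon u a →
    ∃ i, a i ≠ 0 ∧ F12Poly.X i.2 ∈ (projSpaceDatum (σ i.1)).prime (p i.1)}
  zero_mem_prime _ _ _ h := (F12Poly.mon_ne_zero _ _ h.symm).elim
  mul_mem_prime {p a} b ha u c h := by
    obtain rfl | ⟨v, a, rfl⟩ := F12Poly.eq_zero_or_mon a
    · rw [zero_mul] at h
      exact (F12Poly.mon_ne_zero _ _ h.symm).elim
    obtain rfl | ⟨w, b, rfl⟩ := F12Poly.eq_zero_or_mon b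
    · rw [mul_zero] at h
      exact (F12Poly.mon_ne_zero _ _ h.symm).elim
    rw [F12Poly.mon_mul, F12Poly.mon_inj] at h
    obtain ⟨i, hi, hp⟩ := ha v a rfl
    exact ⟨i, by rw [← h.2, Finsupp.add_apply]; omega, hp⟩
  one_notMem_prime p h := by
    obtain ⟨i, hi, -⟩ := h 1 0 rfl
    exact hi rfl
  mem_or_mem {p a b} h := by
    by_contra! hab
    obtain rfl | ⟨v, a, rfl⟩ := F12Poly.eq_zero_or_mon a
    · exact hab.1 fun _ _ h => (F12Poly.mon_ne_zero _ _ h.symm).elim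
    obtain rfl | ⟨w, b, rfl⟩ := F12Poly.eq_zero_or_mon b
    · exact hab.2 fun _ _ h => (F12Poly.mon_ne_zero _ _ h.symm).elim
    obtain ⟨i, hi, hp⟩ := h _ _ (F12Poly.mon_mul v w a b)
    rw [Finsupp.add_apply] at hi
    rcases Nat.eq_zero_or_pos (a i) with h0 | h0
    · refine hab.2 fun u c hc => ⟨i, ?_, hp⟩
      rw [← (F12Poly.mon_inj.1 hc).2]
      omega
    · refine hab.1 fun u c hc => ⟨i, ?_, hp⟩
      rw [← (F12Poly.mon_inj.1 hc).2]
      omega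
  isOpen_basic {_ z} _ := by
    obtain rfl | ⟨u, a, rfl⟩ := F12Poly.eq_zero_or_mon z
    · convert! isOpen_empty
      ext p
      exact iff_of_false (fun h => h fun _ _ h => (F12Poly.mon_ne_zero _ _ h.symm).elim) id
    · have h : {p : ∀ j, (projSpaceDatum (σ j)).pt | ¬ ∀ v b, F12Poly.mon u a = F12Poly.mon v b →
          ∃ i, b i ≠ 0 ∧ F12Poly.X i.2 ∈ (projSpaceDatum (σ i.1)).prime (p i.1)} =
          ⋂ i ∈ a.support, {p | F12Poly.X i.2 ∉ (projSpaceDatum (σ i.1)).prime (p i.1)} := by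
        ext p
        simp only [Set.mem_ofPred_eq, Set.mem_iInter, F12Poly.mon_inj, Finsupp.mem_support_iff]
        constructor
        · intro h i hi hp
          exact h fun v b hb => ⟨i, hb.2 ▸ hi, hp⟩
        · intro h h'
          obtain ⟨i, hi, hp⟩ := h' u a ⟨rfl, rfl⟩
          exact h i hi hp
      change IsOpen {p : ∀ j, (projSpaceDatum (σ j)).pt | ¬ ∀ v b, F12Poly.mon u a =
        F12Poly.mon v b → ∃ i, b i ≠ 0 ∧ F12Poly.X i.2 ∈ (projSpaceDatum (σ i.1)).prime (p i.1)}
      rw [h]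
      refine isOpen_biInter_finset fun i _ => ?_
      exact ((projSpaceDatum (σ i.1)).isOpen_basic (F12Poly.X_mem_part i.2)).preimage
        (continuous_apply (A := fun j => (projSpaceDatum (σ j)).pt) i.1)

variable {σ}

theorem mon_mem_prodDatum_part_iff {u : ℤˣ} {a : (Σ j, σ j) →₀ ℕ} {d : J →₀ ℕ} :
    (F12Poly.mon u a) ∈ (prodDatum σ).part d ↔ a.mapDomain Sigma.fst = d := by
  refine ⟨fun h => h u a rfl, ?_⟩
  rintro h v b hb
  rw [← (F12Poly.mon_inj.1 hb).2, h]

theorem mon_mem_prodDatum_prime_iff {u : ℤˣ} {a : (Σ j, σ j) →₀ ℕ} {p : (prodDatum σ).pt} :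
    (F12Poly.mon u a) ∈ (prodDatum σ).prime p ↔
      ∃ i, a i ≠ 0 ∧ F12Poly.X i.2 ∈ (projSpaceDatum (σ i.1)).prime (p i.1) := by
  refine ⟨fun h => h u a rfl, ?_⟩
  rintro ⟨i, hi, hp⟩ v b hb
  exact ⟨i, (F12Poly.mon_inj.1 hb).2 ▸ hi, hp⟩

theorem X_mem_prodDatum_prime_iff {i : Σ j, σ j} {p : (prodDatum σ).pt} :
    (F12Poly.X i) ∈ (prodDatum σ).prime p ↔
      F12Poly.X i.2 ∈ (projSpaceDatum (σ i.1)).prime (p i.1) := by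
  rw [F12Poly.X_eq_mon, mon_mem_prodDatum_prime_iff]
  constructor
  · rintro ⟨k, hk, hp⟩
    obtain rfl : i = k := by
      by_contra h
      exact hk (Finsupp.single_eq_of_ne (Ne.symm h))
    exact hp
  · exact fun h => ⟨i, by simp, h⟩

theorem X_mem_prodDatum_part (i : Σ j, σ j) :
    (F12Poly.X i) ∈ (prodDatum σ).part (Finsupp.single i.1 1) := by
  rw [F12Poly.X_eq_mon, mon_mem_prodDatum_part_iff, Finsupp.mapDomain_single]

instance [∀ j, Finite (σ j)] : SpectralSpace (prodDatum σ).pt :=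
  spectralSpace_pi_of_finite (Y := fun j => (projSpaceDatum (σ j)).pt)

/-- Nonvanishing of a monomial is a separate condition on each factor, involving only the variables
of its block. So the locus is a box. -/
theorem isCompact_prodDatum_basic [∀ j, Finite (σ j)] (z : F12Poly (Σ j, σ j)) :
    IsCompact {p : (prodDatum σ).pt | z ∉ (prodDatum σ).prime p} := by
  obtain rfl | ⟨u, a, rfl⟩ := F12Poly.eq_zero_or_mon z
  · convert! isCompact_empty
    ext p
    exact iff_of_false (fun h => h ((prodDatum σ).zero_mem_prime p)) id
  · have h : {p : (prodDatum σ).pt | F12Poly.mon u a ∉ (prodDatum σ).prime p} =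
        Set.univ.pi fun j => {q : (projSpaceDatum (σ j)).pt |
          ∀ l, a ⟨j, l⟩ ≠ 0 → F12Poly.X l ∉ (projSpaceDatum (σ j)).prime q} := by
      ext p
      refine (not_congr mon_mem_prodDatum_prime_iff).trans ?_
      constructor
      · exact fun h j _ l hl hp => h ⟨⟨j, l⟩, hl, hp⟩
      · rintro h ⟨i, hi, hp⟩
        exact h i.1 trivial i.2 hi hp
    rw [h]
    exact isCompact_univ_pi_of_finite _

/-- The product of the projective spaces as a weak scheme. -/
noncomputable def prodScheme (σ : J → Type) [∀ j, Finite (σ j)] : WeakScheme :=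
  (prodDatum σ).toWeakSchemeOfCompact fun _ z _ => isCompact_prodDatum_basic z

theorem const_mem_prodDatum_part (a : F12) : F12Poly.const a ∈ (prodDatum σ).part 0 := by
  induction a using WithZero.recZeroCoe with
  | zero =>
    rw [map_zero]
    exact (prodDatum σ).zero_mem_part 0
  | coe u => exact mon_mem_prodDatum_part_iff.2 Finsupp.mapDomain_zero

/-- The inclusion of the coordinates of the `j`-th factor. -/
noncomputable def prodCoord (σ : J → Type) (j : J) : F12Poly (σ j) →*₀ F12Poly (Σ j, σ j) :=
  WithZero.map' ((MonoidHom.id ℤˣ).prodMap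
    (AddMonoidHom.toMultiplicative (Finsupp.mapDomain.addMonoidHom (Sigma.mk j))))

theorem prodCoord_mon (j : J) (u : ℤˣ) (a : σ j →₀ ℕ) :
    prodCoord σ j (F12Poly.mon u a) = F12Poly.mon u (a.mapDomain (Sigma.mk j)) := rfl

theorem prodCoord_X (j : J) (l : σ j) :
    prodCoord σ j (F12Poly.X l) = F12Poly.X ⟨j, l⟩ := by
  rw [F12Poly.X_eq_mon, prodCoord_mon, Finsupp.mapDomain_single]
  rfl

theorem prodCoord_mem_part (j : J) {n : ℕ} {z : F12Poly (σ j)} (hz : z ∈ F12Poly.part n) :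
    prodCoord σ j z ∈ (prodDatum σ).part (Finsupp.single j n) := by
  obtain rfl | ⟨u, a, rfl⟩ := F12Poly.eq_zero_or_mon z
  · rw [map_zero]
    exact (prodDatum σ).zero_mem_part _
  · rw [prodCoord_mon, mon_mem_prodDatum_part_iff, ← Finsupp.mapDomain_comp]
    obtain rfl := F12Poly.mon_mem_part_iff.1 hz
    exact F12Poly.mapDomain_const j a

theorem mem_prime_iff_prodCoord (j : J) (p : (prodDatum σ).pt) (z : F12Poly (σ j)) :
    z ∈ (projSpaceDatum (σ j)).prime (p j) ↔ prodCoord σ j z ∈ (prodDatum σ).prime p := by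
  obtain rfl | ⟨u, a, rfl⟩ := F12Poly.eq_zero_or_mon z
  · rw [map_zero]
    exact iff_of_true ((projSpaceDatum (σ j)).zero_mem_prime _) ((prodDatum σ).zero_mem_prime _)
  · rw [prodCoord_mon, mon_mem_prodDatum_prime_iff]
    refine (F12Poly.mon_mem_prime_iff _ u a).trans ?_
    constructor
    · rintro ⟨l, hl, hp⟩
      refine ⟨⟨j, l⟩, ?_, hp⟩
      rwa [Finsupp.mapDomain_apply sigma_mk_injective]
    · rintro ⟨⟨k, l⟩, hl, hp⟩
      -- The image of a monomial of the `j`-th factor has exponent `0` on all other blocks, so only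
      -- variables of block `j` can put it in the ideal.
      by_cases hk : k = j
      · subst hk
        rw [Finsupp.mapDomain_apply sigma_mk_injective] at hl
        exact ⟨l, hl, hp⟩
      · refine (hl (Finsupp.mapDomain_of_notMem_range _ _ ?_)).elim
        rintro ⟨l', hl'⟩
        exact hk (congrArg Sigma.fst hl').symm

/-- The projection to the `j`-th factor. -/
noncomputable def prodProj (σ : J → Type) (j : J) :
    ProjDatum.Hom (prodDatum σ) (projSpaceDatum (σ j)) where
  hom := prodCoord σ j
  deg n := Finsupp.single j n
  map_part hz := prodCoord_mem_part j hz
  base p := p j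
  continuous_base := continuous_apply (A := fun j => (projSpaceDatum (σ j)).pt) j
  mem_prime_base p _ z _ := mem_prime_iff_prodCoord j p z

end ProductDatum

/-! ### Families of germs that come from sections. -/

namespace MonoidSpace

variable {X : MonoidSpace}

/-- A family of germs that is given by a section near `x`. -/
def LocallySec (x : X) (z : ∀ y, Germ X y) : Prop :=
  ∃ (W : Opens X) (r : Sec X W), x ∈ W ∧ ∀ y (hy : y ∈ W), germ hy r = z y

namespace LocallySec

variable {x : X} {z w : ∀ y, Germ X y}

theorem one : LocallySec x fun _ => 1 :=
  ⟨⊤, 1, trivial, fun _ hy => map_one (germ hy)⟩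

theorem mul (hz : LocallySec x z) (hw : LocallySec x w) : LocallySec x fun y => z y * w y := by
  obtain ⟨U, r, hxU, hr⟩ := hz
  obtain ⟨V, s, hxV, hs⟩ := hw
  refine ⟨U ⊓ V, res inf_le_left r * res inf_le_right s, ⟨hxU, hxV⟩, fun y hy => ?_⟩
  rw [map_mul, germ_res, germ_res, hr y hy.1, hs y hy.2]

theorem pow (hz : LocallySec x z) (n : ℕ) : LocallySec x fun y => z y ^ n := by
  obtain ⟨U, r, hxU, hr⟩ := hz
  exact ⟨U, r ^ n, hxU, fun y hy => by rw [map_pow, hr y hy]⟩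

theorem prod {ι : Type*} (s : Finset ι) {z : ι → ∀ y, Germ X y} (h : ∀ i ∈ s, LocallySec x (z i)) :
    LocallySec x fun y => ∏ i ∈ s, z i y := by
  classical
  induction s using Finset.induction_on with
  | empty => simpa only [Finset.prod_empty] using one
  | insert i s hi ih =>
    simp only [Finset.prod_insert hi]
    exact (h i (Finset.mem_insert_self i s)).mul
      (ih fun j hj => h j (Finset.mem_insert_of_mem hj))

end LocallySec

end MonoidSpace

/-! ### Morphisms to the product as families of morphisms to the factors. -/

namespace ProjDatum

variable {X : MonoidSpace} {J : Type} {σ : J → Type}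

theorem gfrac_prod (f : X ⟶ (prodDatum σ).space) (j : J) (l n : σ j) (x : X)
    (hx : F12Poly.X n ∉ (projSpaceDatum (σ j)).prime (ptMap (f ≫ (prodProj σ j).toSpaceHom) x))
    {d : J →₀ ℕ} (hl : F12Poly.X ⟨j, l⟩ ∈ (prodDatum σ).part d)
    (hn : F12Poly.X ⟨j, n⟩ ∈ (prodDatum σ).part d)
    (hx' : F12Poly.X ⟨j, n⟩ ∉ (prodDatum σ).prime (ptMap f x)) :
    ratio (f ≫ (prodProj σ j).toSpaceHom) l n x hx =
      gfrac f (F12Poly.X ⟨j, l⟩) (F12Poly.X ⟨j, n⟩) hl hn x hx' := by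
  have h1 : (prodProj σ j).hom (F12Poly.X n) ∉ (prodDatum σ).prime (ptMap f x) := by
    change prodCoord σ j (F12Poly.X n) ∉ _
    rwa [prodCoord_X]
  refine (gfrac_comp f (prodProj σ j) _ _ hx h1).trans (gfrac_eq f _ _ _ _ _ _ ?_)
  change prodCoord σ j (F12Poly.X l) * F12Poly.X ⟨j, n⟩ =
    F12Poly.X ⟨j, l⟩ * prodCoord σ j (F12Poly.X n)
  rw [prodCoord_X, prodCoord_X]

theorem sign_prod (f : X ⟶ (prodDatum σ).space) (j : J) (x : X) (u : ℤˣ)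
    (h0 : F12Poly.mon u 0 ∈ (prodDatum σ).part 0) :
    sign (f ≫ (prodProj σ j).toSpaceHom) x u = gfrac f (F12Poly.mon u 0) 1 h0
      (prodDatum σ).one_mem_part x ((prodDatum σ).one_notMem_prime _) := by
  have h1 : (prodProj σ j).hom 1 ∉ (prodDatum σ).prime (ptMap f x) := by
    rw [map_one]
    exact (prodDatum σ).one_notMem_prime _
  refine (gfrac_comp f (prodProj σ j) _ _ ((projSpaceDatum (σ j)).one_notMem_prime _) h1).trans (gfrac_eq f _ _ _ _ _ _ ?_)
  rw [map_one]
  rfl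

/-- Morphisms to the product are determined by their components. -/
theorem prodDatum_hom_ext [Nonempty J] {f g : X ⟶ (prodDatum σ).space}
    (h : ∀ j, f ≫ (prodProj σ j).toSpaceHom = g ≫ (prodProj σ j).toSpaceHom) : f = g := by
  have hb : ∀ x, ptMap f x = ptMap g x := fun x => funext fun j =>
    congrArg (fun k => ptMap k x) (h j)
  choose n hn using fun x j => F12Poly.exists_X_notMem (ptMap f x j)
  refine hom_ext_of_generators (D := prodDatum σ) (MonoidWithZeroHom.id (F12Poly (Σ j, σ j)))
    (fun z => ⟨z, rfl⟩) (fun a => a.mapDomain Sigma.fst)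
    (fun u a => mon_mem_prodDatum_part_iff.2 rfl)
    (fun u a i h => mon_mem_prodDatum_part_iff.1 h) hb
    -- Each variable is replaced by a nonvanishing one from its own block, which preserves the
    -- multidegree.
    (fun x i => ⟨i.1, n x i.1⟩) (fun x i => X_mem_prodDatum_prime_iff.not.2 (hn x i.1)) ?_ ?_ ?_ ?_
  · intro x a
    rw [← Finsupp.mapDomain_comp]
    rfl
  · intro x a b hab
    have h1 : (fun i : Σ j, σ j => (⟨i.1, n x i.1⟩ : Σ j, σ j)) =
        (fun j => ⟨j, n x j⟩) ∘ Sigma.fst := rfl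
    rw [h1, Finsupp.mapDomain_comp, Finsupp.mapDomain_comp]
    exact congrArg _ hab
  · intro x u h0
    -- The pullback of `±1` is read off in any one factor; an empty product would not see it.
    obtain ⟨j⟩ := ‹Nonempty J›
    refine (sign_prod f j x u h0).symm.trans (Eq.trans ?_ (sign_prod g j x u h0))
    rw [h j]
  · rintro x ⟨j, l⟩ d hi hj hf hg
    have hf' := X_mem_prodDatum_prime_iff.not.1 hf
    have hg' := X_mem_prodDatum_prime_iff.not.1 hg
    refine (gfrac_prod f j l (n x j) x hf' hi hj hf).symm.trans
      (Eq.trans ?_ (gfrac_prod g j l (n x j) x hg' hi hj hg))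
    congr 1
    exact h j

/-- Morphisms to the projective spaces that agree on `±1` are the components of a morphism to
the product. -/
theorem exists_prodDatum_lift (g : ∀ j, X ⟶ (projSpaceDatum (σ j)).space) (j₀ : J)
    (hg : ∀ j x u, sign (g j) x u = sign (g j₀) x u) :
    ∃ f : X ⟶ (prodDatum σ).space, ∀ j, f ≫ (prodProj σ j).toSpaceHom = g j := by
  classical
  choose n hn using fun x j => F12Poly.exists_X_notMem (ptMap (g j) x)
  let φ : X → (prodDatum σ).pt := fun x j => ptMap (g j) x
  have hφ : Continuous φ := continuous_pi fun j => continuous_ptMap (g j)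
  -- The variable `(j, l)` goes to `x_l / x_{n x j}`. The choice of `n x j` is arbitrary at each
  -- point, so these values do not form sections; only fractions of multidegree zero will be
  -- independent of the choice.
  let c : ∀ x, (Σ j, σ j) → Germ X x := fun x i => ratio (g i.1) i.2 (n x i.1) x (hn x i.1)
  let ψ : ∀ x, F12Poly (Σ j, σ j) →*₀ Germ X x := fun x => F12Poly.lift (sign (g j₀) x) (c x)
  have hψ : ∀ x (z : F12Poly (Σ j, σ j)), z ∉ (prodDatum σ).prime (φ x) → IsUnit (ψ x z) := by
    intro x z hz
    obtain rfl | ⟨u, a, rfl⟩ := F12Poly.eq_zero_or_mon z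
    · exact (hz ((prodDatum σ).zero_mem_prime _)).elim
    rw [F12Poly.lift_mon]
    refine ((Group.isUnit u).map _).mul ?_
    rw [Finsupp.prod, IsUnit.prod_iff]
    intro i hi
    refine IsUnit.pow _ (isUnit_gfrac _ _ _ _ fun h => hz ?_)
    exact mon_mem_prodDatum_prime_iff.2 ⟨i, Finsupp.mem_support_iff.1 hi, h⟩
  let ev : ∀ x, (prodDatum σ).Loc (φ x) →* Germ X x := fun x =>
    (Localization.monoidOf ((prodDatum σ).den (φ x))).lift (g := (ψ x).toMonoidHom)
      fun y => hψ x y.1 y.2.1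
  -- All later evaluations use only this characterization of the value on `a / b`, which avoids
  -- explicit inverses.
  have hev : ∀ x (a : F12Poly (Σ j, σ j)) (b : (prodDatum σ).den (φ x)) (v : Germ X x),
      ev x (Localization.mk a b) = v ↔ ψ x a = ψ x b.1 * v := by
    intro x a b v
    rw [Localization.mk_eq_monoidOf_mk']
    exact Submonoid.LocalizationMap.lift_mk'_spec (Localization.monoidOf ((prodDatum σ).den (φ x))) _ _ _ _
  have hev0 : ∀ x, ev x 0 = 0 := by
    intro x
    rw [← Localization.mk_zero 1]
    refine (hev x 0 1 0).2 ?_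
    rw [map_zero, mul_zero]
  obtain ⟨f, hfφ, hf⟩ := exists_hom_of_locMaps φ hφ ev hev0 (by
    intro d a b ha hb x hx
    change F12Poly (Σ j, σ j) at a b
    obtain rfl | ⟨v, b, rfl⟩ := F12Poly.eq_zero_or_mon b
    · exact (hx ((prodDatum σ).zero_mem_prime _)).elim
    obtain rfl | ⟨u, a, rfl⟩ := F12Poly.eq_zero_or_mon a
    · refine ⟨⊤, 0, trivial, fun y hy hb => ?_⟩
      rw [map_zero]
      refine ((hev y _ _ _).2 ?_).symm
      rw [mul_zero]
      exact map_zero _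
    have hab : a.mapDomain Sigma.fst = b.mapDomain Sigma.fst :=
      (mon_mem_prodDatum_part_iff.1 ha).trans (mon_mem_prodDatum_part_iff.1 hb).symm
    -- near `x` the coordinates `x_{j, n x j}` can be used as denominators
    let c' : ∀ y, (Σ j, σ j) → Germ X y := fun y i =>
      if h : F12Poly.X (n x i.1) ∉ (projSpaceDatum (σ i.1)).prime (ptMap (g i.1) y) then
        ratio (g i.1) i.2 (n x i.1) y h else 1
    -- The transition factors from the denominators fixed at `x` to those chosen at `y`.
    let w : ∀ y, J → Germ X y := fun y j => ratio (g j) (n x j) (n y j) y (hn y j)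
    have hc' : ∀ i, LocallySec x fun y => c' y i := by
      intro i
      refine ⟨pre (g i.1) (basicOpen (D := projSpaceDatum (σ i.1)) (F12Poly.X (n x i.1))
        (F12Poly.X_mem_part _)), pull (g i.1) _ (sfrac (D := projSpaceDatum (σ i.1))
          (i := (1 : ℕ)) (F12Poly.X i.2) (F12Poly.X (n x i.1)) (F12Poly.X_mem_part _)
          (F12Poly.X_mem_part _) _ fun _ hy => hy), hn x i.1, fun y hy => ?_⟩
      have hy' : F12Poly.X (n x i.1) ∉ (projSpaceDatum (σ i.1)).prime (ptMap (g i.1) y) := hy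
      simp only [c', dif_pos hy']
      rfl
    have hψ' : ∀ (u : ℤˣ) (a : (Σ j, σ j) →₀ ℕ),
        LocallySec x fun y => F12Poly.lift (sign (g j₀) y) (c' y) (F12Poly.mon u a) := by
      intro u a
      simp only [F12Poly.lift_mon]
      refine LocallySec.mul ⟨pre (g j₀) (basicOpen (D := projSpaceDatum (σ j₀)) 1
        (projSpaceDatum (σ j₀)).one_mem_part), pull (g j₀) _ (sfrac (D := projSpaceDatum (σ j₀))
          (i := (0 : ℕ)) (F12Poly.mon u 0) 1 (F12Poly.mon_mem_part_iff.2 (map_zero _))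
          (projSpaceDatum (σ j₀)).one_mem_part _ fun _ hy => hy),
        (projSpaceDatum (σ j₀)).one_notMem_prime _, fun y hy => rfl⟩ ?_
      exact LocallySec.prod _ fun i _ => (hc' i).pow _
    -- The pointwise evaluation and the one with denominators fixed at `x` differ by a product of
    -- transition factors that depends only on the multidegree. It is therefore the same for `a` and
    -- `b` and drops out of `a / b`.
    have hcw : ∀ (u : ℤˣ) (a : (Σ j, σ j) →₀ ℕ) (y : X), (∀ i ∈ a.support,
        F12Poly.X (n x i.1) ∉ (projSpaceDatum (σ i.1)).prime (ptMap (g i.1) y)) →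
        ψ y (F12Poly.mon u a) = F12Poly.lift (sign (g j₀) y) (c' y) (F12Poly.mon u a) *
          (a.mapDomain Sigma.fst).prod fun j k => w y j ^ k := by
      intro u a y hy
      rw [F12Poly.lift_mon, F12Poly.lift_mon, mul_assoc, Finsupp.prod_mapDomain_index
        (fun _ => pow_zero _) (fun _ _ _ => pow_add _ _ _), ← Finsupp.prod_mul]
      congr 1
      refine Finsupp.prod_congr fun i hi => ?_
      rw [← mul_pow]
      congr 1
      simp only [c', dif_pos (hy i hi)]
      exact (gfrac_mul_cancel _ _ _ _ _ _).symm
    obtain ⟨U, A, hxU, hA⟩ := hψ' u a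
    obtain ⟨V, B, hxV, hB⟩ := hψ' v b
    -- At `x` the pointwise evaluation of `b` is a unit and has `B` as a factor, so `B` is
    -- invertible near `x`.
    have hBu : IsUnit (germ hxV B) := by
      rw [hB x hxV]
      have h1 := hψ x _ hx
      rw [hcw v b x fun i _ => hn x i.1] at h1
      exact isUnit_of_mul_isUnit_left h1
    obtain ⟨V', hV', hxV', hBu'⟩ := (unitAt_iff_isUnit_germ hxV B).2 hBu
    obtain ⟨B', hB'⟩ := hBu'.exists_right_inv
    let N : Opens X := ⟨⋂ i ∈ a.support ∪ b.support,
      {y | F12Poly.X (n x i.1) ∉ (projSpaceDatum (σ i.1)).prime (ptMap (g i.1) y)},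
      isOpen_biInter_finset fun i _ => ((projSpaceDatum (σ i.1)).isOpen_basic
        (F12Poly.X_mem_part (n x i.1))).preimage (continuous_ptMap (g i.1))⟩
    have hN : ∀ y, y ∈ N ↔ ∀ i ∈ a.support ∪ b.support,
        F12Poly.X (n x i.1) ∉ (projSpaceDatum (σ i.1)).prime (ptMap (g i.1) y) :=
      fun y => Set.mem_iInter₂
    refine ⟨U ⊓ V' ⊓ N, res (inf_le_left.trans inf_le_left) A *
      res (inf_le_left.trans inf_le_right) B', ⟨⟨hxU, hxV'⟩, (hN x).2 fun i _ => hn x i.1⟩,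
      fun y hy hby => ((hev y _ _ _).2 ?_).symm⟩
    have h1 := (hN y).1 hy.2
    have h2 := congrArg (germ hy.1.2) hB'
    rw [map_mul, germ_res, map_one, hB y (hV' hy.1.2)] at h2
    rw [map_mul, germ_res, germ_res, hA y hy.1.1]
    change ψ y (F12Poly.mon u a) = ψ y (F12Poly.mon v b) * _
    rw [hcw u a y fun i hi => h1 i (Finset.mem_union_left _ hi),
      hcw v b y fun i hi => h1 i (Finset.mem_union_right _ hi), hab]
    beta_reduce at h2 ⊢
    generalize F12Poly.lift (sign (g j₀) y) (c' y) (F12Poly.mon u a) = α at *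
    generalize F12Poly.lift (sign (g j₀) y) (c' y) (F12Poly.mon v b) = β at *
    generalize germ hy.1.2 B' = γ at *
    generalize (b.mapDomain Sigma.fst).prod (fun j k => w y j ^ k) = δ at *
    calc α * δ = (β * γ) * (α * δ) := by rw [h2, one_mul]
      _ = β * δ * (α * γ) := by ac_rfl)
  refine ⟨f, fun j => projSpace_hom_ext (fun x => congrFun (congrFun hfφ x) j) ?_ ?_⟩
  · intro x u
    have h0 : F12Poly.mon u 0 ∈ (prodDatum σ).part 0 :=
      mon_mem_prodDatum_part_iff.2 Finsupp.mapDomain_zero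
    rw [sign_prod f j x u h0, hg]
    refine (hf _ _ x ((prodDatum σ).one_notMem_prime _) _).trans ((hev x _ _ _).2 ?_)
    rw [F12Poly.lift_mon_zero]
    exact ((congrArg (· * _) (map_one (ψ x))).trans (one_mul _)).symm
  · intro x l k hf' hg'
    have hx' : F12Poly.X ⟨j, k⟩ ∉ (prodDatum σ).prime (ptMap f x) :=
      X_mem_prodDatum_prime_iff.not.2 hf'
    rw [gfrac_prod f j l k x hf' (X_mem_prodDatum_part _) (X_mem_prodDatum_part _) hx']
    refine (hf _ _ x (X_mem_prodDatum_prime_iff.not.2 hg') _).trans ((hev x _ _ _).2 ?_)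
    rw [F12Poly.lift_X]
    refine Eq.trans ?_ (congrArg (· * _) (F12Poly.lift_X _ _ _).symm)
    rw [mul_comm]
    exact (gfrac_mul_cancel _ _ _ _ _ _).symm

end ProjDatum

/-! ### Compatibility with structure morphisms, and locality. -/

namespace ProjDatum

variable {X : MonoidSpace} {D E : ProjDatum}

theorem toSpaceHom_comp_structureHom (φ : Hom E D) (a : F12 →*₀ D.M) (ha : ∀ z, a z ∈ D.part 0)
    (b : F12 →*₀ E.M) (hb : ∀ z, b z ∈ E.part 0) (h : ∀ z, φ.hom (a z) = b z) :
    φ.toSpaceHom ≫ (structureHom D a ha).toSpaceHom = (structureHom E b hb).toSpaceHom := by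
  refine specF12_hom_ext fun x u => ?_
  have h1 : ∀ (p : E.pt), (b 1) ∉ E.prime p := fun p => by
    rw [map_one]
    exact E.one_notMem_prime p
  have h2 : ∀ (p : D.pt), (a 1) ∉ D.prime p := fun p => by
    rw [map_one]
    exact D.one_notMem_prime p
  have h3 : ∀ (p : E.pt), φ.hom (a 1) ∉ E.prime p := fun p => by
    rw [h]
    exact h1 p
  refine (gfrac_comp φ.toSpaceHom (structureHom D a ha) _ _ _ (h2 _)).trans
    (((gfrac_comp (𝟙 _) φ (ha u) (ha 1) (h2 _) (h3 _)).trans ?_).trans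
    (gfrac_comp (𝟙 _) (structureHom E b hb) (i := ()) (a := (u : F12)) (b := (1 : F12)) trivial
      trivial ((specDatum F12).one_notMem_prime _) (h1 _)).symm)
  refine gfrac_eq (𝟙 _) _ _ _ _ _ _ ?_
  change φ.hom (a u) * b 1 = b u * φ.hom (a 1)
  rw [h, h]

/-- Every section is a fraction near a given point, and `a/b` is a unit there exactly when `a` does
not vanish. -/
theorem isLocal_of_gfrac (f : X ⟶ D.space)
    (h : ∀ (i : D.ι) (a b : D.M) (ha : a ∈ D.part i) (hb : b ∈ D.part i) (x : X)
      (hx : b ∉ D.prime (ptMap f x)), IsUnit (gfrac f a b ha hb x hx) →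
        a ∉ D.prime (ptMap f x)) : IsLocal f := by
  rintro (V : Opens D.pt) (t : D.sections V) x (hx : ptMap f x ∈ V) hu
  obtain ⟨W, hW, i, a, b, ha, hb, hWb, hxW, hs⟩ := exists_sres_eq_sfrac t hx
  have hxW' : x ∈ pre f W := hxW
  have h1 : IsUnit (germ (show x ∈ pre f V from hx) (pull f V t)) :=
    (unitAt_iff_isUnit_germ _ _).1 hu
  rw [← germ_pull_sres f hW t hxW', hs, germ_pull_sfrac] at h1
  have h2 := (sunitAt_sfrac_iff ha hb hWb hxW).2 (h i a b ha hb x _ h1)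
  rw [← hs] at h2
  exact (sunitAt_sres_iff hW t hxW).1 h2

theorem notMem_of_isUnit_gfrac {f : X ⟶ D.space} (hf : IsLocal f) {i : D.ι} {a b : D.M}
    {ha : a ∈ D.part i} {hb : b ∈ D.part i} {x : X} {hx : b ∉ D.prime (ptMap f x)}
    (h : IsUnit (gfrac f a b ha hb x hx)) : a ∉ D.prime (ptMap f x) := by
  rw [← sunitAt_sfrac_iff ha hb (fun _ hy => hy)
    (show ptMap f x ∈ basicOpen b hb from hx)]
  exact hf (basicOpen b hb) (sfrac a b ha hb _ fun _ hy => hy) x hx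
    ((unitAt_iff_isUnit_germ _ _).2 h)

end ProjDatum

open ProjDatum

/-- The morphism of monoid-valued spaces underlying a morphism to projective space. -/
noncomputable def toProjMap {σ : Type} [Finite σ] {T : Over specF12} (g : T ⟶ projSpace σ) :
    T.left.space ⟶ (projSpaceDatum σ).space :=
  WeakScheme.Hom.map g.left

/-- The morphism of monoid-valued spaces underlying the structure morphism. -/
def toSpecMap (T : Over specF12) : T.left.space ⟶ (specDatum F12).space :=
  WeakScheme.Hom.map T.hom

theorem toProjMap_comp_structureHom {σ : Type} [Finite σ] {T : Over specF12}
    (g : T ⟶ projSpace σ) : toProjMap g ≫ (structureHom (projSpaceDatum σ) F12Poly.const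
      F12Poly.const_mem_part).toSpaceHom = toSpecMap T :=
  congrArg WeakScheme.Hom.map (Over.w g)

/-- The right side involves only the structure morphism of `T`. So all morphisms over `𝔽_{1²}` pull
back `±1` in the same way, the compatibility needed to build a morphism to the product. -/
theorem sign_toProjMap {σ : Type} [Finite σ] {T : Over specF12} (g : T ⟶ projSpace σ)
    (x : T.left.space) (u : ℤˣ) : sign (toProjMap g) x u =
      gfrac (D := specDatum F12) (toSpecMap T) (i := ()) (u : F12) (1 : F12) trivial
        trivial x ((specDatum F12).one_notMem_prime _) := by
  simp only [← toProjMap_comp_structureHom g]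
  exact (gfrac_comp (toProjMap g) (structureHom (projSpaceDatum σ) F12Poly.const
    F12Poly.const_mem_part) (i := ()) (a := (u : F12)) (b := (1 : F12)) trivial trivial
    ((specDatum F12).one_notMem_prime _) ((projSpaceDatum σ).one_notMem_prime _)).symm

/-- Suppose `a/b` pulls back to a unit although `a` vanishes at the image of `x`. Some variable of
`a` vanishes there, and its quotient by a nonvanishing variable of the same block divides a unit,
which contradicts locality of that component. -/
theorem isLocal_of_components {J : Type} {σ : J → Type} [Nonempty J] {X : MonoidSpace}
    (f : X ⟶ (prodDatum σ).space)
    (h : ∀ j, IsLocal (f ≫ (prodProj σ j).toSpaceHom)) : IsLocal f := by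
  refine isLocal_of_gfrac f fun d a b ha hb x hx hu hax => ?_
  change F12Poly (Σ j, σ j) at a b
  obtain rfl | ⟨v, b, rfl⟩ := F12Poly.eq_zero_or_mon b
  · exact hx ((prodDatum σ).zero_mem_prime _)
  obtain rfl | ⟨u, a, rfl⟩ := F12Poly.eq_zero_or_mon a
  -- For `a = 0` the zero of the stalk would be a unit, and this already contradicts locality of any
  -- one component.
  · obtain ⟨j⟩ := ‹Nonempty J›
    obtain ⟨n, hn⟩ := F12Poly.exists_X_notMem (ptMap (f ≫ (prodProj σ j).toSpaceHom) x)
    have h0 := (projSpaceDatum (σ j)).zero_mem_part (1 : ℕ)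
    refine notMem_of_isUnit_gfrac (h j) (ha := h0) (hb := F12Poly.X_mem_part n) (hx := hn) ?_
      ((projSpaceDatum (σ j)).zero_mem_prime _)
    have hu0 : IsUnit (0 : Germ X x) := (gfrac_zero f ha hb hx) ▸ hu
    exact (gfrac_zero (f ≫ (prodProj σ j).toSpaceHom) h0 (F12Poly.X_mem_part n) hn).symm ▸ hu0
  obtain ⟨⟨j, l⟩, hl, hp⟩ := mon_mem_prodDatum_prime_iff.1 hax
  choose n hn using fun j => F12Poly.exists_X_notMem (ptMap f x j)
  let κ : (Σ j, σ j) → Σ j, σ j := fun i => ⟨i.1, n i.1⟩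
  have hden : ∀ c : (Σ j, σ j) →₀ ℕ,
      F12Poly.mon 1 (c.mapDomain κ) ∉ (prodDatum σ).prime (ptMap f x) := by
    intro c hc
    classical
    obtain ⟨i, hi, hp⟩ := mon_mem_prodDatum_prime_iff.1 hc
    obtain ⟨k, hk, rfl⟩ := Finset.mem_image.1
      (Finsupp.mapDomain_support (Finsupp.mem_support_iff.2 hi))
    exact hn _ hp
  have hdeg : ∀ c : (Σ j, σ j) →₀ ℕ, F12Poly.mon 1 (c.mapDomain κ) ∈
      (prodDatum σ).part (c.mapDomain Sigma.fst) := by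
    intro c
    rw [mon_mem_prodDatum_part_iff, ← Finsupp.mapDomain_comp]
    rfl
  have hab : a.mapDomain κ = b.mapDomain κ := by
    have h1 : κ = (fun j => ⟨j, n j⟩) ∘ Sigma.fst := rfl
    rw [h1, Finsupp.mapDomain_comp, Finsupp.mapDomain_comp,
      mon_mem_prodDatum_part_iff.1 ha, mon_mem_prodDatum_part_iff.1 hb]
  have hKa : F12Poly.mon 1 (a.mapDomain κ) ∈ (prodDatum σ).part d := by
    have := hdeg a
    rwa [mon_mem_prodDatum_part_iff.1 ha] at this
  have hKb : F12Poly.mon 1 (a.mapDomain κ) ∉ (prodDatum σ).prime (ptMap f x) := hden a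
  have hbu : IsUnit (gfrac f (F12Poly.mon v b) (F12Poly.mon 1 (a.mapDomain κ)) hb hKa x hKb) :=
    isUnit_gfrac f hb hKa hKb hx
  -- The replacement monomial `K` of `a` is also that of `b`, and `a/K = (a/b)(b/K)` is a product of
  -- units.
  have hau : IsUnit (gfrac f (F12Poly.mon u a) (F12Poly.mon 1 (a.mapDomain κ)) ha hKa x hKb) :=
    (gfrac_mul_cancel f ha hb hKa hx hKb) ▸ hu.mul hbu
  -- Splitting off the vanishing variable exhibits its ratio as a factor of the unit `a/K`.
  obtain ⟨a', rfl⟩ : ∃ a', a = Finsupp.single ⟨j, l⟩ 1 + a' :=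
    ⟨a - Finsupp.single ⟨j, l⟩ 1, (add_tsub_cancel_of_le (Finsupp.single_le_iff.2
      (Nat.one_le_iff_ne_zero.2 hl))).symm⟩
  have hx' : F12Poly.X ⟨j, n j⟩ ∉ (prodDatum σ).prime (ptMap f x) :=
    X_mem_prodDatum_prime_iff.not.2 (hn j)
  have ha' : F12Poly.mon u a' ∈ (prodDatum σ).part (a'.mapDomain Sigma.fst) :=
    mon_mem_prodDatum_part_iff.2 rfl
  have h1 := gfrac_mul f (X_mem_prodDatum_part (⟨j, l⟩ : Σ j, σ j))
    (X_mem_prodDatum_part (⟨j, n j⟩ : Σ j, σ j)) ha' (hdeg a') hx' (hden a')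
  have h2 : gfrac f (F12Poly.mon u (Finsupp.single (⟨j, l⟩ : Σ j, σ j) 1 + a'))
      (F12Poly.mon 1 ((Finsupp.single (⟨j, l⟩ : Σ j, σ j) 1 + a').mapDomain κ)) ha hKa x hKb =
      gfrac f (F12Poly.X (⟨j, l⟩ : Σ j, σ j) * F12Poly.mon u a')
        (F12Poly.X (⟨j, n j⟩ : Σ j, σ j) * F12Poly.mon 1 (a'.mapDomain κ))
        ((prodDatum σ).mul_mem_part (X_mem_prodDatum_part (⟨j, l⟩ : Σ j, σ j)) ha')
        ((prodDatum σ).mul_mem_part (X_mem_prodDatum_part (⟨j, n j⟩ : Σ j, σ j)) (hdeg a')) x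
        (mul_notMem hx' (hden a')) := by
    refine gfrac_eq f _ _ ((prodDatum σ).mul_mem_part (X_mem_prodDatum_part (⟨j, l⟩ : Σ j, σ j)) ha')
      ((prodDatum σ).mul_mem_part (X_mem_prodDatum_part (⟨j, n j⟩ : Σ j, σ j)) (hdeg a')) _ _ ?_
    have h3 : F12Poly.X (⟨j, l⟩ : Σ j, σ j) * F12Poly.mon u a' =
        F12Poly.mon u (Finsupp.single (⟨j, l⟩ : Σ j, σ j) 1 + a') := by
      rw [F12Poly.X_eq_mon, F12Poly.mon_mul, one_mul]
    have h4 : F12Poly.X (⟨j, n j⟩ : Σ j, σ j) * F12Poly.mon 1 (a'.mapDomain κ) =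
        F12Poly.mon 1 ((Finsupp.single (⟨j, l⟩ : Σ j, σ j) 1 + a').mapDomain κ) := by
      rw [F12Poly.X_eq_mon, F12Poly.mon_mul, one_mul, Finsupp.mapDomain_add,
        Finsupp.mapDomain_single]
    exact congrArg₂ (· * ·) h3.symm h4
  have h5 := isUnit_of_mul_isUnit_left ((congrArg IsUnit (h2.trans h1.symm)).mp hau)
  exact notMem_of_isUnit_gfrac (h j)
    ((congrArg IsUnit (gfrac_prod f j l (n j) x (hn j) (X_mem_prodDatum_part ⟨j, l⟩)
      (X_mem_prodDatum_part ⟨j, n j⟩) hx').symm).mp h5) hp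

/-! ### The categorical product over `𝔽_{1²}`. -/

section ProductScheme

variable {J : Type} (σ : J → Type) [∀ j, Finite (σ j)]

/-- The product of the projective spaces as a weak scheme over `𝔽_{1²}`. -/
noncomputable def prodOver : Over specF12 :=
  Over.mk (Y := prodScheme σ)
    (show prodScheme σ ⟶ specF12 from
      { map := (structureHom (prodDatum σ) F12Poly.const const_mem_prodDatum_part).toSpaceHom
        isSpectralMap :=
          { toContinuous := (structureHom (prodDatum σ) F12Poly.const
              const_mem_prodDatum_part).continuous_base
            isCompact_preimage_of_isOpen := fun V _ _ => by
              -- The target is a point, so preimages are empty or everything.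
              rcases Set.eq_empty_or_nonempty V with rfl | ⟨y, hy⟩
              · exact isCompact_empty
              · convert! isCompact_univ (X := (prodDatum σ).pt)
                refine Set.eq_univ_of_forall fun x => ?_
                have h := Subsingleton.elim (α := MonoidPrime F12) y (ProjDatum.Hom.base
                  (structureHom (prodDatum σ) F12Poly.const const_mem_prodDatum_part) x)
                exact (congrArg (· ∈ V) h).mp hy }
        isLocal := (structureHom (prodDatum σ) F12Poly.const
          const_mem_prodDatum_part).isLocal_toSpaceHom })

/-- The projections. -/
noncomputable def prodOverProj (j : J) : prodOver σ ⟶ projSpace (σ j) :=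
  Over.homMk
    (show prodScheme σ ⟶ (projSpaceDatum (σ j)).toWeakScheme from
      { map := (prodProj σ j).toSpaceHom
        isSpectralMap :=
          { toContinuous := (prodProj σ j).continuous_base
            isCompact_preimage_of_isOpen := fun V _ _ => by
              classical
              -- The transport along `k = j` writes the cylinder over `V` as a box, with full sides
              -- for `k ≠ j`.
              have h : (fun p : (prodDatum σ).pt => p j) ⁻¹' V = Set.univ.pi
                  fun k => {q : (projSpaceDatum (σ k)).pt | ∀ h : k = j, h ▸ q ∈ V} := by
                ext p
                constructor
                · rintro hp k - rfl
                  exact hp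
                · exact fun hp => hp j trivial rfl
              change IsCompact ((fun p : (prodDatum σ).pt => p j) ⁻¹' V)
              rw [h]
              exact isCompact_univ_pi_of_finite _ }
        isLocal := (prodProj σ j).isLocal_toSpaceHom })
    (WeakScheme.Hom.ext (toSpaceHom_comp_structureHom (prodProj σ j) _ _ _ _ fun z => by
      induction z using WithZero.recZeroCoe with
      | zero => rfl
      | coe u => exact congrArg (F12Poly.mon u) (Finsupp.mapDomain_zero (f := Sigma.mk j))))

variable {σ}

/-- A compact open subset of the product is a finite union of cylinders. The preimage of a cylinder
is a finite intersection of compact open sets, hence compact since `T` is spectral. -/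
theorem isSpectralMap_of_components {T : Type*} [TopologicalSpace T] [SpectralSpace T]
    (φ : T → (prodDatum σ).pt)
    (h : ∀ j, IsSpectralMap fun t => φ t j) : IsSpectralMap φ where
  toContinuous := continuous_pi fun j => (h j).toContinuous
  isCompact_preimage_of_isOpen := by
    have hb := isTopologicalBasis_pi fun j : J =>
      isTopologicalBasis_opens (α := (projSpaceDatum (σ j)).pt)
    intro V hV hVc
    choose! B hB hxB hBV using fun x (hx : x ∈ V) => hb.exists_subset_of_mem_open hx hV
    obtain ⟨t, htV, ht⟩ := hVc.elim_nhds_subcover B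
      fun x hx => (hb.isOpen (hB x hx)).mem_nhds (hxB x hx)
    have hV' : V = ⋃ x ∈ t, B x := Set.Subset.antisymm ht (Set.iUnion₂_subset fun x hx =>
      hBV x (htV x hx))
    have hpre : φ ⁻¹' V = ⋃ x ∈ t, φ ⁻¹' B x := by
      rw [hV']
      exact Set.preimage_iUnion₂
    rw [hpre]
    refine t.finite_toSet.isCompact_biUnion fun x hx => ?_
    obtain ⟨U, F, hU, hBx⟩ := hB x (htV x hx)
    rw [hBx]
    have key : ∀ G : Finset J, G ⊆ F → IsOpen (φ ⁻¹' (G : Set J).pi U) ∧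
        IsCompact (φ ⁻¹' (G : Set J).pi U) := by
      classical
      intro G
      induction G using Finset.induction_on with
      | empty =>
        intro _
        rw [Finset.coe_empty, Set.empty_pi]
        exact ⟨isOpen_univ, isCompact_univ⟩
      | insert j G hj ih =>
        intro hG
        obtain ⟨h1, h2⟩ := ih fun i hi => hG (Finset.mem_insert_of_mem hi)
        have hUj : IsOpen (U j) := hU j (hG (Finset.mem_insert_self j G))
        have h3 : IsOpen ((fun t => φ t j) ⁻¹' U j) := hUj.preimage (h j).toContinuous
        have h4 : IsCompact ((fun t => φ t j) ⁻¹' U j) :=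
          (h j).isCompact_preimage_of_isOpen hUj (U j).toFinite.isCompact
        have h5 : φ ⁻¹' ((insert j G : Finset J) : Set J).pi U =
            (fun t => φ t j) ⁻¹' U j ∩ φ ⁻¹' (G : Set J).pi U := by
          rw [Finset.coe_insert, Set.insert_pi]
          rfl
        rw [h5]
        exact ⟨h3.inter h1, h4.inter_of_isOpen h2 h3 h1⟩
    exact (key F le_rfl).2

theorem exists_prodOver_lift [Nonempty J] {T : Over specF12} (g : ∀ j, T ⟶ projSpace (σ j)) :
    ∃ f : T ⟶ prodOver σ, ∀ j, f ≫ prodOverProj σ j = g j := by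
  have := T.left.spectral
  obtain ⟨j₀⟩ := ‹Nonempty J›
  obtain ⟨f, hf⟩ := exists_prodDatum_lift (fun j => toProjMap (g j)) j₀ fun j x u => by
    rw [sign_toProjMap, sign_toProjMap]
  have hφ : ∀ j, (fun t => ptMap f t j) = ptMap (toProjMap (g j)) := fun j => by
    rw [← hf j]
    rfl
  let F : T.left ⟶ prodScheme σ :=
    { map := f
      isSpectralMap := isSpectralMap_of_components (ptMap f) fun j => by
        rw [hφ]
        exact (WeakScheme.Hom.isSpectralMap (g j).left)
      isLocal := isLocal_of_components f fun j => by
        rw [hf]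
        exact WeakScheme.Hom.isLocal (g j).left }
  have hF : ∀ j, F ≫ (prodOverProj σ j).left = (g j).left := fun j => WeakScheme.Hom.ext (hf j)
  refine ⟨Over.homMk F ?_, fun j => Over.OverMorphism.ext (hF j)⟩
  -- The structure morphism of the product factors through the projection to `j₀`, so compatibility
  -- follows from that of `g j₀`.
  refine (congrArg (F ≫ ·) (Over.w (prodOverProj σ j₀))).symm.trans ?_
  refine (Category.assoc F (prodOverProj σ j₀).left (projSpace (σ j₀)).hom).symm.trans ?_
  exact (congrArg (· ≫ (projSpace (σ j₀)).hom) (hF j₀)).trans (Over.w (g j₀))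

theorem prodOver_hom_ext [Nonempty J] {T : Over specF12} {f g : T ⟶ prodOver σ}
    (h : ∀ j, f ≫ prodOverProj σ j = g ≫ prodOverProj σ j) : f = g := by
  refine Over.OverMorphism.ext (WeakScheme.Hom.ext ?_)
  refine prodDatum_hom_ext (σ := σ) fun j => ?_
  exact congrArg (fun k => WeakScheme.Hom.map (CommaMorphism.left k)) (h j)

variable (σ) in
theorem hasProduct_projSpace [Nonempty J] : HasProduct fun j => projSpace (σ j) := by
  choose l hl using fun (T : Over specF12) (g : ∀ j, T ⟶ projSpace (σ j)) =>
    exists_prodOver_lift g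
  refine ⟨⟨Fan.mk (prodOver σ) (prodOverProj σ), Fan.IsLimit.mk _ (fun s => l s.pt s.proj)
    (fun s j => hl s.pt s.proj j) fun s m hm => prodOver_hom_ext fun j => ?_⟩⟩
  exact (hm j).trans (hl s.pt s.proj j).symm

end ProductScheme

/-! ### Generators of the twisting sheaves. -/

namespace ProjDatum

variable {D : ProjDatum}

theorem isUnit_mk {x : D.pt} {i j : D.ι} {a b : D.M} (ha : a ∈ D.part i) (hax : a ∉ D.prime x)
    (hb : b ∈ D.part j) (hbx : b ∉ D.prime x) :
    IsUnit (Localization.mk a (⟨b, hbx, j, hb⟩ : D.den x)) := by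
  refine IsUnit.of_mul_eq_one (Localization.mk b (⟨a, hax, i, ha⟩ : D.den x)) ?_
  rw [Localization.mk_mul,
    ← Localization.mk_self ((⟨b, hbx, j, hb⟩ : D.den x) * ⟨a, hax, i, ha⟩)]
  congr 1
  exact mul_comm _ _

theorem mk_mul_mk_one {x : D.pt} {a b c e : D.M} (hb : b ∈ D.den x) (h1 : 1 ∈ D.den x)
    (h : a * c = b * e) :
    Localization.mk a (⟨b, hb⟩ : D.den x) * Localization.mk c ⟨1, h1⟩ =
      Localization.mk e ⟨1, h1⟩ := by
  rw [Localization.mk_mul, Localization.mk_eq_mk_iff, Localization.r_iff_exists]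
  refine ⟨1, congrArg _ ?_⟩
  change 1 * (a * c) = b * 1 * e
  rw [one_mul, mul_one, h]

/-- The inverse of multiplication by `a/b` is multiplication by `b/a`, which brings degree `e` back
to `0`. The grading monoid need not be commutative, so `hie` is required to rearrange degrees. -/
theorem isGenerator_frac {i e : D.ι} (hie : i + e = e + i) {a b : D.M} (ha : a ∈ D.part (i + e))
    (hb : b ∈ D.part i) {U : Opens D.pt} (hU : ∀ x ∈ U, b ∉ D.prime x)
    (hU' : ∀ x ∈ U, a ∉ D.prime x) : IsGenerator (frac a b ha hb U hU) := by
  intro V h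
  constructor
  · intro r r' hr
    refine Subtype.ext (funext fun x => ?_)
    exact (isUnit_mk ha (hU' x.1 (h x.2)) hb (hU x.1 (h x.2))).mul_left_injective
      (congrFun (congrArg Subtype.val hr) x)
  · intro t
    refine ⟨⟨fun x => t.1 x * Localization.mk b (⟨a, hU' x.1 (h x.2), _, ha⟩ : D.den x.1), fun x => ?_⟩, ?_⟩
    · obtain ⟨W, hxW, iW, j, c, hc, k, hk, hck⟩ := t.2 x
      refine ⟨W, hxW, iW, j + (i + e), c * b, ?_, k * a, D.mul_mem_part hk ha, fun y => ?_⟩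
      · rw [add_zero, hie, ← add_assoc]
        exact D.mul_mem_part hc hb
      · obtain ⟨h1, h1'⟩ := hck y
        have h2 : a ∈ D.den y.1 := ⟨hU' y.1 (h (iW.le y.2)), _, ha⟩
        refine ⟨(D.den y.1).mul_mem h1 h2, ?_⟩
        exact (congrArg (· * Localization.mk b ⟨a, h2⟩) h1').trans (Localization.mk_mul _ _ _ _)
    · refine Subtype.ext (funext fun x => ?_)
      change t.1 x * Localization.mk b (⟨a, hU' x.1 (h x.2), _, ha⟩ : D.den x.1) *
        Localization.mk a (⟨b, hU x.1 (h x.2), _, hb⟩ : D.den x.1) = t.1 x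
      rw [mul_assoc, Localization.mk_mul, mul_comm b a]
      refine (congrArg (t.1 x * ·) ?_).trans (mul_one _)
      exact Localization.mk_self ((⟨a, hU' x.1 (h x.2), _, ha⟩ : D.den x.1) *
        ⟨b, hU x.1 (h x.2), _, hb⟩)

/-- A generator must divide the section `c/1` of `𝒪(e)`. Since `c/1` is invertible at `x`, so is
`a/b`. Without a nonvanishing `c` of degree `e` the forward direction has nothing to test against.
-/
theorem generatesAt_frac_iff {i e : D.ι} (hie : i + e = e + i) {a b c : D.M}
    (ha : a ∈ D.part (i + e)) (hb : b ∈ D.part i) {U : Opens D.pt} (hU : ∀ x ∈ U, b ∉ D.prime x)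
    {x : D.pt} (hx : x ∈ U) (hc : c ∈ D.part e) (hcx : c ∉ D.prime x) :
    GeneratesAt (frac a b ha hb U hU) x ↔ a ∉ D.prime x := by
  constructor
  · rintro ⟨V, hV, hxV, hg⟩
    let W : Opens D.pt := V ⊓ basicOpen c hc
    obtain ⟨r, hr⟩ := (hg W inf_le_left).2
      (frac (i := 0) c 1 (by rwa [zero_add]) D.one_mem_part W fun y _ => D.one_notMem_prime y)
    have h : r.1 ⟨x, hxV, hcx⟩ * Localization.mk a (⟨b, hU x hx, i, hb⟩ : D.den x) =
        Localization.mk c (⟨1, D.one_notMem_prime x, 0, D.one_mem_part⟩ : D.den x) :=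
      congrFun (congrArg Subtype.val hr) ⟨x, hxV, hcx⟩
    obtain ⟨z, hz⟩ := (isUnit_mk hc hcx D.one_mem_part (D.one_notMem_prime x)).exists_right_inv
    refine notMem_of_mk_mul_eq_one (b := ⟨b, hU x hx, i, hb⟩) (z := r.1 ⟨x, hxV, hcx⟩ * z) ?_
    rw [← hz, ← h]
    ac_rfl
  · intro hax
    exact ⟨U ⊓ basicOpen a ha, inf_le_left, ⟨hx, hax⟩,
      isGenerator_frac hie ha hb (fun y (hy : y ∈ U ⊓ basicOpen a ha) => hU y hy.1)
        fun y (hy : y ∈ U ⊓ basicOpen a ha) => hy.2⟩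

end ProjDatum

/-! ### The linear systems `l γᵈ` and their morphisms. -/

theorem R0.mono_mem_part {n : ℕ} {m : ℤ} (h : |m| ≤ 2 ^ n) : R0.mono n m h ∈ R0.part n := ⟨m, rfl⟩

/-- The linear system has no base points. If `γ ∉ p` then `γᵈ ∉ p`; if `γ ∈ p` then `(2γ)ᵈ ∉ p`,
because `p` does not contain all of the positive part. -/
theorem ProjR0.exists_mono_succ_notMem (p : ProjR0) (d : ℕ) :
    ∃ l : Fin (2 ^ d), R0.mono d (l + 1) (succ_abs_le l) ∉ p.carrier := by
  by_cases hp : R0.mono 1 1 (one_abs_le 1) ∈ p.carrier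
  -- Sections are numbered from `0`, so the coefficient `2ᵈ` has index `2ᵈ - 1`.
  · refine ⟨⟨2 ^ d - 1, Nat.sub_lt (by positivity) one_pos⟩, ?_⟩
    rw [mono_congr rfl _ _ (two_pow_abs_le d)]
    · exact two_pow_notMem hp d
    · rw [Nat.cast_sub Nat.one_le_two_pow]
      simp
  · refine ⟨⟨0, by positivity⟩, ?_⟩
    rw [mono_congr rfl _ _ (one_abs_le d)]
    · exact one_mono_notMem hp d
    · simp

theorem generatesAt_linearSystem_iff {d : ℕ} (n : Fin (2 ^ d)) (x : projR0Datum.pt) :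
    GeneratesAt (linearSystem d n) x ↔
      R0.mono d (n + 1) (succ_abs_le n) ∉ projR0Datum.prime x := by
  obtain ⟨l, hl⟩ := ProjR0.exists_mono_succ_notMem x d
  exact generatesAt_frac_iff (D := projR0Datum) (i := (0 : ℕ)) (e := (d : ℕ)) (add_comm (0 : ℕ) d) _ _ _
    (Opens.mem_top x) (R0.mono_mem_part (succ_abs_le l)) hl

theorem isLineBundle_projR0Datum (d : ℕ) : projR0Datum.IsLineBundle (show ℕ from d) := by
  intro x
  obtain ⟨l, hl⟩ := ProjR0.exists_mono_succ_notMem x d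
  obtain ⟨U, h, hx, hs⟩ := (generatesAt_linearSystem_iff l x).2 hl
  exact ⟨U, _, hx, hs⟩

/-- The homomorphism `𝔽_{1²}[x_1, …, x_{2ᵈ}] → R₀` sending `x_l` to `l γᵈ`. -/
noncomputable def linearHom (d : ℕ) : F12Poly (Fin (2 ^ d)) →*₀ R0 :=
  F12Poly.lift ((R0.ofF12 : F12 →* R0).comp WithZero.coeMonoidHom)
    fun l => R0.mono d (l + 1) (succ_abs_le l)

theorem linearHom_X {d : ℕ} (l : Fin (2 ^ d)) :
    linearHom d (F12Poly.X l) = R0.mono d (l + 1) (succ_abs_le l) := F12Poly.lift_X _ _ l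

theorem linearHom_const {d : ℕ} (z : F12) : linearHom d (F12Poly.const z) = R0.ofF12 z := by
  induction z using WithZero.recZeroCoe with
  | zero => rw [map_zero, map_zero, map_zero]
  | coe u => exact F12Poly.lift_mon_zero _ _ u

theorem linearHom_mem_part {d n : ℕ} {a : F12Poly (Fin (2 ^ d))} (ha : a ∈ F12Poly.part n) :
    linearHom d a ∈ R0.part (d * n) := by
  obtain rfl | ⟨u, a, rfl⟩ := F12Poly.eq_zero_or_mon a
  · rw [map_zero]
    exact R0.zero_mem_part _
  rw [← F12Poly.mon_mem_part_iff.1 ha]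
  have h : linearHom d (F12Poly.mon 1 a) ∈ R0.part (d * Finsupp.degree a) := by
    clear ha
    induction a using F12Poly.exponent_induction with
    | zero =>
      rw [F12Poly.mon_one_zero, map_one, map_zero, mul_zero]
      exact ⟨1, rfl⟩
    | single i =>
      rw [← F12Poly.X_eq_mon, linearHom_X, Finsupp.degree_single, mul_one]
      exact R0.mono_mem_part _
    | add a b ha hb =>
      have := R0.mul_mem_part ha hb
      rwa [← map_mul, F12Poly.mon_mul, mul_one, ← mul_add, ← map_add] at this
  have h0 : linearHom d (F12Poly.mon u 0) ∈ R0.part 0 := by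
    rw [← F12Poly.const_coe, linearHom_const]
    exact R0.ofF12_mem_part _
  have := R0.mul_mem_part h0 h
  rwa [← map_mul, F12Poly.mon_mul, mul_one, zero_add, zero_add] at this

/-- Every element of the polynomial monoid is homogeneous. This gives continuity of the map of
points, since only homogeneous elements of `R0` define basic open sets. -/
theorem exists_linearHom_mem_part {d : ℕ} (a : F12Poly (Fin (2 ^ d))) :
    ∃ n, linearHom d a ∈ R0.part n := by
  obtain rfl | ⟨u, a, rfl⟩ := F12Poly.eq_zero_or_mon a
  · exact ⟨0, by rw [map_zero]; exact R0.zero_mem_part 0⟩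
  · exact ⟨_, linearHom_mem_part (F12Poly.mon_mem_part_iff.2 rfl)⟩

/-- The map of graded monoids defined by the linear system `l γᵈ`. -/
noncomputable def linearMap (d : ℕ) : ProjDatum.Hom projR0Datum (projSpaceDatum (Fin (2 ^ d))) where
  hom := linearHom d
  deg := fun n : ℕ => (d * n : ℕ)
  map_part ha := linearHom_mem_part ha
  base p :=
    ⟨{ carrier := {a | linearHom d a ∈ ProjR0.carrier p}
       zero_mem := by
         change linearHom d 0 ∈ ProjR0.carrier p
         rw [map_zero]
         exact ProjR0.zero_mem p
       mul_mem := fun {a} b h => by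
         change linearHom d (a * b) ∈ ProjR0.carrier p
         rw [map_mul]
         exact ProjR0.mul_mem p _ h
       one_notMem := fun h => ProjR0.one_notMem p (map_one (linearHom d) ▸ h)
       mem_or_mem := fun {a b} h => ProjR0.mem_or_mem p (map_mul (linearHom d) a b ▸ h) }, by
      obtain ⟨l, hl⟩ := ProjR0.exists_mono_succ_notMem p d
      exact ⟨l, fun h => hl (linearHom_X l ▸ h)⟩⟩
  continuous_base := by
    refine Continuous.subtype_mk (continuous_generateFrom_iff.2 ?_) _
    rintro _ ⟨a, rfl⟩
    obtain ⟨n, hn⟩ := exists_linearHom_mem_part a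
    exact ProjR0.isOpen_basic hn
  mem_prime_base _ _ _ _ := Iff.rfl

/-- The morphism `Proj R₀ → ℙ^{2ᵈ-1}` defined by the linear system `l γᵈ`. -/
noncomputable def linearMor (d : ℕ) : projR0 ⟶ projSpace (Fin (2 ^ d)) :=
  Over.homMk (linearMap d).toWeakSchemeHom
    (WeakScheme.Hom.ext (toSpaceHom_comp_structureHom (linearMap d) _ _ _ _ linearHom_const))

theorem isAssociated_linearMor (d : ℕ) : IsAssociated d (linearMor d) where
  mem_preim_iff n x := by
    rw [generatesAt_linearSystem_iff, ← linearHom_X]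
    rfl
  comap_coord l n := by
    refine Subtype.ext (funext fun x => ?_)
    have hx : F12Poly.X n ∈ (projSpaceDatum (Fin (2 ^ d))).den ((linearMap d).base x.1) :=
      ⟨x.2, (1 : ℕ), F12Poly.X_mem_part n⟩
    have h1 : (1 : R0) ∈ projR0Datum.den x.1 := (projR0Datum.den x.1).one_mem
    change (linearMap d).locMap x.1 (Localization.mk (F12Poly.X l) ⟨F12Poly.X n, hx⟩) *
      (Localization.mk (R0.mono d (n + 1) (succ_abs_le n)) ⟨1, h1⟩ : projR0Datum.Loc x.1) =
      Localization.mk (R0.mono d (l + 1) (succ_abs_le l)) ⟨1, h1⟩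
    refine (congrArg (· * (Localization.mk (R0.mono d (n + 1) (succ_abs_le n)) ⟨1, h1⟩ :
      projR0Datum.Loc x.1)) ((linearMap d).locMap_mk x.1 _ _)).trans (mk_mul_mk_one _ h1 ?_)
    change linearHom d (F12Poly.X l) * R0.mono d (n + 1) (succ_abs_le n) =
      linearHom d (F12Poly.X n) * R0.mono d (l + 1) (succ_abs_le l)
    rw [linearHom_X, linearHom_X, mul_comm]

theorem IsAssociated.X_mem_prime_iff {d : ℕ} {f : projR0 ⟶ projSpace (Fin (2 ^ d))}
    (hf : IsAssociated d f) (n : Fin (2 ^ d)) (x : projR0Datum.pt) :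
    F12Poly.X n ∈ (projSpaceDatum (Fin (2 ^ d))).prime (ptMap (toProjMap f) x) ↔
      R0.mono d (n + 1) (succ_abs_le n) ∈ projR0Datum.prime x :=
  not_iff_not.1 ((hf.mem_preim_iff n x).trans (generatesAt_linearSystem_iff n x))

/-- A morphism to projective space is determined by points, signs and coordinate ratios. The
generating loci fix the first, the structure morphism the second, and the relation `f^*(x_l/x_n) s_n
= s_l` the third. -/
theorem IsAssociated.unique {d : ℕ} {f g : projR0 ⟶ projSpace (Fin (2 ^ d))}
    (hf : IsAssociated d f) (hg : IsAssociated d g) : f = g := by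
  refine Over.OverMorphism.ext (WeakScheme.Hom.ext ?_)
  change toProjMap f = toProjMap g
  refine projSpace_hom_ext (fun x => F12Poly.pt_ext fun n =>
    (hf.X_mem_prime_iff n x).trans (hg.X_mem_prime_iff n x).symm) (fun x u => ?_) ?_
  · rw [sign_toProjMap, sign_toProjMap]
  · intro x l n hxf hxg
    let U : Opens projR0Datum.pt := pre (toProjMap f) (coordOpen n)
    let V : Opens projR0Datum.pt := pre (toProjMap g) (coordOpen n)
    let r : projR0Datum.sections U := pull (toProjMap f) (coordOpen n) (coord l n)
    let s : projR0Datum.sections V := pull (toProjMap g) (coordOpen n) (coord l n)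
    have hr := hf.comap_coord l n
    have hs := hg.comap_coord l n
    have hxU : x ∈ U := hxf
    have hxV : x ∈ V := hxg
    refine (germ_eq_iff (X := projR0Datum.space) hxU hxV (s := r) (t := s)).2
      ⟨U ⊓ V, inf_le_left, inf_le_right, ⟨hxU, hxV⟩, ?_⟩
    refine Subtype.ext (funext fun y => ?_)
    change r.1 ⟨y.1, y.2.1⟩ = s.1 ⟨y.1, y.2.2⟩
    have hy := (hf.X_mem_prime_iff n y.1).not.1 y.2.1
    have h1 : (1 : R0) ∈ projR0Datum.part (0 : ℕ) := projR0Datum.one_mem_part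
    -- On the preimage of `D₊(x_n)` the section `s_n` is invertible in the local monoid, so it can
    -- be cancelled.
    refine (isUnit_mk (D := projR0Datum) (R0.mono_mem_part (succ_abs_le n)) hy h1
      (projR0Datum.one_notMem_prime y.1)).mul_left_injective ?_
    exact (congrFun (congrArg Subtype.val hr) ⟨y.1, y.2.1⟩).trans
      (congrFun (congrArg Subtype.val hs) ⟨y.1, y.2.2⟩).symm

/-- The coefficient bound `|m| ≤ 2ⁿ` on `R0` is exactly the range of the linear system: `m γⁿ` is
`0` or plus or minus one of the sections. -/
theorem exists_linearHom_eq {n : ℕ} {a : R0} (ha : a ∈ R0.part n) :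
    ∃ A ∈ F12Poly.part (σ := Fin (2 ^ n)) 1, linearHom n A = a := by
  obtain ⟨m, h, rfl⟩ := R0.exists_mono ha
  rcases eq_or_ne m 0 with rfl | hm
  · exact ⟨0, F12Poly.zero_mem_part 1, (map_zero _).trans
      (Subtype.ext (map_zero (Polynomial.monomial n)).symm)⟩
  have hpos : m.natAbs ≠ 0 := Int.natAbs_ne_zero.2 hm
  have hle : m.natAbs ≤ 2 ^ n := by
    rw [← Int.natCast_natAbs] at h
    exact_mod_cast h
  -- The shift by one matches the numbering of the sections from `0`.
  let l : Fin (2 ^ n) := ⟨m.natAbs - 1, by omega⟩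
  have hl : ((l : ℕ) + 1 : ℤ) = m.natAbs := by
    change ((m.natAbs - 1 : ℕ) + 1 : ℤ) = m.natAbs
    omega
  have key : ∀ (u : ℤˣ), (u : ℤ) * m.natAbs = m →
      linearHom n (F12Poly.const (u : F12) * F12Poly.X l) = R0.mono n m h := by
    intro u hu
    rw [map_mul, linearHom_const, linearHom_X]
    refine Subtype.ext ?_
    change Polynomial.monomial 0 (u : ℤ) * Polynomial.monomial n ((l : ℕ) + 1 : ℤ) =
      Polynomial.monomial n m
    rw [Polynomial.monomial_mul_monomial, zero_add, hl, hu]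
  have hmem : ∀ u : ℤˣ, F12Poly.const (u : F12) * F12Poly.X l ∈
      F12Poly.part (σ := Fin (2 ^ n)) 1 := fun u =>
    F12Poly.mul_mem_part (i := 0) (F12Poly.const_mem_part _) (F12Poly.X_mem_part l)
  rcases Int.natAbs_eq m with h1 | h1
  · exact ⟨_, hmem 1, key 1 (by rw [Units.val_one, one_mul, ← h1])⟩
  · exact ⟨_, hmem (-1), key (-1) (by rw [Units.val_neg, Units.val_one, neg_one_mul, ← h1])⟩

/-! ### The immersion criterion. -/

section Immersion

variable {P : MonoidSpace} {F : projR0Datum.space ⟶ P}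

/-- `D₊(a)` is the union of `D₊(a · γ)` and `D₊(a · 2γ)`, and each of these is pulled back from a
basic open set of the projective space with `d = n + 1`. So the topology is induced, and the T0
property gives injectivity. -/
theorem isEmbedding_of_comp_eq_linearMap (h : ∀ d : ℕ+, ∃ G : P ⟶
    (projSpaceDatum (Fin (2 ^ (d : ℕ)))).space, F ≫ G = (linearMap d).toSpaceHom) :
    Topology.IsEmbedding F.hom.base := by
  have hind : Topology.IsInducing F.hom.base := by
    constructor
    refine le_antisymm F.hom.base.hom.continuous.le_induced ?_
    refine le_generateFrom ?_
    rintro _ ⟨n, a, ha, rfl⟩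
    -- The factor of degree 1 makes the degree positive, as only `d ≥ 1` is available and `a` may
    -- have degree `0`.
    have key : ∀ l : Fin (2 ^ 1), ∃ V : Set P, IsOpen V ∧
        F.hom.base ⁻¹' V = {p : ProjR0 | a * R0.mono 1 (l + 1) (succ_abs_le l) ∉ p.carrier} := by
      intro l
      have hal := R0.mul_mem_part ha (R0.mono_mem_part (succ_abs_le l))
      obtain ⟨A, hA, hA'⟩ := exists_linearHom_eq hal
      obtain ⟨G, hG⟩ := h ⟨n + 1, n.succ_pos⟩
      refine ⟨pre G (basicOpen (D := projSpaceDatum (Fin (2 ^ (n + 1)))) A hA), Opens.isOpen _, ?_⟩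
      ext p
      have hp : ptMap (F ≫ G) p = (linearMap (n + 1)).base p := congrArg (ptMap · p) hG
      refine (iff_of_eq (congrArg (fun q => A ∉ (projSpaceDatum (Fin (2 ^ (n + 1)))).prime q)
        hp)).trans ?_
      change linearHom (n + 1) A ∉ ProjR0.carrier p ↔ _
      rw [hA']
      rfl
    choose V hV hV' using key
    have hU : {p : ProjR0 | a ∉ p.carrier} =
        ⋃ l : Fin (2 ^ 1), {p : ProjR0 | a * R0.mono 1 (l + 1) (succ_abs_le l) ∉ p.carrier} := by
      ext p
      obtain ⟨l, hl⟩ := ProjR0.exists_mono_succ_notMem p 1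
      simp only [Set.mem_iUnion, Set.mem_ofPred_eq, ProjR0.mul_mem_iff, not_or]
      exact ⟨fun h => ⟨l, h, hl⟩, fun ⟨_, h, _⟩ => h⟩
    exact isOpen_induced_iff.2 ⟨⋃ l, V l, isOpen_iUnion hV,
      Set.preimage_iUnion.trans ((Set.iUnion_congr hV').trans hU.symm)⟩
  have : T0Space projR0Datum.space := inferInstanceAs (T0Space ProjR0)
  exact hind.isEmbedding

/-- A germ is a fraction `a/b` of degree `i`. With `c ∈ {γ, 2γ}` nonvanishing at `x`, the elements
`ac` and `bc` of degree `i + 1` lift to forms `A` and `B` of degree 1 on one factor, and `A/B` pulls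
back to `a/b`. -/
theorem isStalkSurjective_of_comp_eq_linearMap (h : ∀ d : ℕ+, ∃ G : P ⟶
    (projSpaceDatum (Fin (2 ^ (d : ℕ)))).space, F ≫ G = (linearMap d).toSpaceHom) :
    IsStalkSurjective F := by
  intro x (U : Opens projR0Datum.pt) (s : projR0Datum.sections U) (hx : x ∈ U)
  obtain ⟨W, hW, i, a, b, ha, hb, hWb, hxW, hs⟩ := exists_sres_eq_sfrac s hx
  change ℕ at i
  change R0 at a b
  obtain ⟨l, hl⟩ := ProjR0.exists_mono_succ_notMem x 1
  have hc := R0.mono_mem_part (succ_abs_le l)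
  have hac := R0.mul_mem_part (i := i) ha hc
  have hbc := R0.mul_mem_part (i := i) hb hc
  have hbx : b ∉ projR0Datum.prime x := hWb x hxW
  have hbcx : b * R0.mono 1 (l + 1) (succ_abs_le l) ∉ projR0Datum.prime x := mul_notMem hbx hl
  obtain ⟨A, hA, hA'⟩ := exists_linearHom_eq hac
  obtain ⟨B, hB, hB'⟩ := exists_linearHom_eq hbc
  obtain ⟨G, hG⟩ := h ⟨i + 1, i.succ_pos⟩
  change P ⟶ (projSpaceDatum (Fin (2 ^ (i + 1)))).space at G
  change F ≫ G = (linearMap (i + 1)).toSpaceHom at hG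
  have hBx' : linearHom (i + 1) B ∉ projR0Datum.prime x := by
    rw [hB']
    exact hbcx
  have hBx : B ∉ (projSpaceDatum (Fin (2 ^ (i + 1)))).prime (ptMap (F ≫ G) x) := by
    rw [hG]
    exact hBx'
  have h1 : gfrac (D := projSpaceDatum (Fin (2 ^ (i + 1)))) (F ≫ G) A B hA hB x hBx =
      gfrac (𝟙 projR0Datum.space) a b ha hb x hbx := by
    have h2 : ∀ (H : projR0Datum.space ⟶ (projSpaceDatum (Fin (2 ^ (i + 1)))).space)
        (_ : H = (linearMap (i + 1)).toSpaceHom) hBx,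
        gfrac (D := projSpaceDatum (Fin (2 ^ (i + 1)))) H A B hA hB x hBx =
        gfrac (𝟙 projR0Datum.space) (linearHom (i + 1) A) (linearHom (i + 1) B)
          (linearHom_mem_part hA) (linearHom_mem_part hB) x hBx' := by
      rintro _ rfl hBx
      exact gfrac_comp (𝟙 projR0Datum.space) (linearMap (i + 1)) hA hB hBx hBx'
    refine (h2 _ hG hBx).trans (gfrac_eq _ _ _ _ _ _ _ ?_)
    change linearHom (i + 1) A * b = a * linearHom (i + 1) B
    rw [hA', hB']
    ac_rfl
  have h2 : germ (X := projR0Datum.space) (U := U) hx s =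
      gfrac (𝟙 projR0Datum.space) a b ha hb x hbx := by
    have h3 := germ_pull_sres (𝟙 projR0Datum.space) hW s (x := x) hxW hx
    rw [hs] at h3
    exact h3.symm.trans (germ_pull_sfrac (𝟙 projR0Datum.space) ha hb hWb hxW)
  let V : Opens P := pre G (basicOpen (D := projSpaceDatum (Fin (2 ^ (i + 1)))) B hB)
  let t : Sec P V := pull G _ (sfrac (D := projSpaceDatum (Fin (2 ^ (i + 1)))) A B hA hB
    (basicOpen (D := projSpaceDatum (Fin (2 ^ (i + 1)))) B hB) fun _ hy => hy)
  have h4 : germ (X := projR0Datum.space) (U := preim F V) (show x ∈ preim F V from hBx)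
      (comap F V t) = germ (X := projR0Datum.space) (U := U) hx s := h1.trans h2.symm
  obtain ⟨W', hWV, hWU, hxW', hW'⟩ := (germ_eq_iff _ _).1 h4
  exact ⟨V, t, W', hWU, hWV, hxW', hW'⟩

end Immersion

theorem isImmersion_of_isAssociated {P : Over specF12} (f : projR0 ⟶ P)
    (π : ∀ d : ℕ+, P ⟶ projSpace (Fin (2 ^ (d : ℕ)))) (h : ∀ d : ℕ+, IsAssociated d (f ≫ π d)) :
    WeakScheme.IsImmersion f.left := by
  have hG : ∀ d : ℕ+, ∃ G : P.left.space ⟶ (projSpaceDatum (Fin (2 ^ (d : ℕ)))).space,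
      WeakScheme.Hom.map f.left ≫ G = (linearMap d).toSpaceHom := fun d : ℕ+ =>
    ⟨toProjMap (π d), congrArg toProjMap ((h d).unique (isAssociated_linearMor d))⟩
  exact ⟨isEmbedding_of_comp_eq_linearMap hG, isStalkSurjective_of_comp_eq_linearMap hG⟩

/-! ### Initiality of `R₀`. -/

/-- An element of `R₀` given by a polynomial. -/
def R0.mk (f : Polynomial ℤ) (hf : IsR0 f) : R0 := ⟨f, hf⟩

namespace CommConvexoidRing

variable {B : Type u} [CommConvexoidRing B]

theorem box_zero_right (a : B) : box a 0 = gamma B * a := by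
  rw [gamma, mul_comm, mul_box, mul_one, mul_zero]

theorem box_zero_left (a : B) : box 0 a = gamma B * a := by
  rw [box_comm, box_zero_right]

/-- The medial law with one entry `0`. It is associativity of `⊞` up to factors of `γ`, and becomes
associativity of addition once `γ` is inverted. -/
theorem box_box_assoc (a b c : B) :
    box (box a b) (gamma B * c) = box (gamma B * a) (box b c) := by
  rw [← box_zero_right, ← box_zero_right, box_comm c 0, box_box_comm]

theorem GammaRegular.mul_left_cancel (h : GammaRegular B) (s : Submonoid.powers (gamma B))
    {a b : B} (hab : s * a = s * b) : a = b := by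
  obtain ⟨_, n, rfl⟩ := s
  change gamma B ^ n * a = gamma B ^ n * b at hab
  induction n with
  | zero => simpa using hab
  | succ n ih =>
    rw [pow_succ', mul_assoc, mul_assoc] at hab
    exact ih (h hab)

/-- The localization of a commutative convexoid ring at its fundamental constant. -/
def GammaLoc (_ : GammaRegular B) : Type u := Localization (Submonoid.powers (gamma B))

namespace GammaLoc

variable (h : GammaRegular B)

noncomputable instance : CommMonoidWithZero (GammaLoc h) :=
  inferInstanceAs (CommMonoidWithZero (Localization (Submonoid.powers (gamma B))))

/-- The fraction `a / s`. -/
def fraction (a : B) (s : Submonoid.powers (gamma B)) : GammaLoc h := Localization.mk a s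

/-- The fundamental constant as a denominator. -/
def den : Submonoid.powers (gamma B) := ⟨gamma B, Submonoid.mem_powers _⟩

variable {h}

theorem exists_fraction (x : GammaLoc h) : ∃ a s, x = fraction h a s :=
  Localization.induction_on x fun y => ⟨y.1, y.2, rfl⟩

theorem r_iff (a b : B) (s t : Submonoid.powers (gamma B)) (h : GammaRegular B) :
    Localization.r (Submonoid.powers (gamma B)) (a, s) (b, t) ↔ t * a = s * b := by
  rw [Localization.r_iff_exists]
  exact ⟨fun ⟨c, hc⟩ => h.mul_left_cancel c hc, fun hc => ⟨1, congrArg _ hc⟩⟩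

theorem fraction_eq_iff {a b : B} {s t : Submonoid.powers (gamma B)} :
    fraction h a s = fraction h b t ↔ t * a = s * b :=
  Localization.mk_eq_mk_iff.trans (r_iff a b s t h)

theorem fraction_mul (a b : B) (s t : Submonoid.powers (gamma B)) :
    fraction h a s * fraction h b t = fraction h (a * b) (s * t) := Localization.mk_mul a b s t

theorem fraction_zero (s : Submonoid.powers (gamma B)) : fraction h 0 s = 0 := Localization.mk_zero s

theorem fraction_one : fraction h 1 1 = 1 := Localization.mk_one

/-- Since `⊞` should be `γ` times addition, the sum over a common denominator carries one further
factor `γ` in the denominator. -/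
noncomputable instance : Add (GammaLoc h) where
  add x y := Localization.liftOn₂ x y
    (fun a s b t => fraction h (box (t * a) (s * b)) (den * s * t)) fun {a a' s s' b b' t t'} h1 h2 => by
      rw [r_iff _ _ _ _ h] at h1 h2
      refine fraction_eq_iff.2 ?_
      have key : ∀ d s s' t t' a a' : B, s' * a = s * a' →
          d * s' * t' * (t * a) = d * s * t * (t' * a') := fun d s s' t t' a a' h1 => by
        calc d * s' * t' * (t * a) = d * t * t' * (s' * a) := by ac_rfl
          _ = d * s * t * (t' * a') := by rw [h1]; ac_rfl
      have h3 := key (den : Submonoid.powers (gamma B)) s s' t t' a a' h1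
      have h4 := key (den : Submonoid.powers (gamma B)) t t' s s' b b' h2
      rw [mul_right_comm _ (t' : B), mul_right_comm _ (t : B)] at h4
      rw [mul_box, mul_box]
      exact congrArg₂ box h3 h4

theorem fraction_add (a b : B) (s t : Submonoid.powers (gamma B)) :
    fraction h a s + fraction h b t = fraction h (box (t * a) (s * b)) (den * s * t) := rfl

noncomputable instance : Neg (GammaLoc h) where
  neg x := Localization.liftOn x (fun a s => fraction h (-a) s) fun {a b s t} h1 => by
    rw [r_iff _ _ _ _ h] at h1
    exact fraction_eq_iff.2 (by rw [CommConvexoidRing.mul_neg, h1, CommConvexoidRing.mul_neg])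

theorem neg_fraction (a : B) (s : Submonoid.powers (gamma B)) : -fraction h a s = fraction h (-a) s := rfl

theorem coe_den : ((den : Submonoid.powers (gamma B)) : B) = gamma B := rfl

protected theorem zero_add (x : GammaLoc h) : 0 + x = x := by
  obtain ⟨a, s, rfl⟩ := exists_fraction x
  rw [← fraction_zero 1, fraction_add, fraction_eq_iff, mul_zero, box_zero_left]
  push_cast
  rw [coe_den]
  ac_rfl

protected theorem add_comm (x y : GammaLoc h) : x + y = y + x := by
  obtain ⟨a, s, rfl⟩ := exists_fraction x
  obtain ⟨b, t, rfl⟩ := exists_fraction y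
  rw [fraction_add, fraction_add, box_comm]
  congr 1
  ac_rfl

protected theorem add_assoc (x y z : GammaLoc h) : x + y + z = x + (y + z) := by
  obtain ⟨a, s, rfl⟩ := exists_fraction x
  obtain ⟨b, t, rfl⟩ := exists_fraction y
  obtain ⟨c, u, rfl⟩ := exists_fraction z
  rw [fraction_add, fraction_add, fraction_add, fraction_add]
  have h1 : (u : B) * box (t * a) (s * b) = box (t * u * a) (s * u * b) := by
    rw [mul_box]
    congr 1 <;> ac_rfl
  have h2 : ((den * s * t : Submonoid.powers (gamma B)) : B) * c = gamma B * (s * t * c) := by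
    push_cast
    rw [coe_den]
    ac_rfl
  have h3 : (s : B) * box (u * b) (t * c) = box (s * u * b) (s * t * c) := by
    rw [mul_box]
    congr 1 <;> ac_rfl
  have h4 : ((den * t * u : Submonoid.powers (gamma B)) : B) * a = gamma B * (t * u * a) := by
    push_cast
    rw [coe_den]
    ac_rfl
  rw [h1, h2, h3, h4, box_box_assoc]
  congr 1
  ac_rfl

protected theorem neg_add_cancel (x : GammaLoc h) : -x + x = 0 := by
  obtain ⟨a, s, rfl⟩ := exists_fraction x
  rw [neg_fraction, fraction_add, CommConvexoidRing.mul_neg, box_comm, box_neg, fraction_zero]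

protected theorem left_distrib (x y z : GammaLoc h) : x * (y + z) = x * y + x * z := by
  obtain ⟨a, s, rfl⟩ := exists_fraction x
  obtain ⟨b, t, rfl⟩ := exists_fraction y
  obtain ⟨c, u, rfl⟩ := exists_fraction z
  rw [fraction_add, fraction_mul, fraction_mul, fraction_mul, fraction_add, fraction_eq_iff, mul_box, mul_box, mul_box]
  push_cast
  congr 1 <;> ac_rfl

noncomputable instance : CommRing (GammaLoc h) where
  __ := (inferInstance : CommMonoidWithZero (GammaLoc h))
  add_assoc := GammaLoc.add_assoc
  zero_add := GammaLoc.zero_add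
  add_zero x := by rw [GammaLoc.add_comm, GammaLoc.zero_add]
  add_comm := GammaLoc.add_comm
  neg_add_cancel := GammaLoc.neg_add_cancel
  left_distrib := GammaLoc.left_distrib
  right_distrib x y z := by
    rw [mul_comm, GammaLoc.left_distrib, mul_comm z, mul_comm z]
  nsmul := nsmulRec
  zsmul := zsmulRec

theorem fraction_mul_one (a b : B) : fraction h (a * b) 1 = fraction h a 1 * fraction h b 1 := by
  rw [fraction_mul, mul_one]

theorem fraction_box_one (a b : B) : fraction h (box a b) 1 = fraction h (gamma B) 1 * (fraction h a 1 + fraction h b 1) := by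
  rw [fraction_add, fraction_mul, fraction_eq_iff]
  push_cast
  rw [coe_den]
  simp only [one_mul, mul_one]

/-- Regularity of `γ` enters here: identities in `B` can be checked in the localization, which is a
ring. -/
theorem fraction_one_injective : Function.Injective fun a : B => fraction h a 1 := fun a b hab => by
  have := fraction_eq_iff.1 hab
  rwa [OneMemClass.coe_one, one_mul, one_mul] at this

end GammaLoc

/-- `R0` is generated by `0` and `1` under operations that a homomorphism preserves. -/
theorem Hom.ext_R0 (χ χ' : Hom R0 B) : χ = χ' := by
  have hbox : ∀ (χ : Hom R0 B) (f g : R0), χ.toMonoidWithZeroHom (box f g) =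
      box (χ.toMonoidWithZeroHom f) (χ.toMonoidWithZeroHom g) := fun χ => χ.map_box
  have hneg : ∀ (χ : Hom R0 B) (f : R0), χ.toMonoidWithZeroHom (-f) =
      -χ.toMonoidWithZeroHom f := fun χ => χ.map_neg
  have key : ∀ f hf, χ.toMonoidWithZeroHom (R0.mk f hf) =
      χ'.toMonoidWithZeroHom (R0.mk f hf) := by
    intro f hf
    induction hf with
    | zero =>
      rw [show R0.mk 0 .zero = 0 from rfl, map_zero, map_zero]
    | one =>
      rw [show R0.mk 1 .one = 1 from rfl, map_one, map_one]
    | @mul f g hf hg ih ih' =>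
      rw [show R0.mk (f * g) (.mul hf hg) = (R0.mk f hf) * (R0.mk g hg) from rfl, map_mul,
        map_mul, ih, ih']
    | @box f g hf hg ih ih' =>
      rw [show R0.mk (Polynomial.X * (f + g)) (.box hf hg) = box (R0.mk f hf) (R0.mk g hg)
        from rfl, hbox, hbox, ih, ih']
    | @neg f hf ih =>
      rw [show R0.mk (-f) (.neg hf) = -(R0.mk f hf) from rfl, hneg, hneg, ih]
  obtain ⟨χ, _, _⟩ := χ
  obtain ⟨χ', _, _⟩ := χ'
  obtain rfl : χ = χ' := MonoidWithZeroHom.ext fun f => key f.1 f.2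
  rfl

open GammaLoc Polynomial in
-- The map to `B` is evaluation of polynomials at `γ_B` in the ring `B[1/γ_B]`, which sends `R0`
-- into `B`.
theorem isInitialConvexoidRing_R0 : IsInitialConvexoidRing.{u} R0 := by
  refine ⟨fun f g hfg => ?_, fun B _ h => ?_⟩
  -- The fundamental constant `1 ⊞ 0` of `R0` is `X * (1 + 0)`.
  · have h1 : (X * (1 + 0) : ℤ[X]) * f.1 = X * (1 + 0) * g.1 := congrArg Subtype.val hfg
    rw [add_zero, mul_one] at h1
    exact Subtype.ext (mul_left_cancel₀ X_ne_zero h1)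
  · let φ : ℤ[X] →+* GammaLoc h := eval₂RingHom (Int.castRingHom _) (fraction h (gamma B) 1)
    have hφX : φ X = fraction h (gamma B) 1 := eval₂_X _ _
    -- Elements with denominator `1` are closed under all the generating operations; for `⊞` the
    -- factor `γ` cancels the denominator that addition introduces.
    have hφ : ∀ f : R0, ∃ b : B, fraction h b 1 = φ f.1 := by
      rintro ⟨f, hf⟩
      induction hf with
      | zero => exact ⟨0, by rw [fraction_zero, map_zero]⟩
      | one => exact ⟨1, by rw [fraction_one, map_one]⟩
      | mul _ _ ha hb =>
        obtain ⟨a, ha⟩ := ha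
        obtain ⟨b, hb⟩ := hb
        exact ⟨a * b, by rw [fraction_mul_one, ha, hb, map_mul]⟩
      | box _ _ ha hb =>
        obtain ⟨a, ha⟩ := ha
        obtain ⟨b, hb⟩ := hb
        exact ⟨box a b, by rw [fraction_box_one, ha, hb, map_mul, map_add, hφX]⟩
      | neg _ ha =>
        obtain ⟨a, ha⟩ := ha
        exact ⟨-a, by rw [← neg_fraction, ha, map_neg]⟩
    choose ψ hψ using hφ
    refine ⟨⟨⟨⟨⟨⟨ψ, ?_⟩, ?_, ?_⟩, ?_, ?_⟩⟩, ?_⟩⟩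
    · refine fraction_one_injective (h := h) ?_
      change fraction h (ψ 0) 1 = fraction h 0 1
      rw [hψ, fraction_zero]
      exact map_zero φ
    · refine fraction_one_injective (h := h) ?_
      change fraction h (ψ 1) 1 = fraction h 1 1
      rw [hψ, fraction_one]
      exact map_one φ
    · intro f g
      refine fraction_one_injective (h := h) ?_
      change fraction h (ψ (f * g)) 1 = fraction h (ψ f * ψ g) 1
      rw [hψ, fraction_mul_one, hψ, hψ]
      exact map_mul φ f.1 g.1
    · intro f g
      refine fraction_one_injective (h := h) ?_
      change fraction h (ψ (box f g)) 1 = fraction h (box (ψ f) (ψ g)) 1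
      rw [hψ, fraction_box_one, hψ, hψ, ← hφX, ← map_add, ← map_mul]
      rfl
    · intro f
      refine fraction_one_injective (h := h) ?_
      change fraction h (ψ (-f)) 1 = fraction h (-ψ f) 1
      rw [hψ, ← neg_fraction, hψ, ← map_neg]
      rfl
    · exact fun χ => Hom.ext_R0 χ _

end CommConvexoidRing

theorem mainTheorem5 :
    CommConvexoidRing.IsInitialConvexoidRing.{u} R0 ∧
    (∀ d : ℕ+, projR0Datum.IsLineBundle (d : ℕ)) ∧
    ∃ f : ∀ d : ℕ+, projR0 ⟶ projSpace (Fin (2 ^ (d : ℕ))),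
      (∀ d : ℕ+, IsAssociated d (f d) ∧ ∀ g, IsAssociated d g → g = f d) ∧
      ∃ _ : HasProduct fun d : ℕ+ => projSpace (Fin (2 ^ (d : ℕ))),
        WeakScheme.IsImmersion (Pi.lift f).left := by
  refine ⟨CommConvexoidRing.isInitialConvexoidRing_R0, fun d => isLineBundle_projR0Datum d,
    fun d => linearMor d, fun d => ⟨isAssociated_linearMor d, fun g hg =>
      hg.unique (isAssociated_linearMor d)⟩,
    hasProduct_projSpace fun d : ℕ+ => Fin (2 ^ (d : ℕ)), ?_⟩
  have := hasProduct_projSpace fun d : ℕ+ => Fin (2 ^ (d : ℕ))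
  refine isImmersion_of_isAssociated _ (Pi.π fun d : ℕ+ => projSpace (Fin (2 ^ (d : ℕ))))
    fun d : ℕ+ => ?_
  rw [Pi.lift_π]
  exact isAssociated_linearMor d
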